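/- Let $\gamma>1$. There is $\delta>0$, depending only on $\gamma$, such that for all constants $C_1,C_2,c>0$ there are $C,W_0>0$, depending only on $\gamma,C_1,C_2,c$, with the following property. Let $\zeta\in\mathbb C$ satisfy $|\zeta|=1$ and $\operatorname{Re}\zeta^2>0$, let $W\ge W_0$, and let $U:\mathbb R\to\mathbb C$ satisfy: (U1) $U$ is smooth and $U(0)=U'(0)=0$; (U2) $\zeta^2U''(0)$ is real and positive; (U3) $\operatorname{Re}U(x)\ge \frac1{C_1}\min(1,|x|^2)$ for all $x\in\mathbb R$; (U4) $U$ has an analytic extension to the strip $|\operatorname{Im}z|\le c$ satisfying $|U'(z)|\le C_2\,(\max(1,\operatorname{Re}U(z)))^{\gamma}$ for all $z$ in this strip. Then the kernel $$K(x,y)=\exp\Big\{-W^2\zeta^2(x-y)^2-\tfrac12U(x)-\tfrac12U(y)\Big\}$$ defines a bounded integral operator $K$ on $L_2(\mathbb R)$. Put $$\alpha=W\sqrt{\zeta^2U''(0)/2}>0,\qquad \mu=\sqrt{\frac{\pi}{W^2\zeta^2+\alpha}}\ \text{ (principal branch)},\qquad g_\alpha(x)=\Big(\frac{2\alpha}{\pi}\Big)^{1/4}e^{-\alpha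 x^2}.$$ Then the following hold. 1. $K$ has an eigenvalue $\lambda_0$ such that $|\lambda|<|\lambda_0|$ for every other eigenvalue $\lambda$ of $K$; its eigenspace is one-dimensional; and $\lambda_0=\mu(1+\varepsilon)$ for some $\varepsilon\in\mathbb C$ with $|\varepsilon|\le CW^{-1-\delta}$. 2. There is exactly one eigenfunction $u_0$ of $K$ for $\lambda_0$ with $\|u_0\|=1$ and $\langle u_0,g_\alpha\rangle\ge0$, and it satisfies $\|u_0-g_\alpha\|\le CW^{-\delta}$. 3. The subspace $\bar u_0^\perp$, the orthogonal complement of the complex conjugate of $u_0$, is invariant under $K$, and for every $n\in\mathbb N$ and every $u\in\bar u_0^\perp$, $$\|K^nu\|\le|\lambda_0|^n\Big(1-\sqrt{\frac{|U''(0)|}{2}}\,\frac{\operatorname{Re}\zeta^2}{W}+CW^{-1-\delta}\Big)^n\|u\|.$$ -/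

import Mathlib

open MeasureTheory
open scoped ContDiff

noncomputable section

/-- The complex Hilbert space `L₂(ℝ)` with respect to Lebesgue measure. -/
abbrev L2R : Type := Lp ℂ 2 (volume : Measure ℝ)

/-- The bounded operator `K` on `L₂(ℝ)` is the integral operator with kernel `k`: for every `u`
and almost every `x`, the function `y ↦ k x y * u y` is integrable and `K u x` is its integral. -/
def HasKernel (K : L2R →L[ℂ] L2R) (k : ℝ → ℝ → ℂ) : Prop :=
  ∀ u : L2R, ∀ᵐ x : ℝ, Integrable (fun y : ℝ => k x y * u y) ∧ K u x = ∫ y : ℝ, k x y * u y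

/-- A bounded operator on `L₂(ℝ)` is determined by its kernel. -/
theorem HasKernel.unique {K K' : L2R →L[ℂ] L2R} {k : ℝ → ℝ → ℂ} (h : HasKernel K k)
    (h' : HasKernel K' k) : K = K' := by
  ext1 u
  apply Lp.ext
  filter_upwards [h u, h' u] with x hx hx'
  rw [hx.2, hx'.2]

/-- The kernel `exp (-W² ζ² (x - y)² - U(x) / 2 - U(y) / 2)`. -/
def transferKernel (W : ℝ) (ζ : ℂ) (U : ℝ → ℂ) (x y : ℝ) : ℂ :=
  Complex.exp (-((W : ℂ) ^ 2 * ζ ^ 2 * ((x : ℂ) - (y : ℂ)) ^ 2) - U x / 2 - U y / 2)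

/-- The assumptions on the potential `U : ℝ → ℂ`, with their implicit constants `C₁`, `C₂`, `c`
and the growth exponent `γ` made explicit. -/
structure AdmissiblePotential (γ C₁ C₂ c : ℝ) (ζ : ℂ) (U : ℝ → ℂ) : Prop where
  smooth : ContDiff ℝ ∞ U
  map_zero : U 0 = 0
  deriv_zero : deriv U 0 = 0
  /-- `ζ² U''(0)` is a positive real number. -/
  second_deriv_real : (ζ ^ 2 * iteratedDeriv 2 U 0).im = 0
  second_deriv_pos : 0 < (ζ ^ 2 * iteratedDeriv 2 U 0).re
  lower_bound : ∀ x : ℝ, 1 / C₁ * min 1 (|x| ^ 2) ≤ (U x).re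
  /-- `U` extends analytically to the closed strip `|Im z| ≤ c`, with a bound on the derivative
  of the extension by a power of its real part. -/
  analytic_extension : ∃ V : ℂ → ℂ,
    AnalyticOnNhd ℂ V {z : ℂ | |z.im| ≤ c} ∧
    (∀ x : ℝ, V (x : ℂ) = U x) ∧
    ∀ z : ℂ, |z.im| ≤ c → ‖deriv V z‖ ≤ C₂ * (max 1 (V z).re) ^ γ

/-- `α = W √(ζ² U''(0) / 2)`, for `ζ² U''(0)` real and positive. -/
def saddleAlpha (W : ℝ) (ζ : ℂ) (U : ℝ → ℂ) : ℝ :=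
  W * Real.sqrt ((ζ ^ 2 * iteratedDeriv 2 U 0).re / 2)

/-- `μ = √(π / (W² ζ² + α))`, with the principal branch of the square root. -/
def saddleMu (W : ℝ) (ζ : ℂ) (U : ℝ → ℂ) : ℂ :=
  ((Real.pi : ℂ) / ((W : ℂ) ^ 2 * ζ ^ 2 + (saddleAlpha W ζ U : ℂ))) ^ (1 / 2 : ℂ)

/-- The Gaussian `g_α(x) = (2α/π)^{1/4} exp (-α x²)`. -/
def gaussFun (α x : ℝ) : ℝ :=
  (2 * α / Real.pi) ^ (1 / 4 : ℝ) * Real.exp (-α * x ^ 2)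

theorem memLp_gaussFun {α : ℝ} (hα : 0 < α) :
    MemLp (fun x : ℝ => (gaussFun α x : ℂ)) 2 (volume : Measure ℝ) := by
  have hreal : MemLp (gaussFun α) 2 (volume : Measure ℝ) := by
    have hc : Continuous (gaussFun α) := by
      unfold gaussFun
      fun_prop
    rw [memLp_two_iff_integrable_sq hc.aestronglyMeasurable]
    have h := (integrable_exp_neg_mul_sq (b := 2 * α) (by positivity)).const_mul
      (((2 * α / Real.pi) ^ (1 / 4 : ℝ)) ^ 2)
    refine h.congr (Filter.Eventually.of_forall fun x => ?_)
    simp only [gaussFun, mul_pow, ← Real.exp_nat_mul]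
    congr 2
    push_cast
    ring
  exact hreal.ofReal

/-- `g_α` as an element of `L₂(ℝ)` (for `α > 0`, the only case of interest). -/
def gaussL2 (α : ℝ) : L2R :=
  if hα : 0 < α then (memLp_gaussFun hα).toLp _ else 0

/-- `u` is an eigenfunction of `K` with eigenvalue `l`, normalised by `‖u‖ = 1` and
`⟨u, g⟩ ≥ 0` (that is, `⟨u, g⟩` is real and nonnegative). -/
def IsNormalizedEigenfunction (K : L2R →L[ℂ] L2R) (g : L2R) (l : ℂ) (u : L2R) : Prop :=
  K u = l • u ∧ ‖u‖ = 1 ∧ (inner ℂ u g).im = 0 ∧ 0 ≤ (inner ℂ u g).re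

/-- The subspace `ū^⊥`: the orthogonal complement of the complex conjugate of `u`. -/
def conjPerp (u : L2R) : Submodule ℂ L2R :=
  (Submodule.span ℂ {star u})ᗮ

end

/-! The operator $K$ is $e^{-U/2}$ times convolution with $e^{-A t^2}$ times $e^{-U/2}$, where
$A=W^2\zeta^2$. With $a=\sqrt{\zeta^2U''(0)/2}$ and $|\zeta|=1$, the potential near $0$ is
$a^2\overline{\zeta^2}x^2$ plus a cubic error. The model operator has the Mehler kernel
$e^{-A(x-y)^2-B(x^2+y^2)}$ with $B=D-A$, $D^2=A^2+\alpha^2$, $\alpha=Wa$; then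
$B=a^2\overline{\zeta^2}/2+O(W^{-2})$, so it matches $K$ near the saddle.

Since $\zeta^2U''(0)$ is real, $\alpha$ is real. The model then sends the coherent state of width
$\alpha$ and parameter $b$ to a multiple of the one with parameter $qb$, $q=A/(D+\alpha)$. The Gram
form of coherent states is a sum of squares of the $n$-th moments of the parameter, so the model
acts as a diagonal operator with entries proportional to $q^n$, with $g_\alpha$ at $n=0$. Its gap is
$1-|q|=a\operatorname{Re}\zeta^2/W+O(W^{-2})$ (`mehler_coherent`, `norm_sq_mehler_le`).

The gap passes to $K$ on $g_\alpha^\perp$ by localization at $|x|\sim R=W^{-5/14}$ with the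
partition $\cos^2+\sin^2=1$ (`norm_sq_le_of_partition`, `norm_apply_le_of_orthogonal`). Relative to
$|\mu|^2$ the errors are: cubic term $R^3=W^{-15/14}$; localization $W^{-2}R^{-2}=W^{-18/14}$; lost
orthogonality to $g_\alpha$, $W^{-4}R^{-8}=W^{-16/14}$. Away from the saddle $|e^{-U/2}|$ gains
about $R^2\gg W^{-1}$. All errors are $O(W^{-1-1/14})$, hence $\delta=1/14$. The constants are
uniform because (U3) and (U4) bound $U''(0)$ and bound $\operatorname{Re}\zeta^2$ from below
(`exists_saddleData`).

The rest is abstract (`spectral_gap_consequences`). An approximate eigenvector with a gap much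
larger than its error can be corrected to an exact eigenvector $u_0$ by a contraction. The kernel is
symmetric, so $K$ is symmetric for the bilinear form $\int uv$; hence $\bar u_0^\perp$ is invariant.
Its vectors are nearly orthogonal to $g_\alpha$ and inherit the gap. -/

/-! ### Schur test for kernels dominated by a Gaussian. -/

open scoped ENNReal in
theorem lintegral_enorm_sq_eq_eLpNorm_sq {E : Type*} [NormedAddCommGroup E] (f : ℝ → E) :
    ∫⁻ x, ‖f x‖ₑ ^ 2 = eLpNorm f 2 volume ^ 2 := by
  rw [eLpNorm_eq_lintegral_rpow_enorm_toReal (by norm_num) (by norm_num), ← ENNReal.rpow_natCast,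
    ← ENNReal.rpow_mul]
  norm_num

open scoped ENNReal in
theorem ofReal_norm_sq_eq_lintegral (u : L2R) :
    ENNReal.ofReal (‖u‖ ^ 2) = ∫⁻ x, ‖u x‖ₑ ^ 2 := by
  rw [lintegral_enorm_sq_eq_eLpNorm_sq, Lp.norm_def, ENNReal.ofReal_pow (by positivity),
    ENNReal.ofReal_toReal (Lp.eLpNorm_ne_top u)]

open scoped ENNReal in
theorem lintegral_sq_le_measure_mul {ν : Measure ℝ} {f : ℝ → ℝ≥0∞} (hf : AEMeasurable f ν) :
    (∫⁻ y, f y ∂ν) ^ 2 ≤ ν Set.univ * ∫⁻ y, f y ^ 2 ∂ν := by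
  have h := ENNReal.lintegral_mul_le_Lp_mul_Lq ν Real.HolderConjugate.two_two hf
    (aemeasurable_const (b := (1 : ℝ≥0∞)))
  simp only [Pi.mul_apply, mul_one, ENNReal.one_rpow, lintegral_const, one_mul] at h
  calc (∫⁻ y, f y ∂ν) ^ 2 ≤ ((∫⁻ y, f y ^ (2 : ℝ) ∂ν) ^ (1 / 2 : ℝ) * (ν Set.univ) ^ (1 / 2 : ℝ)) ^ 2 := by
        gcongr
    _ = _ := by
        rw [mul_pow, ← ENNReal.rpow_natCast, ← ENNReal.rpow_natCast, ← ENNReal.rpow_mul,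
          ← ENNReal.rpow_mul, mul_comm]
        norm_num

open scoped ENNReal in
theorem lintegral_gauss {b : ℝ} (hb : 0 < b) :
    ∫⁻ t : ℝ, ENNReal.ofReal (Real.exp (-b * t ^ 2)) = ENNReal.ofReal (Real.sqrt (Real.pi / b)) := by
  rw [← ofReal_integral_eq_lintegral_ofReal (integrable_exp_neg_mul_sq hb)
    (Filter.Eventually.of_forall fun _ => (Real.exp_pos _).le), integral_gaussian]

-- Cauchy–Schwarz for the measure with Gaussian density in `y`, followed by Tonelli. Both marginals
-- of the kernel have mass $\sqrt{\pi/b}$, and their product is the constant.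
open scoped ENNReal in
theorem lintegral_gauss_conv_sq_le {b : ℝ} (hb : 0 < b) {f : ℝ → ℝ≥0∞} (hf : Measurable f) :
    ∫⁻ x, (∫⁻ y, ENNReal.ofReal (Real.exp (-b * (x - y) ^ 2)) * f y) ^ 2 ≤
      ENNReal.ofReal (Real.pi / b) * ∫⁻ y, f y ^ 2 := by
  have hm : Measurable fun p : ℝ × ℝ => ENNReal.ofReal (Real.exp (-b * (p.1 - p.2) ^ 2)) := by
    fun_prop
  set S := ENNReal.ofReal (Real.sqrt (Real.pi / b)) with hS
  have hright (x : ℝ) : ∫⁻ y, ENNReal.ofReal (Real.exp (-b * (x - y) ^ 2)) = S := by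
    rw [lintegral_sub_left_eq_self (fun t => ENNReal.ofReal (Real.exp (-b * t ^ 2))) x,
      lintegral_gauss hb]
  have hleft (y : ℝ) : ∫⁻ x, ENNReal.ofReal (Real.exp (-b * (x - y) ^ 2)) = S := by
    rw [lintegral_sub_right_eq_self (fun t => ENNReal.ofReal (Real.exp (-b * t ^ 2))) y,
      lintegral_gauss hb]
  have hpt (x : ℝ) : (∫⁻ y, ENNReal.ofReal (Real.exp (-b * (x - y) ^ 2)) * f y) ^ 2 ≤
      S * ∫⁻ y, ENNReal.ofReal (Real.exp (-b * (x - y) ^ 2)) * f y ^ 2 := by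
    have hx : Measurable fun y : ℝ => ENNReal.ofReal (Real.exp (-b * (x - y) ^ 2)) := by fun_prop
    have h := lintegral_sq_le_measure_mul
      (ν := volume.withDensity fun y : ℝ => ENNReal.ofReal (Real.exp (-b * (x - y) ^ 2)))
      hf.aemeasurable
    rw [lintegral_withDensity_eq_lintegral_mul _ hx hf,
      lintegral_withDensity_eq_lintegral_mul _ hx (hf.pow_const 2),
      withDensity_apply _ MeasurableSet.univ, Measure.restrict_univ, hright] at h
    exact h
  calc _ ≤ ∫⁻ x, S * ∫⁻ y, ENNReal.ofReal (Real.exp (-b * (x - y) ^ 2)) * f y ^ 2 :=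
        lintegral_mono hpt
    _ = S * ∫⁻ x, ∫⁻ y, ENNReal.ofReal (Real.exp (-b * (x - y) ^ 2)) * f y ^ 2 := by
        rw [lintegral_const_mul']
        exact ENNReal.ofReal_ne_top
    _ = S * ∫⁻ y, ∫⁻ x, ENNReal.ofReal (Real.exp (-b * (x - y) ^ 2)) * f y ^ 2 := by
        rw [lintegral_lintegral_swap]
        exact (hm.mul ((hf.comp measurable_snd).pow_const 2)).aemeasurable
    _ = S * ∫⁻ y, S * f y ^ 2 := by
        congr 1
        refine lintegral_congr fun y => ?_
        rw [lintegral_mul_const _ (by fun_prop), hleft]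
    _ = _ := by
        rw [lintegral_const_mul _ (hf.pow_const 2), ← mul_assoc, hS,
          ← ENNReal.ofReal_mul (Real.sqrt_nonneg _), Real.mul_self_sqrt (by positivity)]

theorem memLp_gauss_shift {b : ℝ} (hb : 0 < b) (x : ℝ) :
    MemLp (fun y : ℝ => Real.exp (-b * (x - y) ^ 2)) 2 volume := by
  have hc : Continuous fun y : ℝ => Real.exp (-b * (x - y) ^ 2) := by fun_prop
  rw [memLp_two_iff_integrable_sq hc.aestronglyMeasurable]
  have h := (integrable_exp_neg_mul_sq (b := 2 * b) (by positivity)).comp_sub_left x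
  refine h.congr (Filter.Eventually.of_forall fun y => ?_)
  simp only [← Real.exp_nat_mul]
  congr 1
  push_cast
  ring

theorem integrable_gauss_mul {b : ℝ} (hb : 0 < b) (u : L2R) (x : ℝ) :
    Integrable fun y : ℝ => Real.exp (-b * (x - y) ^ 2) * ‖u y‖ :=
  (memLp_gauss_shift hb x).integrable_mul (Lp.memLp u).norm

theorem integrable_kernel_mul {b : ℝ} (hb : 0 < b) {k : ℝ → ℝ → ℂ}
    (hk : Continuous (Function.uncurry k)) (hbd : ∀ x y, ‖k x y‖ ≤ Real.exp (-b * (x - y) ^ 2))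
    (u : L2R) (x : ℝ) : Integrable fun y : ℝ => k x y * u y := by
  refine (integrable_gauss_mul hb u x).mono' ?_ (Filter.Eventually.of_forall fun y => ?_)
  · exact (hk.comp (by fun_prop : Continuous fun y : ℝ => (x, y))).aestronglyMeasurable.mul
      (Lp.aestronglyMeasurable u)
  · rw [norm_mul]
    exact mul_le_mul_of_nonneg_right (hbd x y) (norm_nonneg _)

open scoped ENNReal in
theorem enorm_le_lintegral_gauss {b c : ℝ} (hc : 0 ≤ c) {a : ℂ} {x : ℝ} (w : L2R)
    (h : ‖a‖ ≤ c * ∫ y, Real.exp (-b * (x - y) ^ 2) * ‖w y‖) :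
    ‖a‖ₑ ≤ ENNReal.ofReal c * ∫⁻ y, ENNReal.ofReal (Real.exp (-b * (x - y) ^ 2)) * ‖w y‖ₑ := by
  rw [← ofReal_norm]
  refine (ENNReal.ofReal_le_ofReal h).trans ?_
  rw [ENNReal.ofReal_mul hc]
  gcongr
  refine (ENNReal.ofReal_le_ofReal (le_abs_self _)).trans ?_
  rw [← Real.norm_eq_abs, ofReal_norm]
  refine (enorm_integral_le_lintegral_enorm _).trans (le_of_eq (lintegral_congr fun y => ?_))
  rw [enorm_mul, enorm_norm, Real.enorm_eq_ofReal (Real.exp_pos _).le]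

open scoped ENNReal in
theorem lintegral_sq_le_of_gauss_dominated {b c : ℝ} (hb : 0 < b) (hc : 0 ≤ c) {v : ℝ → ℂ} (w : L2R)
    (h : ∀ᵐ x : ℝ, ‖v x‖ ≤ c * ∫ y, Real.exp (-b * (x - y) ^ 2) * ‖w y‖) :
    ∫⁻ x, ‖v x‖ₑ ^ 2 ≤ ENNReal.ofReal ((c * Real.sqrt (Real.pi / b) * ‖w‖) ^ 2) := by
  have hw : Measurable fun y => ‖w y‖ₑ := (Lp.stronglyMeasurable w).enorm
  calc ∫⁻ x, ‖v x‖ₑ ^ 2 ≤ ∫⁻ x, ENNReal.ofReal c ^ 2 *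
        (∫⁻ y, ENNReal.ofReal (Real.exp (-b * (x - y) ^ 2)) * ‖w y‖ₑ) ^ 2 := by
        refine lintegral_mono_ae ?_
        filter_upwards [h] with x hx
        rw [← mul_pow]
        gcongr
        exact enorm_le_lintegral_gauss hc w hx
    _ = ENNReal.ofReal c ^ 2 *
        ∫⁻ x, (∫⁻ y, ENNReal.ofReal (Real.exp (-b * (x - y) ^ 2)) * ‖w y‖ₑ) ^ 2 :=
        lintegral_const_mul' _ _ (by simp)
    _ ≤ ENNReal.ofReal c ^ 2 * (ENNReal.ofReal (Real.pi / b) * ∫⁻ y, ‖w y‖ₑ ^ 2) := by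
        gcongr
        exact lintegral_gauss_conv_sq_le hb hw
    _ = _ := by
        rw [← ofReal_norm_sq_eq_lintegral, ← ENNReal.ofReal_pow hc,
          ← ENNReal.ofReal_mul (by positivity), ← ENNReal.ofReal_mul (by positivity), mul_pow,
          mul_pow, Real.sq_sqrt (by positivity)]
        ring_nf

theorem norm_le_of_gauss_dominated {b c : ℝ} (hb : 0 < b) (hc : 0 ≤ c) (v w : L2R)
    (h : ∀ᵐ x : ℝ, ‖v x‖ ≤ c * ∫ y, Real.exp (-b * (x - y) ^ 2) * ‖w y‖) :
    ‖v‖ ≤ c * Real.sqrt (Real.pi / b) * ‖w‖ := by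
  have h1 := lintegral_sq_le_of_gauss_dominated hb hc w h
  rw [← ofReal_norm_sq_eq_lintegral, ENNReal.ofReal_le_ofReal_iff (by positivity)] at h1
  exact le_of_sq_le_sq h1 (by positivity)

theorem aestronglyMeasurable_kernel_integral {k : ℝ → ℝ → ℂ}
    (hk : Continuous (Function.uncurry k)) (u : L2R) :
    AEStronglyMeasurable (fun x : ℝ => ∫ y : ℝ, k x y * u y) volume := by
  have h : StronglyMeasurable (Function.uncurry fun x y : ℝ => k x y * u y) :=
    hk.stronglyMeasurable.mul ((Lp.stronglyMeasurable u).comp_measurable measurable_snd)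
  exact h.integral_prod_right.aestronglyMeasurable

theorem norm_kernel_integral_le {b : ℝ} (hb : 0 < b) {k : ℝ → ℝ → ℂ}
    (hbd : ∀ x y, ‖k x y‖ ≤ Real.exp (-b * (x - y) ^ 2)) (u : L2R) (x : ℝ) :
    ‖∫ y : ℝ, k x y * u y‖ ≤ 1 * ∫ y, Real.exp (-b * (x - y) ^ 2) * ‖u y‖ := by
  rw [one_mul]
  refine norm_integral_le_of_norm_le (integrable_gauss_mul hb u x)
    (Filter.Eventually.of_forall fun y => ?_)
  rw [norm_mul]
  exact mul_le_mul_of_nonneg_right (hbd x y) (norm_nonneg _)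

theorem memLp_kernel_integral {b : ℝ} (hb : 0 < b) {k : ℝ → ℝ → ℂ}
    (hk : Continuous (Function.uncurry k)) (hbd : ∀ x y, ‖k x y‖ ≤ Real.exp (-b * (x - y) ^ 2))
    (u : L2R) : MemLp (fun x : ℝ => ∫ y : ℝ, k x y * u y) 2 volume := by
  refine ⟨aestronglyMeasurable_kernel_integral hk u, ?_⟩
  have h1 := lintegral_sq_le_of_gauss_dominated hb zero_le_one u
    (Filter.Eventually.of_forall fun x => norm_kernel_integral_le hb hbd u x)
  rw [lintegral_enorm_sq_eq_eLpNorm_sq] at h1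
  by_contra hcon
  rw [not_lt, top_le_iff] at hcon
  rw [hcon] at h1
  simp at h1

/-- The Schur test for kernels dominated by a Gaussian convolution kernel. -/
theorem exists_hasKernel {b : ℝ} (hb : 0 < b) {k : ℝ → ℝ → ℂ}
    (hk : Continuous (Function.uncurry k)) (hbd : ∀ x y, ‖k x y‖ ≤ Real.exp (-b * (x - y) ^ 2)) :
    ∃ T : L2R →L[ℂ] L2R, HasKernel T k ∧ ∀ u, ∀ᵐ x : ℝ, T u x = ∫ y : ℝ, k x y * u y := by
  have hae (u : L2R) := (memLp_kernel_integral hb hk hbd u).coeFn_toLp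
  let T₀ : L2R →ₗ[ℂ] L2R :=
    { toFun := fun u => (memLp_kernel_integral hb hk hbd u).toLp _
      map_add' := fun u v => by
        apply Lp.ext
        filter_upwards [hae (u + v), hae u, hae v, Lp.coeFn_add
          ((memLp_kernel_integral hb hk hbd u).toLp _)
          ((memLp_kernel_integral hb hk hbd v).toLp _)] with x h1 h2 h3 h4
        rw [h1, h4, Pi.add_apply, h2, h3, ← integral_add (integrable_kernel_mul hb hk hbd u x)
          (integrable_kernel_mul hb hk hbd v x)]
        refine integral_congr_ae ?_
        filter_upwards [Lp.coeFn_add u v] with y hy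
        rw [hy, Pi.add_apply, mul_add]
      map_smul' := fun c u => by
        apply Lp.ext
        filter_upwards [hae (c • u), hae u, Lp.coeFn_smul c
          ((memLp_kernel_integral hb hk hbd u).toLp _)] with x h1 h2 h3
        rw [h1, RingHom.id_apply, h3, Pi.smul_apply, h2, smul_eq_mul, ← integral_const_mul]
        refine integral_congr_ae ?_
        filter_upwards [Lp.coeFn_smul c u] with y hy
        rw [hy, Pi.smul_apply, smul_eq_mul]
        ring }
  refine ⟨T₀.mkContinuous (1 * Real.sqrt (Real.pi / b)) fun u => ?_, fun u => ?_, fun u => ?_⟩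
  · refine norm_le_of_gauss_dominated hb zero_le_one _ _ ?_
    filter_upwards [hae u] with x hx
    refine (le_of_eq ?_).trans (norm_kernel_integral_le hb hbd u x)
    exact congrArg norm hx
  · filter_upwards [hae u] with x hx
    exact ⟨integrable_kernel_mul hb hk hbd u x, hx⟩
  · exact hae u

/-! ### The complex bilinear form $\int uv$ and symmetric kernels. -/

theorem inner_eq_integral (u v : L2R) : inner ℂ u v = ∫ x, (starRingEnd ℂ) (u x) * v x := by
  rw [L2.inner_def]
  refine integral_congr_ae (Filter.Eventually.of_forall fun x => ?_)
  simp [RCLike.inner_apply, mul_comm]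

theorem inner_star_eq_integral (u v : L2R) : inner ℂ (star u) v = ∫ x, u x * v x := by
  rw [inner_eq_integral]
  refine integral_congr_ae ?_
  filter_upwards [Lp.coeFn_star u] with x hx
  rw [hx]
  simp

theorem inner_star_comm (u v : L2R) : inner ℂ (star u) v = inner ℂ (star v) u := by
  simp only [inner_star_eq_integral, mul_comm]

theorem integrable_kernel_prod {b : ℝ} (hb : 0 < b) {k : ℝ → ℝ → ℂ}
    (hk : Continuous (Function.uncurry k)) (hbd : ∀ x y, ‖k x y‖ ≤ Real.exp (-b * (x - y) ^ 2))
    (u v : L2R) :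
    Integrable (Function.uncurry fun x y : ℝ => v x * (k x y * u y)) (volume.prod volume) := by
  have hsm : AEStronglyMeasurable (Function.uncurry fun x y : ℝ => v x * (k x y * u y))
      (volume.prod volume) :=
    ((((Lp.stronglyMeasurable v).comp_measurable measurable_fst).mul
      (hk.stronglyMeasurable.mul
        ((Lp.stronglyMeasurable u).comp_measurable measurable_snd)))).aestronglyMeasurable
  rw [integrable_prod_iff hsm]
  refine ⟨Filter.Eventually.of_forall fun x =>
    (integrable_kernel_mul hb hk hbd u x).const_mul (v x), ?_⟩
  let u' : L2R := (Lp.memLp u).norm.ofReal.toLp _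
  have hu' : ∀ᵐ y, u' y = (‖u y‖ : ℂ) := MemLp.coeFn_toLp _
  -- The modulus of the kernel is again a Gaussian-dominated kernel, so applied to $|u|$ it gives an
  -- $L_2$ function, whose product with $|v|$ is integrable.
  let k' : ℝ → ℝ → ℂ := fun x y => ((‖k x y‖ : ℝ) : ℂ)
  have hk' : Continuous (Function.uncurry k') := by
    have : Continuous fun p : ℝ × ℝ => ((‖Function.uncurry k p‖ : ℝ) : ℂ) := by fun_prop
    exact this
  have hm := memLp_kernel_integral hb hk' (fun x y => by simpa [k'] using hbd x y) u'
  have hi := ((Lp.memLp v).norm).integrable_mul hm.norm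
  refine hi.congr (Filter.Eventually.of_forall fun x => ?_)
  have : ∫ y, k' x y * u' y = ((∫ y, ‖k x y‖ * ‖u y‖ : ℝ) : ℂ) := by
    rw [← integral_complex_ofReal]
    refine integral_congr_ae ?_
    filter_upwards [hu'] with y hy
    rw [hy]
    simp [k']
  simp only [Pi.mul_apply, Function.uncurry_apply_pair, norm_mul, this, Complex.norm_real,
    integral_const_mul]
  rw [Real.norm_of_nonneg]
  exact integral_nonneg fun y => by positivity

/-- Operators with symmetric kernels are symmetric with respect to the bilinear form `∫ u v`. -/
theorem HasKernel.inner_star_symm {b : ℝ} (hb : 0 < b) {k : ℝ → ℝ → ℂ}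
    (hk : Continuous (Function.uncurry k)) (hbd : ∀ x y, ‖k x y‖ ≤ Real.exp (-b * (x - y) ^ 2))
    (hsym : ∀ x y, k x y = k y x) {T : L2R →L[ℂ] L2R} (hT : HasKernel T k) (u v : L2R) :
    inner ℂ (star v) (T u) = inner ℂ (star (T v)) u := by
  rw [inner_star_comm (T v) u, inner_star_eq_integral, inner_star_eq_integral]
  have h1 (u v : L2R) : ∫ x, v x * T u x = ∫ x, ∫ y, v x * (k x y * u y) := by
    refine integral_congr_ae ?_
    filter_upwards [hT u] with x hx
    rw [hx.2, integral_const_mul]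
  rw [h1, h1, integral_integral_swap (integrable_kernel_prod hb hk hbd u v)]
  refine integral_congr_ae (Filter.Eventually.of_forall fun y => ?_)
  refine integral_congr_ae (Filter.Eventually.of_forall fun x => ?_)
  simp only [hsym x y]
  ring

/-! ### Coherent states: Gram matrix, density and sums of squares. -/

theorem ofReal_norm_sq_eq_inner {H : Type*} [NormedAddCommGroup H] [InnerProductSpace ℂ H] (u : H) :
    ((‖u‖ ^ 2 : ℝ) : ℂ) = inner ℂ u u := by
  rw [inner_self_eq_norm_sq_to_K]
  simp

/-- The normalised coherent state of width `α` and parameter `b`. -/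
noncomputable def coherentFun (α : ℝ) (b : ℂ) (x : ℝ) : ℂ :=
  (((2 * α / Real.pi) ^ (1 / 4 : ℝ) : ℝ) : ℂ) *
    Complex.exp (-(α : ℂ) * (x : ℂ) ^ 2 + b * x + -(b ^ 2 / (8 * α)))

theorem continuous_coherentFun (α : ℝ) (b : ℂ) : Continuous (coherentFun α b) := by
  unfold coherentFun
  fun_prop

theorem conj_coherentFun_mul (α : ℝ) (b b' : ℂ) (x : ℝ) :
    (starRingEnd ℂ) (coherentFun α b x) * coherentFun α b' x =
      ((((2 * α / Real.pi) ^ (1 / 4 : ℝ)) ^ 2 : ℝ) : ℂ) *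
        Complex.exp (-(2 * α : ℂ) * (x : ℂ) ^ 2 + ((starRingEnd ℂ) b + b') * x +
          -(((starRingEnd ℂ) b ^ 2 + b' ^ 2) / (8 * α))) := by
  have he : Complex.exp (-(2 * α : ℂ) * (x : ℂ) ^ 2 + ((starRingEnd ℂ) b + b') * x +
      -(((starRingEnd ℂ) b ^ 2 + b' ^ 2) / (8 * α))) =
      Complex.exp (-(α : ℂ) * (x : ℂ) ^ 2 + (starRingEnd ℂ) b * x +
        -((starRingEnd ℂ) b ^ 2 / (8 * α))) *
      Complex.exp (-(α : ℂ) * (x : ℂ) ^ 2 + b' * x + -(b' ^ 2 / (8 * α))) := by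
    rw [← Complex.exp_add]
    congr 1
    ring
  rw [he, coherentFun, coherentFun, map_mul, Complex.conj_ofReal, ← Complex.exp_conj]
  simp only [map_add, map_mul, map_neg, map_div₀, map_pow, Complex.conj_ofReal, map_ofNat]
  push_cast
  ring

theorem memLp_coherentFun {α : ℝ} (hα : 0 < α) (b : ℂ) : MemLp (coherentFun α b) 2 volume := by
  rw [memLp_two_iff_integrable_sq_norm (continuous_coherentFun α b).aestronglyMeasurable]
  have h : Integrable fun x : ℝ =>
      (starRingEnd ℂ) (coherentFun α b x) * coherentFun α b x := by
    simp only [conj_coherentFun_mul]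
    refine (integrable_cexp_quadratic (b := (2 * α : ℂ)) ?_ _ _).const_mul _
    simpa using hα
  refine h.norm.congr (Filter.Eventually.of_forall fun x => ?_)
  simp [pow_two]

/-- The coherent state as an element of `L₂(ℝ)`. -/
noncomputable def coherentL2 {α : ℝ} (hα : 0 < α) (b : ℂ) : L2R := (memLp_coherentFun hα b).toLp _

theorem coherentL2_ae {α : ℝ} (hα : 0 < α) (b : ℂ) :
    ∀ᵐ x : ℝ, coherentL2 hα b x = coherentFun α b x :=
  (memLp_coherentFun hα b).coeFn_toLp

theorem gaussL2_ae {α : ℝ} (hα : 0 < α) : ∀ᵐ x : ℝ, gaussL2 α x = (gaussFun α x : ℂ) := by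
  rw [gaussL2, dif_pos hα]
  exact (memLp_gaussFun hα).coeFn_toLp

theorem coherentL2_zero {α : ℝ} (hα : 0 < α) : coherentL2 hα 0 = gaussL2 α := by
  apply Lp.ext
  filter_upwards [coherentL2_ae hα 0, gaussL2_ae hα] with x h1 h2
  rw [h1, h2, coherentFun, gaussFun]
  push_cast
  simp

/-- The factor $e^{-b^2/(8\alpha)}$ is holomorphic in $b$ and cancels the pure squares left by the
Gaussian integral, so only the cross term survives. These vectors have norm one only at $b=0$, but
the exponential has a power series with positive coefficients, which gives the diagonalization. -/
theorem coherent_inner {α : ℝ} (hα : 0 < α) (b b' : ℂ) :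
    inner ℂ (coherentL2 hα b) (coherentL2 hα b') =
      Complex.exp ((starRingEnd ℂ) b * b' / (4 * α)) := by
  have hα' : (α : ℂ) ≠ 0 := by exact_mod_cast hα.ne'
  rw [inner_eq_integral]
  have h : ∫ x : ℝ, (starRingEnd ℂ) (coherentL2 hα b x) * coherentL2 hα b' x =
      ∫ x : ℝ, ((((2 * α / Real.pi) ^ (1 / 4 : ℝ)) ^ 2 : ℝ) : ℂ) *
        Complex.exp (-(2 * α : ℂ) * (x : ℂ) ^ 2 + ((starRingEnd ℂ) b + b') * x +
          -(((starRingEnd ℂ) b ^ 2 + b' ^ 2) / (8 * α))) := by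
    refine integral_congr_ae ?_
    filter_upwards [coherentL2_ae hα b, coherentL2_ae hα b'] with x h1 h2
    rw [h1, h2, conj_coherentFun_mul]
  rw [h, integral_const_mul, integral_cexp_quadratic (by simpa using hα), ← mul_assoc]
  have h1 : ((((2 * α / Real.pi) ^ (1 / 4 : ℝ)) ^ 2 : ℝ) : ℂ) *
      ((Real.pi : ℂ) / - -(2 * α : ℂ)) ^ (1 / 2 : ℂ) = 1 := by
    have h2 : ((Real.pi : ℂ) / - -(2 * α : ℂ)) ^ (1 / 2 : ℂ) =
        (((Real.pi / (2 * α)) ^ (1 / 2 : ℝ) : ℝ) : ℂ) := by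
      rw [Complex.ofReal_cpow (by positivity)]
      push_cast
      simp
    rw [h2, ← Complex.ofReal_mul, ← Real.rpow_natCast, ← Real.rpow_mul (by positivity),
      show (1 / 4 : ℝ) * ((2 : ℕ) : ℝ) = 1 / 2 by norm_num,
      ← Real.mul_rpow (by positivity) (by positivity)]
    have : 2 * α / Real.pi * (Real.pi / (2 * α)) = 1 := by
      field_simp
    rw [this]
    simp
  rw [h1, one_mul]
  congr 1
  field_simp
  ring

theorem norm_gaussL2 {α : ℝ} (hα : 0 < α) : ‖gaussL2 α‖ = 1 := by
  have h := coherent_inner hα 0 0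
  rw [coherentL2_zero, ← ofReal_norm_sq_eq_inner] at h
  simp only [map_zero, zero_mul, zero_div, Complex.exp_zero] at h
  have h2 : ‖gaussL2 α‖ ^ 2 = 1 := by exact_mod_cast h
  exact (pow_eq_one_iff_of_nonneg (norm_nonneg _) two_ne_zero).1 h2

theorem star_gaussL2 {α : ℝ} (hα : 0 < α) : star (gaussL2 α) = gaussL2 α := by
  apply Lp.ext
  filter_upwards [Lp.coeFn_star (gaussL2 α), gaussL2_ae hα] with x h1 h2
  rw [h1, Pi.star_apply, h2]
  simp

-- A smooth compactly supported test function is the Fourier transform of a Schwartz function, and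
-- the transform can be moved onto `f` under the integral.
open scoped FourierTransform SchwartzMap in
theorem ae_eq_zero_of_fourier_eq_zero {f : ℝ → ℂ} (hf : Integrable f) (h : ∀ ξ, 𝓕 f ξ = 0) :
    ∀ᵐ x : ℝ, f x = 0 := by
  refine ae_eq_zero_of_integral_contDiff_smul_eq_zero hf.locallyIntegrable fun g hg hc => ?_
  let G : 𝓢(ℝ, ℂ) := HasCompactSupport.toSchwartzMap
    (f := fun x => (g x : ℂ)) (hc.comp_left (g := fun t : ℝ => (t : ℂ)) (by simp))
    (Complex.ofRealCLM.contDiff.comp hg)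
  have hG (x : ℝ) : 𝓕 ((𝓕⁻ G : 𝓢(ℝ, ℂ)) : ℝ → ℂ) x = g x := by
    rw [← SchwartzMap.fourier_coe, FourierTransform.fourier_fourierInv_eq]
    rfl
  have key := VectorFourier.integral_fourierIntegral_smul_eq_flip (L := innerₗ ℝ)
    (μ := volume) (ν := volume) Real.continuous_fourierChar (by fun_prop)
    ((𝓕⁻ G : 𝓢(ℝ, ℂ)).integrable (μ := volume)) hf
  calc ∫ x, g x • f x = ∫ x, 𝓕 ((𝓕⁻ G : 𝓢(ℝ, ℂ)) : ℝ → ℂ) x • f x := by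
        simp only [hG]
        rfl
    _ = ∫ x, (𝓕⁻ G : 𝓢(ℝ, ℂ)) x • 𝓕 f x := by
        rw [flip_innerₗ] at key
        exact key
    _ = 0 := by simp [h]

-- Purely imaginary parameters $2\pi i\xi$ already suffice: pairing with them gives, up to a nonzero
-- factor, the Fourier transform of $g_\alpha u$, and $g_\alpha$ has no zeros.
open scoped FourierTransform in
theorem span_coherentL2_dense {α : ℝ} (hα : 0 < α) :
    (Submodule.span ℂ (Set.range (coherentL2 hα))).topologicalClosure = ⊤ := by
  rw [Submodule.topologicalClosure_eq_top_iff, Submodule.eq_bot_iff]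
  intro u hu
  have hu' (b : ℂ) : inner ℂ (coherentL2 hα b) u = 0 :=
    (Submodule.mem_orthogonal _ u).1 hu _ (Submodule.subset_span ⟨b, rfl⟩)
  have hint : Integrable fun x : ℝ => (starRingEnd ℂ) (coherentFun α 0 x) * u x := by
    have h := (memLp_coherentFun hα 0).star.integrable_mul (Lp.memLp u)
    exact h
  have hF (ξ : ℝ) : 𝓕 (fun x : ℝ => (starRingEnd ℂ) (coherentFun α 0 x) * u x) ξ = 0 := by
    rw [Real.fourier_real_eq_integral_exp_smul]
    have h := hu' (2 * Real.pi * ξ * Complex.I)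
    rw [inner_eq_integral] at h
    have h2 : ∫ x : ℝ, (starRingEnd ℂ) (coherentL2 hα (2 * Real.pi * ξ * Complex.I) x) * u x =
        Complex.exp ((2 * Real.pi * ξ) ^ 2 / (8 * α)) *
        ∫ x : ℝ, Complex.exp (↑(-2 * Real.pi * x * ξ) * Complex.I) •
          ((starRingEnd ℂ) (coherentFun α 0 x) * u x) := by
      rw [← integral_const_mul]
      refine integral_congr_ae ?_
      filter_upwards [coherentL2_ae hα (2 * Real.pi * ξ * Complex.I)] with x hx
      rw [hx, smul_eq_mul, ← mul_assoc, ← mul_assoc]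
      congr 1
      simp only [coherentFun, map_mul, Complex.conj_ofReal, ← Complex.exp_conj]
      rw [mul_left_comm, ← Complex.exp_add, ← Complex.exp_add]
      congr 2
      simp only [map_add, map_mul, map_neg, map_div₀, map_pow, Complex.conj_ofReal, map_ofNat,
        Complex.conj_I, map_zero]
      push_cast
      ring_nf
      simp [Complex.I_sq]
      ring
    rw [h2] at h
    exact (mul_eq_zero.1 h).resolve_left (Complex.exp_ne_zero _)
  have h0 := ae_eq_zero_of_fourier_eq_zero hint hF
  apply Lp.ext
  filter_upwards [h0, Lp.coeFn_zero ℂ 2 (volume : Measure ℝ)] with x hx hx0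
  rw [hx0, Pi.zero_apply]
  refine (mul_eq_zero.1 hx).resolve_left ?_
  rw [← ne_eq, map_ne_zero, coherentFun]
  refine mul_ne_zero ?_ (Complex.exp_ne_zero _)
  exact_mod_cast (Real.rpow_pos_of_pos (by positivity) _).ne'

/-- The Gram form of coherent states as a sum of squares. -/
theorem hasSum_norm_sq_coherent {ι : Type*} (s : Finset ι) {α : ℝ} (hα : 0 < α) (c b : ι → ℂ) :
    HasSum (fun n : ℕ => ‖∑ i ∈ s, c i * b i ^ n‖ ^ 2 / ((4 * α) ^ n * n.factorial))
      (‖∑ i ∈ s, c i • coherentL2 hα (b i)‖ ^ 2) := by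
  have hα' : (α : ℂ) ≠ 0 := by exact_mod_cast hα.ne'
  have h1 : HasSum (fun n : ℕ => ∑ i ∈ s, ∑ j ∈ s, (starRingEnd ℂ) (c i) * c j *
      (((starRingEnd ℂ) (b i) * b j / (4 * α)) ^ n / n.factorial))
      (∑ i ∈ s, ∑ j ∈ s, (starRingEnd ℂ) (c i) * c j *
        Complex.exp ((starRingEnd ℂ) (b i) * b j / (4 * α))) := by
    refine hasSum_sum fun i _ => hasSum_sum fun j _ => HasSum.mul_left _ ?_
    rw [Complex.exp_eq_exp_ℂ]
    exact NormedSpace.expSeries_div_hasSum_exp _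
  have h2 : ((‖∑ i ∈ s, c i • coherentL2 hα (b i)‖ ^ 2 : ℝ) : ℂ) =
      ∑ i ∈ s, ∑ j ∈ s, (starRingEnd ℂ) (c i) * c j *
        Complex.exp ((starRingEnd ℂ) (b i) * b j / (4 * α)) := by
    rw [ofReal_norm_sq_eq_inner, sum_inner]
    refine Finset.sum_congr rfl fun i _ => ?_
    rw [inner_sum]
    refine Finset.sum_congr rfl fun j _ => ?_
    rw [inner_smul_left, inner_smul_right, coherent_inner]
    ring
  rw [← Complex.hasSum_ofReal, h2]
  convert h1 using 1
  funext n
  have h3 : ((‖∑ i ∈ s, c i * b i ^ n‖ ^ 2 : ℝ) : ℂ) =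
      (∑ i ∈ s, (starRingEnd ℂ) (c i) * (starRingEnd ℂ) (b i) ^ n) * ∑ j ∈ s, c j * b j ^ n := by
    rw [← Complex.normSq_eq_norm_sq, Complex.normSq_eq_conj_mul_self, map_sum]
    simp only [map_mul, map_pow]
  rw [Complex.ofReal_div, h3, Finset.sum_mul_sum, Finset.sum_div]
  refine Finset.sum_congr rfl fun i _ => ?_
  rw [Finset.sum_div]
  refine Finset.sum_congr rfl fun j _ => ?_
  push_cast
  simp only [div_pow, mul_pow]
  have hf : (n.factorial : ℂ) ≠ 0 := by exact_mod_cast n.factorial_ne_zero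
  field_simp

/-- Scaling the parameters by `q` multiplies the `n`-th square of the Gram expansion by
$|q|^{2n}\le|q|^2$ for $n\ge1$. The term $n=0$ is unchanged and equals the squared overlap with the
Gaussian, because every coherent state has inner product one with it. -/
theorem norm_sq_coherent_le {ι : Type*} (s : Finset ι) {α : ℝ} (hα : 0 < α) (c b : ι → ℂ) {q : ℂ}
    (hq : ‖q‖ ≤ 1) :
    ‖∑ i ∈ s, c i • coherentL2 hα (q * b i)‖ ^ 2 ≤
      ‖q‖ ^ 2 * ‖∑ i ∈ s, c i • coherentL2 hα (b i)‖ ^ 2 +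
        (1 - ‖q‖ ^ 2) * ‖inner ℂ (gaussL2 α) (∑ i ∈ s, c i • coherentL2 hα (b i))‖ ^ 2 := by
  have h1 := hasSum_norm_sq_coherent s hα c fun i => q * b i
  have h2 := (hasSum_norm_sq_coherent s hα c b).mul_left (‖q‖ ^ 2)
  have hg : inner ℂ (gaussL2 α) (∑ i ∈ s, c i • coherentL2 hα (b i)) = ∑ i ∈ s, c i := by
    rw [inner_sum]
    refine Finset.sum_congr rfl fun i _ => ?_
    rw [inner_smul_right, ← coherentL2_zero hα, coherent_inner]
    simp
  rw [hg]
  have h3 : HasSum (fun n : ℕ => if n = 0 then (1 - ‖q‖ ^ 2) * ‖∑ i ∈ s, c i‖ ^ 2 else 0)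
      ((1 - ‖q‖ ^ 2) * ‖∑ i ∈ s, c i‖ ^ 2) := hasSum_ite_eq 0 _
  refine hasSum_le (fun n => ?_) h1 (h2.add h3)
  have hpow : ∑ i ∈ s, c i * (q * b i) ^ n = q ^ n * ∑ i ∈ s, c i * b i ^ n := by
    rw [Finset.mul_sum]
    refine Finset.sum_congr rfl fun i _ => ?_
    rw [mul_pow]
    ring
  rcases Nat.eq_zero_or_pos n with rfl | hn
  · simp only [pow_zero, mul_one, Nat.factorial_zero, Nat.cast_one, div_one, if_true]
    linarith
  · rw [if_neg hn.ne', add_zero, hpow, norm_mul, norm_pow, mul_pow, mul_div_assoc]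
    refine mul_le_mul_of_nonneg_right ?_ (by positivity)
    rw [← pow_mul]
    exact pow_le_pow_of_le_one (norm_nonneg _) hq (by omega)

/-! ### The Mehler operator and its spectral gap. -/

/-- The Mehler kernel `exp (-A (x - y)² - B x² - B y²)`. -/
noncomputable def mehlerKernel (A B : ℂ) (x y : ℝ) : ℂ :=
  Complex.exp (-(A * ((x : ℂ) - y) ^ 2) - B * (x : ℂ) ^ 2 - B * (y : ℂ) ^ 2)

theorem continuous_mehlerKernel (A B : ℂ) : Continuous (Function.uncurry (mehlerKernel A B)) := by
  unfold mehlerKernel Function.uncurry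
  fun_prop

theorem norm_mehlerKernel (A B : ℂ) (x y : ℝ) :
    ‖mehlerKernel A B x y‖ =
      Real.exp (-A.re * (x - y) ^ 2 - B.re * x ^ 2 - B.re * y ^ 2) := by
  rw [mehlerKernel, Complex.norm_exp]
  congr 1
  have h : -(A * ((x : ℂ) - y) ^ 2) - B * (x : ℂ) ^ 2 - B * (y : ℂ) ^ 2 =
    -(A * ((x - y) ^ 2 : ℝ)) - B * (x ^ 2 : ℝ) - B * (y ^ 2 : ℝ) := by push_cast; ring
  rw [h]
  simp only [Complex.sub_re, Complex.neg_re, Complex.re_mul_ofReal]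
  ring

theorem norm_mehlerKernel_le {A B : ℂ} (hB : 0 ≤ B.re) (x y : ℝ) :
    ‖mehlerKernel A B x y‖ ≤ Real.exp (-A.re * (x - y) ^ 2) := by
  rw [norm_mehlerKernel]
  apply Real.exp_le_exp.2
  have := mul_nonneg hB (sq_nonneg x)
  have := mul_nonneg hB (sq_nonneg y)
  linarith

/-- The top eigenvalue of the Mehler kernel with parameters `A` and `B = D - A`, where
`D ^ 2 = A ^ 2 + α ^ 2`. -/
noncomputable def mehlerTop (D : ℂ) (α : ℝ) : ℂ := ((Real.pi : ℂ) / (D + α)) ^ (1 / 2 : ℂ)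

/-- Completing the square gives the $x^2$-coefficient $-D+A^2/(D+\alpha)$, and $D^2=A^2+\alpha^2$ is
exactly what makes it $-\alpha$: the width is reproduced and only the parameter is scaled. -/
theorem mehler_coherent {A D : ℂ} {α : ℝ} (hα : 0 < α) (hD : 0 < D.re) 
    (hsq : D ^ 2 = A ^ 2 + (α : ℂ) ^ 2) {T : L2R →L[ℂ] L2R} (hT : HasKernel T (mehlerKernel A (D - A)))
    (b : ℂ) : T (coherentL2 hα b) = mehlerTop D α • coherentL2 hα (A / (D + α) * b) := by
  have hDα : D + α ≠ 0 := by
    intro h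
    have := congrArg Complex.re h
    simp at this
    linarith
  have hα' : (α : ℂ) ≠ 0 := by exact_mod_cast hα.ne'
  apply Lp.ext
  filter_upwards [hT (coherentL2 hα b), Lp.coeFn_smul (mehlerTop D α)
    (coherentL2 hα (A / (D + α) * b)), coherentL2_ae hα (A / (D + α) * b)] with x h1 h2 h3
  rw [h1.2, h2, Pi.smul_apply, h3, smul_eq_mul]
  have h4 : ∫ y : ℝ, mehlerKernel A (D - A) x y * coherentL2 hα b y =
      ∫ y : ℝ, (((2 * α / Real.pi) ^ (1 / 4 : ℝ) : ℝ) : ℂ) *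
        Complex.exp (-(D + α) * (y : ℂ) ^ 2 + (2 * A * x + b) * y +
          (-(D * x ^ 2) - b ^ 2 / (8 * α))) := by
    refine integral_congr_ae ?_
    filter_upwards [coherentL2_ae hα b] with y hy
    rw [hy, coherentFun, mehlerKernel, mul_left_comm, ← Complex.exp_add]
    congr 2
    ring
  rw [h4, integral_const_mul, integral_cexp_quadratic, coherentFun, mehlerTop, neg_neg]
  · rw [mul_left_comm]
    congr 3
    have h5 : A ^ 2 = (D + α) * (D - α) := by linear_combination -hsq
    have h6 : A ^ 2 / (D + α) ^ 2 = (D - α) / (D + α) := by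
      rw [h5]; field_simp
    have h7 : (A / (D + α) * b) ^ 2 / (8 * α) = (D - α) / (D + α) * b ^ 2 / (8 * α) := by
      rw [← h6]; field_simp
    rw [h7]
    field_simp
    linear_combination (-32 * α * x ^ 2) * hsq
  · simp only [Complex.neg_re, Complex.add_re, Complex.ofReal_re]
    linarith

/-- One has $|A|^2=|D-\alpha||D+\alpha|$, and $D$, lying in the right half plane, is closer to
$\alpha$ than to $-\alpha$. -/
theorem norm_mehler_ratio_le_one {A D : ℂ} {α : ℝ} (hα : 0 < α) (hD : 0 < D.re)
    (hsq : D ^ 2 = A ^ 2 + (α : ℂ) ^ 2) : ‖A / (D + α)‖ ≤ 1 := by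
  rw [norm_div]
  refine div_le_one_of_le₀ ?_ (norm_nonneg _)
  refine le_of_sq_le_sq ?_ (norm_nonneg _)
  have h1 : ‖A‖ ^ 2 = ‖D + α‖ * ‖D - α‖ := by
    rw [← norm_mul, ← norm_pow]
    congr 1
    linear_combination -hsq
  have h2 : ‖D - α‖ ≤ ‖D + α‖ := by
    refine le_of_sq_le_sq ?_ (norm_nonneg _)
    rw [← Complex.normSq_eq_norm_sq, ← Complex.normSq_eq_norm_sq, Complex.normSq_apply,
      Complex.normSq_apply]
    simp
    nlinarith
  rw [h1, sq]
  gcongr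

/-- The spectral gap of the Mehler operator. -/
theorem norm_sq_mehler_le {A D : ℂ} {α : ℝ} (hα : 0 < α) (hD : 0 < D.re)
    (hsq : D ^ 2 = A ^ 2 + (α : ℂ) ^ 2) {T : L2R →L[ℂ] L2R}
    (hT : HasKernel T (mehlerKernel A (D - A))) (u : L2R) :
    ‖T u‖ ^ 2 ≤ ‖mehlerTop D α‖ ^ 2 *
      (‖A / (D + α)‖ ^ 2 * ‖u‖ ^ 2 + (1 - ‖A / (D + α)‖ ^ 2) * ‖inner ℂ (gaussL2 α) u‖ ^ 2) := by
  -- Both sides are continuous in `u`, so by density the inequality need only be checked on finite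
  -- combinations of coherent states.
  have hclosed : IsClosed {u : L2R | ‖T u‖ ^ 2 ≤ ‖mehlerTop D α‖ ^ 2 *
      (‖A / (D + α)‖ ^ 2 * ‖u‖ ^ 2 + (1 - ‖A / (D + α)‖ ^ 2) * ‖inner ℂ (gaussL2 α) u‖ ^ 2)} :=
    isClosed_le (by fun_prop) (by fun_prop)
  have hmem : u ∈ (Submodule.span ℂ (Set.range (coherentL2 hα))).topologicalClosure := by
    rw [span_coherentL2_dense hα]
    trivial
  refine closure_minimal ?_ hclosed hmem
  intro v hv
  obtain ⟨c, rfl⟩ := Finsupp.mem_span_range_iff_exists_finsupp.1 hv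
  simp only [Finsupp.sum, Set.mem_ofPred_eq, map_sum, map_smul, mehler_coherent hα hD hsq hT]
  have h : ∑ b ∈ c.support, c b • mehlerTop D α • coherentL2 hα (A / (D + α) * b) =
      mehlerTop D α • ∑ b ∈ c.support, c b • coherentL2 hα (A / (D + α) * b) := by
    rw [Finset.smul_sum]
    exact Finset.sum_congr rfl fun b _ => smul_comm _ _ _
  rw [h, norm_smul, mul_pow]
  gcongr
  exact norm_sq_coherent_le c.support hα c id (norm_mehler_ratio_le_one hα hD hsq)

theorem norm_mehler_le {A D : ℂ} {α : ℝ} (hα : 0 < α) (hD : 0 < D.re)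
    (hsq : D ^ 2 = A ^ 2 + (α : ℂ) ^ 2) {T : L2R →L[ℂ] L2R}
    (hT : HasKernel T (mehlerKernel A (D - A))) (u : L2R) :
    ‖T u‖ ≤ ‖mehlerTop D α‖ * ‖u‖ := by
  have h := norm_sq_mehler_le hα hD hsq hT u
  have hq := norm_mehler_ratio_le_one hα hD hsq
  have h1 : ‖inner ℂ (gaussL2 α) u‖ ≤ ‖u‖ := by
    simpa [norm_gaussL2 hα] using norm_inner_le_norm (𝕜 := ℂ) (gaussL2 α) u
  have h2 : ‖inner ℂ (gaussL2 α) u‖ ^ 2 ≤ ‖u‖ ^ 2 := by gcongr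
  have h3 : ‖A / (D + α)‖ ^ 2 ≤ 1 := pow_le_one₀ (norm_nonneg _) hq
  refine le_of_sq_le_sq (h.trans ?_) (by positivity)
  rw [mul_pow]
  gcongr
  nlinarith

theorem cpow_half_sq (z : ℂ) : (z ^ (1 / 2 : ℂ)) ^ 2 = z := by
  simp

theorem norm_sq_mehlerTop (D : ℂ) (α : ℝ) : ‖mehlerTop D α‖ ^ 2 = Real.pi / ‖D + α‖ := by
  rw [← norm_pow, mehlerTop, cpow_half_sq, norm_div, Complex.norm_real,
    Real.norm_of_nonneg Real.pi_pos.le]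

/-- Guarantees $\operatorname{Re}(D-A)\ge0$, so that the Mehler kernel is dominated by its
convolution factor. Eliminating $\operatorname{Im}D$ gives the identity `h1`, whose right side is
nonnegative. -/
theorem re_le_of_sq_eq {A D : ℂ} {α : ℝ} (hD : 0 < D.re)
    (hsq : D ^ 2 = A ^ 2 + (α : ℂ) ^ 2) : A.re ≤ D.re := by
  have hre := congrArg Complex.re hsq
  have him := congrArg Complex.im hsq
  simp only [sq, Complex.add_re, Complex.add_im, Complex.mul_re, Complex.mul_im,
    Complex.ofReal_re, Complex.ofReal_im] at hre him
  have h1 : (D.re ^ 2 - A.re ^ 2) * (D.re ^ 2 + A.im ^ 2) = D.re ^ 2 * α ^ 2 := by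
    have h2 : D.re * D.im = A.re * A.im := by linarith
    have h3 : D.re ^ 2 * D.im ^ 2 = A.re ^ 2 * A.im ^ 2 := by
      rw [← mul_pow, h2, mul_pow]
    linear_combination (D.re ^ 2) * hre + h3
  have h4 : 0 ≤ D.re ^ 2 - A.re ^ 2 := by
    by_contra hneg
    have h5 : 0 < D.re ^ 2 + A.im ^ 2 := by positivity
    have h6 := mul_neg_of_neg_of_pos (not_le.1 hneg) h5
    have h7 : 0 ≤ D.re ^ 2 * α ^ 2 := by positivity
    linarith
  exact le_of_sq_le_sq (by linarith) hD.le

theorem norm_mehlerTop_le {A D : ℂ} {α : ℝ} (hA : 0 < A.re) (hα : 0 < α) (hD : 0 < D.re)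
    (hsq : D ^ 2 = A ^ 2 + (α : ℂ) ^ 2) : ‖mehlerTop D α‖ ≤ Real.sqrt (Real.pi / ‖A‖) := by
  have hA0 : 0 < ‖A‖ := norm_pos_iff.2 fun h => by simp [h] at hA
  have hDα : 0 < ‖D + α‖ := norm_pos_iff.2 fun h => by
    have := congrArg Complex.re h
    simp at this
    linarith
  refine Real.le_sqrt_of_sq_le ?_
  rw [norm_sq_mehlerTop]
  have h := norm_mehler_ratio_le_one hα hD hsq
  rw [norm_div, div_le_one hDα] at h
  gcongr

/-- The sharp norm bound for convolution with a complex Gaussian. -/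
theorem norm_gauss_conv_le {A : ℂ} (hA : 0 < A.re) {T : L2R →L[ℂ] L2R}
    (hT : HasKernel T (mehlerKernel A 0)) (u : L2R) :
    ‖T u‖ ≤ Real.sqrt (Real.pi / ‖A‖) * ‖u‖ := by
  -- Convolution is the limit $\alpha\to0^+$ of Mehler operators, all of norm at most
  -- $\sqrt{\pi/|A|}$; the bound passes to the limit by Fatou in $L_2$. The Schur test would only
  -- give $\sqrt{\pi/\operatorname{Re}A}$, too weak for complex $\zeta^2$.
  let D : ℝ → ℂ := fun α => (A ^ 2 + (α : ℂ) ^ 2) ^ (2⁻¹ : ℂ)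
  have hDsq (α : ℝ) : D α ^ 2 = A ^ 2 + (α : ℂ) ^ 2 := by
    simp only [D]
    exact Complex.cpow_nat_inv_pow _ two_ne_zero
  have hslit : A ^ 2 + ((0 : ℝ) : ℂ) ^ 2 ∈ Complex.slitPlane := by
    rw [Complex.mem_slitPlane_iff]
    simp only [sq, Complex.add_re, Complex.add_im, Complex.mul_re, Complex.mul_im,
      Complex.ofReal_re, Complex.ofReal_im]
    by_cases h : A.im = 0
    · left; rw [h]; nlinarith
    · right
      have : A.re * A.im ≠ 0 := mul_ne_zero hA.ne' h
      intro h2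
      exact this (by linarith)
  have hD0 : D 0 = A := by
    simp only [D, Complex.ofReal_zero]
    rw [zero_pow two_ne_zero, add_zero, Complex.sq_cpow_two_inv hA]
  have hDcont : Filter.Tendsto D (nhdsWithin 0 (Set.Ioi 0)) (nhds A) := by
    have h1 : ContinuousAt D 0 := by
      refine ContinuousAt.cpow ?_ continuousAt_const hslit
      fun_prop
    have h2 := h1.tendsto
    rw [hD0] at h2
    exact h2.mono_left nhdsWithin_le_nhds
  have hDre : ∀ᶠ α in nhdsWithin (0 : ℝ) (Set.Ioi 0), 0 < (D α).re :=
    (Complex.continuous_re.continuousAt.tendsto.comp hDcont).eventually (lt_mem_nhds hA)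
  have hev : ∀ᶠ α in nhdsWithin (0 : ℝ) (Set.Ioi 0), 0 < α ∧ 0 < (D α).re :=
    by
    filter_upwards [self_mem_nhdsWithin, hDre] with α h1 h2
    exact ⟨h1, h2⟩
  have hbd {α : ℝ} (hα : 0 < α ∧ 0 < (D α).re) (x y : ℝ) :
      ‖mehlerKernel A (D α - A) x y‖ ≤ Real.exp (-A.re * (x - y) ^ 2) := by
    refine norm_mehlerKernel_le ?_ x y
    have := re_le_of_sq_eq hα.2 (hDsq α)
    rw [Complex.sub_re]
    linarith
  have hlim : eLpNorm (fun x => ∫ y : ℝ, mehlerKernel A 0 x y * u y) 2 volume ≤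
      ENNReal.ofReal (Real.sqrt (Real.pi / ‖A‖) * ‖u‖) := by
    refine Lp.eLpNorm_le_of_ae_tendsto (u := nhdsWithin (0 : ℝ) (Set.Ioi 0))
      (f := fun α x => ∫ y : ℝ, mehlerKernel A (D α - A) x y * u y) ?_ ?_ ?_
    · filter_upwards [hev] with α hα
      obtain ⟨S, hS, -⟩ := exists_hasKernel hA (continuous_mehlerKernel A (D α - A)) (hbd hα)
      have h1 : (fun x => ∫ y : ℝ, mehlerKernel A (D α - A) x y * u y) =ᵐ[volume] S u := by
        filter_upwards [hS u] with x hx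
        exact hx.2.symm
      rw [eLpNorm_congr_ae h1, ← ENNReal.ofReal_toReal (Lp.eLpNorm_ne_top (S u)), ← Lp.norm_def]
      refine ENNReal.ofReal_le_ofReal ((norm_mehler_le hα.1 hα.2 (hDsq α) hS u).trans ?_)
      gcongr
      exact norm_mehlerTop_le hA hα.1 hα.2 (hDsq α)
    · exact fun α => aestronglyMeasurable_kernel_integral (continuous_mehlerKernel _ _) u
    · refine Filter.Eventually.of_forall fun x => ?_
      refine tendsto_integral_filter_of_dominated_convergence
        (fun y => Real.exp (-A.re * (x - y) ^ 2) * ‖u y‖) ?_ ?_ (integrable_gauss_mul hA u x) ?_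
      · refine Filter.Eventually.of_forall fun α => ?_
        exact ((continuous_mehlerKernel A (D α - A)).comp
          (by fun_prop : Continuous fun y : ℝ => (x, y))).aestronglyMeasurable.mul
          (Lp.aestronglyMeasurable u)
      · filter_upwards [hev] with α hα
        refine Filter.Eventually.of_forall fun y => ?_
        rw [norm_mul]
        gcongr
        exact hbd hα x y
      · refine Filter.Eventually.of_forall fun y => ?_
        refine Filter.Tendsto.mul_const _ ?_
        have h1 : Filter.Tendsto (fun α => D α - A) (nhdsWithin 0 (Set.Ioi 0)) (nhds 0) := by
          simpa using hDcont.sub_const A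
        have h2 : Continuous fun B : ℂ => mehlerKernel A B x y := by
          unfold mehlerKernel
          fun_prop
        exact (h2.tendsto 0).comp h1
  have h1 : (fun x => ∫ y : ℝ, mehlerKernel A 0 x y * u y) =ᵐ[volume] T u := by
    filter_upwards [hT u] with x hx
    exact hx.2.symm
  rw [eLpNorm_congr_ae h1, ← ENNReal.ofReal_toReal (Lp.eLpNorm_ne_top (T u)), ← Lp.norm_def] at hlim
  exact (ENNReal.ofReal_le_ofReal_iff (by positivity)).1 hlim

/-! ### Taylor expansion of the potential at the saddle. -/

/-- The extension of an admissible potential is bounded near the origin. -/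
theorem norm_extension_le_one {γ C₂ c r : ℝ} {V : ℂ → ℂ} (hrc : r ≤ c)
    (hr : r * C₂ ≤ 1) (hC₂ : 0 < C₂) (hV : AnalyticOnNhd ℂ V {z : ℂ | |z.im| ≤ c}) (hV0 : V 0 = 0)
    (hbd : ∀ z : ℂ, |z.im| ≤ c → ‖deriv V z‖ ≤ C₂ * (max 1 (V z).re) ^ γ) {z : ℂ} (hz : ‖z‖ < r) :
    ‖V z‖ ≤ 1 := by
  have hmem (t : ℝ) (ht : t ∈ Set.Icc (0 : ℝ) 1) : |((t : ℂ) * z).im| ≤ c := by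
    have h1 : |((t : ℂ) * z).im| ≤ ‖(t : ℂ) * z‖ := Complex.abs_im_le_norm _
    rw [norm_mul, Complex.norm_real, Real.norm_of_nonneg ht.1] at h1
    have h2 : t * ‖z‖ ≤ 1 * ‖z‖ := by
      have := ht.2
      gcongr
    linarith
  have hd (t : ℝ) (ht : t ∈ Set.Icc (0 : ℝ) 1) :
      HasDerivAt (fun t : ℝ => V ((t : ℂ) * z)) (deriv V ((t : ℂ) * z) * z) t := by
    have h1 : HasDerivAt V (deriv V ((t : ℂ) * z)) ((t : ℂ) * z) :=
      (hV _ (hmem t ht)).differentiableAt.hasDerivAt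
    have h2 : HasDerivAt (fun t : ℝ => (t : ℂ) * z) (1 * z) t :=
      (Complex.ofRealCLM.hasDerivAt (x := t)).mul_const z
    rw [one_mul] at h2
    exact h1.comp t h2
  -- Along the ray $tz$ the norm of `V` cannot cross the line $t$: at a point of contact
  -- $|V|=t\le1$, so the growth bound reduces to $|V'|\le C_2$ and the speed is below $C_2r\le1$.
  have key := image_norm_le_of_norm_deriv_right_lt_deriv_boundary
    (f := fun t : ℝ => V ((t : ℂ) * z)) (f' := fun t : ℝ => deriv V ((t : ℂ) * z) * z)
    (a := 0) (b := 1) (B := fun t => t) (B' := fun _ => 1)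
    (fun t ht => (hd t ht).continuousAt.continuousWithinAt)
    (fun t ht => (hd t ⟨ht.1, ht.2.le⟩).hasDerivWithinAt) (by simp [hV0])
    (fun t => hasDerivAt_id t) ?_ (show (1 : ℝ) ∈ Set.Icc (0 : ℝ) 1 by simp)
  · simpa using key
  · intro t ht heq
    have h1 := hbd _ (hmem t ⟨ht.1, ht.2.le⟩)
    have h2 : (V ((t : ℂ) * z)).re ≤ 1 := by
      refine (Complex.re_le_norm _).trans ?_
      rw [heq]; exact ht.2.le
    rw [max_eq_left h2, Real.one_rpow, mul_one] at h1
    rw [norm_mul]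
    calc ‖deriv V (t * z)‖ * ‖z‖ ≤ C₂ * ‖z‖ := by gcongr
      _ < C₂ * r := by gcongr
      _ ≤ 1 := by linarith

/-- Quadratic Taylor expansion of a bounded holomorphic function with a double zero. -/
theorem exists_quadratic_factor {V : ℂ → ℂ} {r : ℝ} (hr : 0 < r)
    (hV : DifferentiableOn ℂ V (Metric.ball 0 r)) (hV0 : V 0 = 0) (hV1 : deriv V 0 = 0)
    (hbd : ∀ z ∈ Metric.ball (0 : ℂ) r, ‖V z‖ ≤ 1) :
    ∃ h : ℂ → ℂ, DifferentiableOn ℂ h (Metric.ball 0 r) ∧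
      (∀ z, V z = z ^ 2 * h z) ∧ ‖h 0‖ ≤ 4 / r ^ 2 ∧
      ∀ z ∈ Metric.ball (0 : ℂ) r, ‖h z - h 0‖ ≤ 12 / r ^ 3 * ‖z‖ := by
  have hmem0 : (0 : ℂ) ∈ Metric.ball (0 : ℂ) r := Metric.mem_ball_self hr
  have hnhds : Metric.ball (0 : ℂ) r ∈ nhds (0 : ℂ) := Metric.ball_mem_nhds 0 hr
  -- Dividing by $z$ is `dslope` at $0$. The Schwarz lemma bounds each quotient by the previous
  -- bound divided by `r`; the numerators $2,4,12$ leave slack.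
  have hd1 : DifferentiableOn ℂ (dslope V 0) (Metric.ball 0 r) :=
    (Complex.differentiableOn_dslope hnhds).2 hV
  have hd2 : DifferentiableOn ℂ (dslope (dslope V 0) 0) (Metric.ball 0 r) :=
    (Complex.differentiableOn_dslope hnhds).2 hd1
  have hb1 (z : ℂ) (hz : z ∈ Metric.ball (0 : ℂ) r) : ‖dslope V 0 z‖ ≤ 2 / r := by
    refine Complex.norm_dslope_le_div_of_mapsTo_ball hV ?_ hz
    intro w hw
    rw [hV0, mem_closedBall_zero_iff]
    linarith [hbd w hw]
  have h10 : dslope V 0 0 = 0 := by rw [dslope_same, hV1]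
  have hb2 (z : ℂ) (hz : z ∈ Metric.ball (0 : ℂ) r) : ‖dslope (dslope V 0) 0 z‖ ≤ 4 / r ^ 2 := by
    have h1 : ‖dslope (dslope V 0) 0 z‖ ≤ (4 / r) / r := by
      refine Complex.norm_dslope_le_div_of_mapsTo_ball hd1 ?_ hz
      intro w hw
      rw [h10, mem_closedBall_zero_iff]
      refine (hb1 w hw).trans ?_
      gcongr
      norm_num
    refine h1.trans_eq ?_
    field_simp
  refine ⟨dslope (dslope V 0) 0, hd2, fun z => ?_, hb2 0 hmem0, fun z hz => ?_⟩
  · have h1 := sub_smul_dslope V 0 z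
    have h2 := sub_smul_dslope (dslope V 0) 0 z
    rw [hV0, sub_zero, sub_zero, smul_eq_mul] at h1
    rw [h10, sub_zero, sub_zero, smul_eq_mul] at h2
    rw [← h1, ← h2]
    ring
  · have h1 := sub_smul_dslope (dslope (dslope V 0) 0) 0 z
    rw [← h1, sub_zero, smul_eq_mul, norm_mul, mul_comm]
    gcongr
    have h2 : ‖dslope (dslope (dslope V 0) 0) 0 z‖ ≤ (12 / r ^ 2) / r := by
      refine Complex.norm_dslope_le_div_of_mapsTo_ball hd2 ?_ hz
      intro w hw
      rw [Metric.mem_closedBall, dist_eq_norm]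
      refine (norm_sub_le _ _).trans ?_
      have h3 := hb2 w hw
      have h4 := hb2 0 hmem0
      have h5 : 4 / r ^ 2 + 4 / r ^ 2 < 12 / r ^ 2 := by
        rw [← add_div]; gcongr; norm_num
      linarith
    refine h2.trans_eq ?_
    field_simp

theorem iteratedDeriv_two_quadratic {U : ℝ → ℂ} {h : ℂ → ℂ} {r : ℝ} (hr : 0 < r)
    (hh : DifferentiableOn ℂ h (Metric.ball 0 r)) (hU : ∀ x : ℝ, U x = (x : ℂ) ^ 2 * h x) :
    iteratedDeriv 2 U 0 = 2 * h 0 := by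
  have hopen : IsOpen (Metric.ball (0 : ℂ) r) := Metric.isOpen_ball
  have hd (x : ℝ) (hx : x ∈ Metric.ball (0 : ℝ) r) :
      HasDerivAt U ((x : ℂ) * (2 * h x + x * deriv h x)) x := by
    have hx' : (x : ℂ) ∈ Metric.ball (0 : ℂ) r := by
      simpa [Complex.norm_real] using hx
    have h1 : HasDerivAt h (deriv h x) (x : ℂ) :=
      (hh.differentiableAt (hopen.mem_nhds hx')).hasDerivAt
    have h2 := (((hasDerivAt_id (x : ℂ)).pow 2).mul h1).comp_ofReal
    have h3 : U = fun y : ℝ => (id ^ 2 * h : ℂ → ℂ) (y : ℂ) := by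
      funext y
      simp [hU]
    rw [h3]
    convert h2 using 1
    simp
    ring
  have h0' : (0 : ℝ) ∈ Metric.ball (0 : ℝ) r := Metric.mem_ball_self hr
  have hev : deriv U =ᶠ[nhds 0] fun x : ℝ => (x : ℂ) * (2 * h x + x * deriv h x) := by
    filter_upwards [Metric.ball_mem_nhds (0 : ℝ) hr] with x hx
    exact (hd x hx).deriv
  have hcont : ContinuousAt (fun z : ℂ => 2 * h z + z * deriv h z) 0 := by
    have hm : Metric.ball (0 : ℂ) r ∈ nhds (0 : ℂ) := Metric.ball_mem_nhds 0 hr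
    have h1 : ContinuousAt h 0 := (hh.differentiableAt hm).continuousAt
    have h2 : ContinuousAt (deriv h) 0 :=
      ((hh.deriv hopen).differentiableAt hm).continuousAt
    fun_prop
  have hder : HasDerivAt (fun z : ℂ => z * (2 * h z + z * deriv h z)) (2 * h 0) 0 := by
    rw [hasDerivAt_iff_tendsto_slope_zero]
    have : Filter.Tendsto (fun z : ℂ => 2 * h z + z * deriv h z) (nhdsWithin 0 {0}ᶜ)
        (nhds (2 * h 0)) := by
      have h3 := hcont.tendsto
      simp only [zero_mul, add_zero] at h3
      exact h3.mono_left nhdsWithin_le_nhds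
    refine this.congr' ?_
    filter_upwards [self_mem_nhdsWithin] with z hz
    have hz' : z ≠ 0 := hz
    simp
    field_simp
  rw [iteratedDeriv_succ, iteratedDeriv_one, hev.deriv_eq]
  exact (HasDerivAt.comp_ofReal (z := 0) (by simpa using hder)).deriv

/-- Uniform quantitative consequences of admissibility near the saddle. -/
theorem AdmissiblePotential.quadratic_approx {C₁ C₂ c : ℝ} (hC₂ : 0 < C₂)
    (hc : 0 < c) :
    ∃ M r : ℝ, 0 < r ∧ r ≤ 1 ∧ 1 ≤ M ∧ ∀ (γ : ℝ) (ζ : ℂ) (U : ℝ → ℂ), ‖ζ‖ = 1 →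
      AdmissiblePotential γ C₁ C₂ c ζ U →
      ‖iteratedDeriv 2 U 0‖ ≤ M ∧ 1 / C₁ ≤ (iteratedDeriv 2 U 0).re / 2 ∧
      ∀ x : ℝ, |x| < r → ‖U x - iteratedDeriv 2 U 0 / 2 * (x : ℂ) ^ 2‖ ≤ M * |x| ^ 3 := by
  -- The ball of radius `r` must lie in the strip ($r\le c$) and satisfy $rC_2\le1$ for the bound
  -- $|V|\le1$.
  set r := min 1 (min c (1 / C₂)) with hr
  have hr0 : 0 < r := by positivity
  have hr1 : r ≤ 1 := min_le_left _ _
  have hrc : r ≤ c := (min_le_right _ _).trans (min_le_left _ _)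
  have hrC : r * C₂ ≤ 1 := by
    have : r ≤ 1 / C₂ := (min_le_right _ _).trans (min_le_right _ _)
    rwa [le_div_iff₀ hC₂] at this
  refine ⟨12 / r ^ 3, r, hr0, hr1, ?_, fun γ ζ U hζ hU => ?_⟩
  · rw [le_div_iff₀ (by positivity)]
    have : r ^ 3 ≤ 1 := pow_le_one₀ hr0.le hr1
    linarith
  obtain ⟨V, hVan, hVU, hVd⟩ := hU.analytic_extension
  have hV0 : V 0 = 0 := by simpa [hU.map_zero] using hVU 0
  have hsub : Metric.ball (0 : ℂ) r ⊆ {z : ℂ | |z.im| ≤ c} := by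
    intro z hz
    have h1 := Complex.abs_im_le_norm z
    rw [mem_ball_zero_iff] at hz
    change |z.im| ≤ c
    linarith
  have hVdiff : DifferentiableOn ℂ V (Metric.ball 0 r) := fun z hz =>
    (hVan z (hsub hz)).differentiableAt.differentiableWithinAt
  have hV1 : deriv V 0 = 0 := by
    have h1 : HasDerivAt V (deriv V 0) ((0 : ℝ) : ℂ) := by
      rw [Complex.ofReal_zero]
      exact (hVan 0 (by simpa using hc.le)).differentiableAt.hasDerivAt
    have h2 := h1.comp_ofReal
    simp only [hVU] at h2
    rw [← h2.deriv, hU.deriv_zero]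
  obtain ⟨h, hhd, hVh, hh0, hh1⟩ := exists_quadratic_factor hr0 hVdiff hV0 hV1 fun z hz =>
    norm_extension_le_one hrc hrC hC₂ hVan hV0 hVd (by simpa using hz)
  have hUh (x : ℝ) : U x = (x : ℂ) ^ 2 * h x := by rw [← hVU, hVh]
  have hU2 : iteratedDeriv 2 U 0 = 2 * h 0 := iteratedDeriv_two_quadratic hr0 hhd hUh
  have hre2 : (iteratedDeriv 2 U 0).re / 2 = (h 0).re := by
    rw [hU2]
    simp
  refine ⟨?_, ?_, fun x hx => ?_⟩
  · rw [hU2, norm_mul, Complex.norm_ofNat]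
    calc 2 * ‖h 0‖ ≤ 2 * (4 / r ^ 2) := by gcongr
      _ = 8 * r / r ^ 3 := by field_simp; ring
      _ ≤ 12 / r ^ 3 := by gcongr; linarith
  · rw [hre2]
    -- Divide (U3) by $x^2$ and let $x\to0$.
    have hcont : ContinuousAt (fun x : ℝ => (h (x : ℂ)).re) 0 := by
      have h1 : ContinuousAt h ((0 : ℝ) : ℂ) := by
        rw [Complex.ofReal_zero]
        exact (hhd.differentiableAt (Metric.ball_mem_nhds 0 hr0)).continuousAt
      exact Complex.continuous_re.continuousAt.comp (h1.comp Complex.continuous_ofReal.continuousAt)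
    have ht : Filter.Tendsto (fun x : ℝ => (h (x : ℂ)).re) (nhdsWithin 0 {0}ᶜ) (nhds (h 0).re) := by
      have := hcont.tendsto
      simp only [Complex.ofReal_zero] at this
      exact this.mono_left nhdsWithin_le_nhds
    refine ge_of_tendsto ht ?_
    filter_upwards [self_mem_nhdsWithin,
      mem_nhdsWithin_of_mem_nhds (Metric.ball_mem_nhds (0 : ℝ) one_pos)] with x hx hx1
    have hx0 : x ≠ 0 := hx
    have h1 := hU.lower_bound x
    have hx1' : |x| ≤ 1 := by
      rw [mem_ball_zero_iff, Real.norm_eq_abs] at hx1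
      exact hx1.le
    rw [min_eq_right (pow_le_one₀ (abs_nonneg _) hx1'), sq_abs, hUh, ← Complex.ofReal_pow,
      Complex.re_ofReal_mul, mul_comm] at h1
    exact le_of_mul_le_mul_left h1 (by positivity)
  · have hx' : (x : ℂ) ∈ Metric.ball (0 : ℂ) r := by
      simpa [Complex.norm_real] using hx
    have h1 := hh1 x hx'
    have h2 : U x - iteratedDeriv 2 U 0 / 2 * (x : ℂ) ^ 2 = (x : ℂ) ^ 2 * (h x - h 0) := by
      rw [hUh, hU2]; ring
    rw [h2, norm_mul, norm_pow, Complex.norm_real, Real.norm_eq_abs]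
    rw [Complex.norm_real, Real.norm_eq_abs] at h1
    calc |x| ^ 2 * ‖h x - h 0‖ ≤ |x| ^ 2 * (12 / r ^ 3 * |x|) := by gcongr
      _ = _ := by ring

/-! ### Perturbation of an approximate eigenvector with a gap. -/

/-- Existence of an exact eigenvector near an approximate eigenvector with a spectral gap. -/
theorem exists_eigenvector_of_gap {H : Type*} [NormedAddCommGroup H] [InnerProductSpace ℂ H]
    [CompleteSpace H] (K : H →L[ℂ] H) (g : H) (hg : ‖g‖ = 1) {μ : ℂ} (hμ : μ ≠ 0) {e θ : ℝ}
    (he : 0 ≤ e) (hθ : θ ≤ 1) (heθ : 64 * e ≤ θ) (hθ0 : 0 < θ)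
    (hKg : ‖K g - μ • g‖ ≤ e * ‖μ‖)
    (hKt : ∀ w, ‖inner ℂ g (K w) - μ * inner ℂ g w‖ ≤ e * ‖μ‖ * ‖w‖)
    (hgap : ∀ u, inner ℂ g u = 0 → ‖K u‖ ≤ ‖μ‖ * (1 - θ) * ‖u‖) :
    ∃ w : H, ∃ ε : ℂ, inner ℂ g w = 0 ∧ ‖w‖ ≤ 4 * e / θ ∧ ‖ε‖ ≤ 2 * e ∧
      K (g + w) = (μ * (1 + ε)) • (g + w) := by
  have hμ' : 0 < ‖μ‖ := norm_pos_iff.2 hμ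
  have hgg : inner ℂ g g = 1 := by
    rw [← ofReal_norm_sq_eq_inner, hg]; simp
  -- A ball of radius $\rho$ is mapped to itself once $e\le\rho(\theta-2e)$, which $\rho=4e/\theta$
  -- satisfies with room.
  set ρ := 4 * e / θ with hρ
  have hρθ : ρ * θ = 4 * e := by rw [hρ]; field_simp
  have hρ0 : 0 ≤ ρ := by positivity
  have hρ1 : ρ ≤ 1 / 16 := by rw [hρ, div_le_iff₀ hθ0]; linarith
  -- For an eigenvector $g+w$ with $w\perp g$, the eigenvalue must be `D w`, and the component
  -- orthogonal to `g` gives `N w = D w • w`. So $w$ is a fixed point of $N/D$: the gap makes $N$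
  -- contract by $|\mu|(1-\theta)$, while $D$ stays within $O(e|\mu|)$ of $\mu$.
  let D : H → ℂ := fun w => inner ℂ g (K (g + w))
  let N : H → H := fun w => K (g + w) - D w • g
  let s : Set H := {w | inner ℂ g w = 0} ∩ Metric.closedBall 0 ρ
  have hs : IsComplete s :=
    ((isClosed_eq (by fun_prop) (by fun_prop)).inter Metric.isClosed_closedBall).isComplete
  have hPn (v : H) : ‖v - (inner ℂ g v : ℂ) • g‖ ≤ ‖v‖ := by
    have h1 : ‖v‖ ^ 2 = ‖v - (inner ℂ g v : ℂ) • g‖ ^ 2 + ‖(inner ℂ g v : ℂ) • g‖ ^ 2 := by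
      have := norm_add_sq_eq_norm_sq_add_norm_sq_of_inner_eq_zero (𝕜 := ℂ)
        (v - (inner ℂ g v : ℂ) • g) ((inner ℂ g v : ℂ) • g) ?_
      · simpa [sq] using this
      · rw [inner_smul_right, inner_sub_left, inner_smul_left, hgg, mul_one, inner_conj_symm,
          sub_self, mul_zero]
    exact le_of_sq_le_sq (by nlinarith [sq_nonneg ‖(inner ℂ g v : ℂ) • g‖]) (norm_nonneg _)
  have hD (w : H) (hw : inner ℂ g w = 0) : ‖D w - μ‖ ≤ e * ‖μ‖ * (1 + ‖w‖) := by
    have h1 := hKt g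
    have h2 := hKt w
    rw [hgg, mul_one, hg, mul_one] at h1
    rw [hw, mul_zero, sub_zero] at h2
    have : D w - μ = (inner ℂ g (K g) - μ) + inner ℂ g (K w) := by
      simp only [D, map_add, inner_add_right]; ring
    rw [this]
    exact (norm_add_le _ _).trans (by linarith)
  have hDd (w w' : H) (hw : inner ℂ g w = 0) (hw' : inner ℂ g w' = 0) :
      ‖D w - D w'‖ ≤ e * ‖μ‖ * ‖w - w'‖ := by
    have h2 := hKt (w - w')
    rw [inner_sub_right, hw, hw', sub_zero, mul_zero, sub_zero] at h2
    have : D w - D w' = inner ℂ g (K (w - w')) := by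
      simp only [D, map_add, map_sub, inner_add_right, inner_sub_right]; ring
    rwa [this]
  have hNd (w w' : H) (hw : inner ℂ g w = 0) (hw' : inner ℂ g w' = 0) :
      ‖N w - N w'‖ ≤ ‖μ‖ * (1 - θ) * ‖w - w'‖ := by
    have h0 : N w - N w' = K (w - w') - (inner ℂ g (K (w - w')) : ℂ) • g := by
      simp only [N, D, map_add, map_sub, inner_add_right, inner_sub_right, sub_smul, add_smul]
      abel
    rw [h0]
    exact (hPn _).trans (hgap _ (by rw [inner_sub_right, hw, hw', sub_zero]))
  have hN0 : ‖N 0‖ ≤ e * ‖μ‖ := by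
    have h0 : N 0 = (K g - μ • g) - (inner ℂ g (K g - μ • g) : ℂ) • g := by
      simp only [N, D, add_zero, inner_sub_right, inner_smul_right, hgg, mul_one, sub_smul]
      abel
    rw [h0]
    exact (hPn _).trans hKg
  have hNw (w : H) (hw : inner ℂ g w = 0) : ‖N w‖ ≤ ‖μ‖ * (e + (1 - θ) * ‖w‖) := by
    have h1 := hNd w 0 hw (by simp)
    rw [sub_zero] at h1
    have h2 : N w = (N w - N 0) + N 0 := by abel
    rw [h2]
    exact (norm_add_le _ _).trans (by linarith)
  have hNg (w : H) : inner ℂ g (N w) = 0 := by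
    simp only [N, D, inner_sub_right, inner_smul_right, hgg, mul_one, sub_self]
  have hDlow (w : H) (hw : w ∈ s) : ‖μ‖ * (1 - 2 * e) ≤ ‖D w‖ := by
    have h1 := hD w hw.1
    have h2 : ‖w‖ ≤ ρ := by simpa using hw.2
    have h3 : ‖μ‖ ≤ ‖D w‖ + ‖D w - μ‖ := by
      have : μ = D w - (D w - μ) := by ring
      calc ‖μ‖ = ‖D w - (D w - μ)‖ := by rw [← this]
        _ ≤ _ := norm_sub_le _ _
    have h4 : e * ‖μ‖ * (1 + ‖w‖) ≤ e * ‖μ‖ * 2 := by gcongr; linarith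
    linarith
  have hfac : 0 < 1 - 2 * e := by linarith
  have hDpos (w : H) (hw : w ∈ s) : 0 < ‖D w‖ := (mul_pos hμ' hfac).trans_le (hDlow w hw)
  let Φ : H → H := fun w => (D w)⁻¹ • N w
  have hmaps : Set.MapsTo Φ s s := by
    intro w hw
    refine ⟨?_, ?_⟩
    · change inner ℂ g ((D w)⁻¹ • N w) = 0
      rw [inner_smul_right, hNg, mul_zero]
    · have h2 : ‖w‖ ≤ ρ := by simpa using hw.2
      rw [mem_closedBall_zero_iff]
      simp only [Φ]
      rw [norm_smul, norm_inv, inv_mul_le_iff₀ (hDpos w hw)]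
      refine (hNw w hw.1).trans ?_
      refine le_trans ?_ (mul_le_mul_of_nonneg_right (hDlow w hw) hρ0)
      rw [mul_assoc]
      gcongr
      have : (1 - θ) * ‖w‖ ≤ (1 - θ) * ρ := by gcongr
      nlinarith
  have hlip : ∀ w ∈ s, ∀ w' ∈ s, ‖Φ w - Φ w'‖ ≤ (1 - θ / 2) * ‖w - w'‖ := by
    intro w hw w' hw'
    have hd : 0 < ‖D w‖ := hDpos w hw
    have hd' : 0 < ‖D w'‖ := hDpos w' hw'
    have hDw : D w ≠ 0 := norm_pos_iff.1 hd
    have hDw' : D w' ≠ 0 := norm_pos_iff.1 hd'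
    have h0 : Φ w - Φ w' = (D w)⁻¹ • ((N w - N w') - (D w - D w') • Φ w') := by
      have hc : (D w)⁻¹ * ((D w - D w') * (D w')⁻¹) = (D w')⁻¹ - (D w)⁻¹ := by field_simp
      simp only [Φ, smul_sub, smul_smul]
      rw [hc, sub_smul]
      abel
    have hΦ : ‖Φ w'‖ ≤ 1 := by
      have := (hmaps hw').2
      rw [mem_closedBall_zero_iff] at this
      linarith
    rw [h0, norm_smul, norm_inv, inv_mul_le_iff₀ hd]
    refine (norm_sub_le _ _).trans ?_
    rw [norm_smul]
    have h1 := hNd w w' hw.1 hw'.1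
    have h2 := hDd w w' hw.1 hw'.1
    have h3 : ‖D w - D w'‖ * ‖Φ w'‖ ≤ e * ‖μ‖ * ‖w - w'‖ * 1 := by gcongr
    have h4 : ‖μ‖ * (1 - 2 * e) * ((1 - θ / 2) * ‖w - w'‖) ≤ ‖D w‖ * ((1 - θ / 2) * ‖w - w'‖) := by
      have := hDlow w hw
      have : 0 ≤ (1 - θ / 2) * ‖w - w'‖ := mul_nonneg (by linarith) (norm_nonneg _)
      gcongr
    have h5 : ‖μ‖ * (1 - θ) * ‖w - w'‖ + e * ‖μ‖ * ‖w - w'‖ ≤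
        ‖μ‖ * (1 - 2 * e) * ((1 - θ / 2) * ‖w - w'‖) := by
      have h6 : (1 - θ) + e ≤ (1 - 2 * e) * (1 - θ / 2) := by nlinarith
      calc _ = (‖μ‖ * ‖w - w'‖) * ((1 - θ) + e) := by ring
        _ ≤ (‖μ‖ * ‖w - w'‖) * ((1 - 2 * e) * (1 - θ / 2)) := by gcongr
        _ = _ := by ring
    linarith
  have h0s : (0 : H) ∈ s := ⟨by simp, by simpa using hρ0⟩
  have hcontr : ContractingWith (Real.toNNReal (1 - θ / 2)) (hmaps.restrict Φ s s) := by
    refine ⟨?_, LipschitzWith.of_dist_le_mul fun x y => ?_⟩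
    · rw [Real.toNNReal_lt_one]; linarith
    · rw [Real.coe_toNNReal _ (by linarith), Subtype.dist_eq, Subtype.dist_eq, dist_eq_norm,
        dist_eq_norm]
      exact hlip x x.2 y y.2
  obtain ⟨w, hw, hfix, -⟩ := hcontr.exists_fixedPoint' hs hmaps h0s (edist_ne_top _ _)
  have hDw : D w ≠ 0 := norm_pos_iff.1 (hDpos w hw)
  have h2 : ‖w‖ ≤ ρ := by simpa using hw.2
  refine ⟨w, D w / μ - 1, hw.1, h2, ?_, ?_⟩
  · have : D w / μ - 1 = (D w - μ) / μ := by field_simp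
    rw [this, norm_div, div_le_iff₀ hμ']
    refine (hD w hw.1).trans ?_
    have h4 : e * ‖μ‖ * (1 + ‖w‖) ≤ e * ‖μ‖ * 2 := by gcongr; linarith
    linarith
  · have h3 : N w = D w • w := by
      have : (D w)⁻¹ • N w = w := hfix
      rw [← this, smul_smul, this, mul_inv_cancel₀ hDw, one_smul]
    have h4 : K (g + w) = N w + D w • g := by simp [N]
    have h5 : μ * (1 + (D w / μ - 1)) = D w := by field_simp; ring
    rw [h4, h3, h5, smul_add, add_comm]

theorem star_add_L2R (u v : L2R) : star (u + v) = star u + star v := by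
  apply Lp.ext
  filter_upwards [Lp.coeFn_star (u + v), Lp.coeFn_add u v, Lp.coeFn_add (star u) (star v),
    Lp.coeFn_star u, Lp.coeFn_star v] with x h1 h2 h3 h4 h5
  rw [h1, Pi.star_apply, h2, h3, Pi.add_apply, Pi.add_apply, h4, h5, Pi.star_apply, Pi.star_apply,
    star_add]

theorem star_smul_L2R (c : ℂ) (u : L2R) : star (c • u) = (starRingEnd ℂ) c • star u := by
  apply Lp.ext
  filter_upwards [Lp.coeFn_star (c • u), Lp.coeFn_smul c u,
    Lp.coeFn_smul ((starRingEnd ℂ) c) (star u), Lp.coeFn_star u] with x h1 h2 h3 h4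
  simp [h1, h2, h3, h4]

theorem star_sub_L2R (u v : L2R) : star (u - v) = star u - star v := by
  rw [sub_eq_add_neg, ← neg_one_smul ℂ v, star_add_L2R, star_smul_L2R]
  simp [sub_eq_add_neg]

theorem norm_star_L2R (u : L2R) : ‖star u‖ = ‖u‖ := by
  refine le_antisymm (Lp.norm_le_norm_of_ae_le ?_) (Lp.norm_le_norm_of_ae_le ?_) <;>
  · filter_upwards [Lp.coeFn_star u] with x h
    rw [h]
    simp

theorem mem_conjPerp {u v : L2R} : v ∈ conjPerp u ↔ inner ℂ (star u) v = 0 :=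
  Submodule.mem_orthogonal_singleton_iff_inner_right

/-- By symmetry of the bilinear form and reality of `g`, an approximate right eigenvector is also an
approximate left eigenvector, with the same error. -/
theorem inner_approx_of_symm {K : L2R →L[ℂ] L2R} {g : L2R} (hgs : star g = g)
    (hsym : ∀ u v, inner ℂ (star v) (K u) = inner ℂ (star (K v)) u) (μ : ℂ) (w : L2R) :
    ‖inner ℂ g (K w) - μ * inner ℂ g w‖ ≤ ‖K g - μ • g‖ * ‖w‖ := by
  have h1 : inner ℂ g (K w) - μ * inner ℂ g w = inner ℂ (star (K g - μ • g)) w := by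
    rw [star_sub_L2R, star_smul_L2R, inner_sub_left, inner_smul_left, Complex.conj_conj, hgs,
      ← hsym, hgs]
  rw [h1]
  exact (norm_inner_le_norm _ _).trans_eq (by rw [norm_star_L2R])

/-- The norm bound on a subspace of vectors nearly orthogonal to an approximate eigenvector. -/
theorem norm_le_of_nearly_orthogonal {H : Type*} [NormedAddCommGroup H] [InnerProductSpace ℂ H]
    (K : H →L[ℂ] H) (g : H) (hg : ‖g‖ = 1) {μ : ℂ} {e θ σ : ℝ}
    (he : 0 ≤ e) (hθ : θ ≤ 1 / 2) (heθ : 64 * e ≤ θ) (hσ0 : 0 ≤ σ) (hσ : σ * θ ≤ 8 * e)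
    (hKg : ‖K g - μ • g‖ ≤ e * ‖μ‖)
    (hKt : ∀ w, ‖inner ℂ g (K w) - μ * inner ℂ g w‖ ≤ e * ‖μ‖ * ‖w‖)
    (hgap : ∀ u, inner ℂ g u = 0 → ‖K u‖ ≤ ‖μ‖ * (1 - θ) * ‖u‖) (u : H)
    (hu : ‖inner ℂ g u‖ ≤ σ * ‖u‖) : ‖K u‖ ≤ ‖μ‖ * (1 - θ + 4 * e) * ‖u‖ := by
  have hgg : inner ℂ g g = 1 := by
    rw [← ofReal_norm_sq_eq_inner, hg]; simp
  obtain ⟨c, hc⟩ : ∃ c : ℂ, c = inner ℂ g u := ⟨_, rfl⟩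
  rw [← hc] at hu
  obtain ⟨v, hv⟩ : ∃ v : H, v = u - c • g := ⟨_, rfl⟩
  have huv : u = c • g + v := by rw [hv]; abel
  have hgv : inner ℂ g v = 0 := by
    rw [hv, inner_sub_right, inner_smul_right, hgg, hc, mul_one, sub_self]
  have hn : ‖u‖ ^ 2 = ‖c‖ ^ 2 + ‖v‖ ^ 2 := by
    have := norm_add_sq_eq_norm_sq_add_norm_sq_of_inner_eq_zero (𝕜 := ℂ) (c • g) v
      (by rw [inner_smul_left, hgv, mul_zero])
    rw [← huv, norm_smul, hg, mul_one] at this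
    simpa [sq] using this
  have hvu : ‖v‖ ≤ ‖u‖ := le_of_sq_le_sq (by nlinarith [sq_nonneg ‖c‖]) (norm_nonneg _)
  have hKgn : ‖K g‖ ≤ ‖μ‖ * (1 + e) := by
    have h1 : K g = (K g - μ • g) + μ • g := by abel
    rw [h1]
    refine (norm_add_le _ _).trans ?_
    rw [norm_smul, hg]
    linarith
  -- `K g` is nearly $\mu g$, and `K v` is nearly orthogonal to `g` because `v` is; hence the cross
  -- term is only $O(e)$.
  have hcross : ‖inner ℂ (K g) (K v)‖ ≤ 2 * e * ‖μ‖ ^ 2 * ‖v‖ := by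
    have h1 : inner ℂ (K g) (K v) = inner ℂ (K g - μ • g) (K v) +
        (starRingEnd ℂ) μ * inner ℂ g (K v) := by
      rw [inner_sub_left, inner_smul_left]; ring
    rw [h1]
    refine (norm_add_le _ _).trans ?_
    have h2 := hKt v
    rw [hgv, mul_zero, sub_zero] at h2
    have h3 : ‖inner ℂ (K g - μ • g) (K v)‖ ≤ (e * ‖μ‖) * (‖μ‖ * (1 - θ) * ‖v‖) :=
      (norm_inner_le_norm _ _).trans (mul_le_mul hKg (hgap v hgv) (norm_nonneg _) (by positivity))
    have h4 : (e * ‖μ‖) * (‖μ‖ * (1 - θ) * ‖v‖) ≤ (e * ‖μ‖) * (‖μ‖ * 1 * ‖v‖) := by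
      gcongr
      linarith
    rw [norm_mul, RCLike.norm_conj]
    have h5 : ‖μ‖ * ‖inner ℂ g (K v)‖ ≤ ‖μ‖ * (e * ‖μ‖ * ‖v‖) := by gcongr
    nlinarith
  have hexp : ‖K u‖ ^ 2 ≤ ‖c‖ ^ 2 * ‖K g‖ ^ 2 + 2 * (‖c‖ * ‖inner ℂ (K g) (K v)‖) + ‖K v‖ ^ 2 := by
    have h1 : K u = c • K g + K v := by rw [huv, map_add, map_smul]
    rw [h1, norm_add_sq (𝕜 := ℂ), norm_smul, mul_pow]
    have h2 : RCLike.re (inner ℂ (c • K g) (K v)) ≤ ‖c‖ * ‖inner ℂ (K g) (K v)‖ := by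
      refine (RCLike.re_le_norm _).trans ?_
      rw [inner_smul_left, norm_mul, RCLike.norm_conj]
    linarith
  have hm2 : 0 ≤ ‖μ‖ ^ 2 := sq_nonneg _
  have hKv : ‖K v‖ ^ 2 ≤ ‖μ‖ ^ 2 * ((1 - θ) ^ 2 * ‖v‖ ^ 2) := by
    calc ‖K v‖ ^ 2 ≤ (‖μ‖ * (1 - θ) * ‖v‖) ^ 2 := by
          gcongr
          exact hgap v hgv
      _ = _ := by ring
  have h1 : ‖c‖ ^ 2 * ‖K g‖ ^ 2 ≤ ‖μ‖ ^ 2 * ((1 + e) ^ 2 * ‖c‖ ^ 2) := by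
    calc ‖c‖ ^ 2 * ‖K g‖ ^ 2 ≤ ‖c‖ ^ 2 * (‖μ‖ * (1 + e)) ^ 2 := by gcongr
      _ = _ := by ring
  have h2 : 2 * (‖c‖ * ‖inner ℂ (K g) (K v)‖) ≤ ‖μ‖ ^ 2 * (4 * e * (‖c‖ * ‖u‖)) := by
    calc 2 * (‖c‖ * ‖inner ℂ (K g) (K v)‖) ≤ 2 * (‖c‖ * (2 * e * ‖μ‖ ^ 2 * ‖u‖)) := by
          gcongr
          exact hcross.trans (by gcongr)
      _ = _ := by ring
  have hθ0 : 0 ≤ θ := by linarith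
  have h3 : (1 + e) ^ 2 * ‖c‖ ^ 2 + 4 * e * (‖c‖ * ‖u‖) + (1 - θ) ^ 2 * ‖v‖ ^ 2 ≤
      (1 - θ + 4 * e) ^ 2 * ‖u‖ ^ 2 := by
    have hv2 : ‖v‖ ^ 2 = ‖u‖ ^ 2 - ‖c‖ ^ 2 := by linarith
    rw [hv2]
    have h4 : ((1 + e) ^ 2 - (1 - θ) ^ 2) * ‖c‖ ^ 2 ≤ 3 * θ * ‖c‖ ^ 2 := by
      gcongr
      nlinarith
    have h5 : ‖c‖ ^ 2 ≤ (σ * ‖u‖) ^ 2 := by gcongr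
    have h6 : 3 * θ * ‖c‖ ^ 2 ≤ 3 * θ * (σ * ‖u‖) ^ 2 := by gcongr
    have h7 : ‖c‖ * ‖u‖ ≤ σ * ‖u‖ ^ 2 := by
      calc ‖c‖ * ‖u‖ ≤ (σ * ‖u‖) * ‖u‖ := by gcongr
        _ = _ := by ring
    have h8 : 4 * e * (‖c‖ * ‖u‖) ≤ 4 * e * (σ * ‖u‖ ^ 2) := by gcongr
    -- From $\sigma\theta\le8e$ and $64e\le\theta$ one gets $\sigma\le1/8$, so the component along
    -- `g` costs only a multiple of `e`.
    have h9 : 3 * θ * σ ^ 2 + 4 * e * σ ≤ 4 * e := by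
      rcases eq_or_lt_of_le hθ0 with h0 | h0
      · have he0 : e = 0 := by linarith
        rw [← h0, he0]; simp
      · have hσ1 : σ ≤ 1 / 8 := by
          have : σ * θ ≤ 1 / 8 * θ := by linarith
          exact le_of_mul_le_mul_right this h0
        have : 3 * θ * σ ^ 2 = 3 * (σ * θ) * σ := by ring
        rw [this]
        have h10 : 3 * (σ * θ) * σ ≤ 3 * (8 * e) * (1 / 8) := by gcongr
        have h11 : 4 * e * σ ≤ 4 * e * (1 / 8) := by gcongr
        linarith
    have h12 : (3 * θ * σ ^ 2 + 4 * e * σ) * ‖u‖ ^ 2 ≤ 4 * e * ‖u‖ ^ 2 := by gcongr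
    have h13 : (1 - θ) ^ 2 + 4 * e ≤ (1 - θ + 4 * e) ^ 2 := by nlinarith
    have h14 : ((1 - θ) ^ 2 + 4 * e) * ‖u‖ ^ 2 ≤ (1 - θ + 4 * e) ^ 2 * ‖u‖ ^ 2 := by gcongr
    linarith
  have hfin : ‖K u‖ ^ 2 ≤ (‖μ‖ * (1 - θ + 4 * e) * ‖u‖) ^ 2 := by
    calc ‖K u‖ ^ 2 ≤ ‖μ‖ ^ 2 * ((1 + e) ^ 2 * ‖c‖ ^ 2 + 4 * e * (‖c‖ * ‖u‖) +
          (1 - θ) ^ 2 * ‖v‖ ^ 2) := by linarith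
      _ ≤ ‖μ‖ ^ 2 * ((1 - θ + 4 * e) ^ 2 * ‖u‖ ^ 2) := by gcongr
      _ = _ := by ring
  refine le_of_sq_le_sq hfin ?_
  have : 0 ≤ 1 - θ + 4 * e := by linarith
  positivity

/-- Spectral consequences of an approximate eigenvector with a spectral gap, for operators that are
symmetric with respect to the bilinear form `∫ u v`. -/
theorem spectral_gap_consequences {K : L2R →L[ℂ] L2R} {g : L2R} (hg : ‖g‖ = 1)
    (hgs : star g = g) (hsym : ∀ u v, inner ℂ (star v) (K u) = inner ℂ (star (K v)) u)
    {μ : ℂ} (hμ : μ ≠ 0) {e θ : ℝ} (he : 0 ≤ e) (hθ : θ ≤ 1 / 2) (heθ : 64 * e ≤ θ) (hθ0 : 0 < θ)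
    (hKg : ‖K g - μ • g‖ ≤ e * ‖μ‖)
    (hgap : ∀ u, inner ℂ g u = 0 → ‖K u‖ ≤ ‖μ‖ * (1 - θ) * ‖u‖) :
    ∃ l₀ : ℂ, Module.End.HasEigenvalue (K : L2R →ₗ[ℂ] L2R) l₀ ∧
      (∀ l : ℂ, Module.End.HasEigenvalue (K : L2R →ₗ[ℂ] L2R) l → l ≠ l₀ → ‖l‖ < ‖l₀‖) ∧
      Module.finrank ℂ (Module.End.eigenspace (K : L2R →ₗ[ℂ] L2R) l₀) = 1 ∧
      (∃ ε : ℂ, ‖ε‖ ≤ 2 * e ∧ l₀ = μ * (1 + ε)) ∧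
      ∃ u₀ : L2R, IsNormalizedEigenfunction K g l₀ u₀ ∧
        (∀ v : L2R, IsNormalizedEigenfunction K g l₀ v → v = u₀) ∧
        ‖u₀ - g‖ ≤ 8 * e / θ ∧
        (∀ u ∈ conjPerp u₀, K u ∈ conjPerp u₀) ∧
        ∀ u ∈ conjPerp u₀, ‖K u‖ ≤ ‖l₀‖ * (1 - θ + 8 * e) * ‖u‖ := by
  have hμ' : 0 < ‖μ‖ := norm_pos_iff.2 hμ
  have hKt (w : L2R) : ‖inner ℂ g (K w) - μ * inner ℂ g w‖ ≤ e * ‖μ‖ * ‖w‖ :=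
    (inner_approx_of_symm hgs hsym μ w).trans (by gcongr)
  have hgg : inner ℂ g g = 1 := by
    rw [← ofReal_norm_sq_eq_inner, hg]; simp
  obtain ⟨w, ε, hgw, hw, hε, hKw⟩ := exists_eigenvector_of_gap K g hg hμ he (by linarith) heθ hθ0
    hKg hKt hgap
  obtain ⟨l₀, hl₀⟩ : ∃ l₀ : ℂ, l₀ = μ * (1 + ε) := ⟨_, rfl⟩
  rw [← hl₀] at hKw
  have hlow : ‖μ‖ * (1 - 2 * e) ≤ ‖l₀‖ := by
    rw [hl₀, norm_mul]
    gcongr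
    have h1 : ‖(1 : ℂ)‖ ≤ ‖1 + ε‖ + ‖ε‖ := by
      have : (1 : ℂ) = (1 + ε) - ε := by ring
      calc ‖(1 : ℂ)‖ = ‖(1 + ε) - ε‖ := by rw [← this]
        _ ≤ _ := norm_sub_le _ _
    rw [norm_one] at h1
    linarith
  have hl₀pos : 0 < ‖l₀‖ := lt_of_lt_of_le (mul_pos hμ' (by linarith)) hlow
  obtain ⟨n, hn⟩ : ∃ n : ℝ, n = ‖g + w‖ := ⟨_, rfl⟩
  have hn2 : n ^ 2 = 1 + ‖w‖ ^ 2 := by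
    have := norm_add_sq_eq_norm_sq_add_norm_sq_of_inner_eq_zero (𝕜 := ℂ) g w hgw
    rw [hn]
    simpa [sq, hg] using this
  have hn1 : 1 ≤ n := by
    refine le_of_sq_le_sq ?_ (by rw [hn]; positivity)
    nlinarith [sq_nonneg ‖w‖]
  have hnw : n ≤ 1 + ‖w‖ := by
    rw [hn]
    exact (norm_add_le _ _).trans_eq (by rw [hg])
  have hn0 : (n : ℂ) ≠ 0 := by
    have : n ≠ 0 := by linarith
    exact_mod_cast this
  obtain ⟨u₀, hu₀⟩ : ∃ u₀ : L2R, u₀ = (n : ℂ)⁻¹ • (g + w) := ⟨_, rfl⟩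
  have hgw' : g + w = (n : ℂ) • u₀ := by rw [hu₀, smul_smul, mul_inv_cancel₀ hn0, one_smul]
  have hu₀n : ‖u₀‖ = 1 := by
    rw [hu₀, norm_smul, norm_inv, Complex.norm_real, ← hn, Real.norm_of_nonneg (by linarith)]
    field_simp
  have hKu₀ : K u₀ = l₀ • u₀ := by rw [hu₀, map_smul, hKw, smul_comm]
  have hgu₀ : inner ℂ u₀ g = (((n⁻¹ : ℝ)) : ℂ) := by
    have h1 : inner ℂ g (g + w) = 1 := by rw [inner_add_right, hgg, hgw, add_zero]
    rw [hu₀, inner_smul_left, ← inner_conj_symm, h1]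
    simp
  have hdist : ‖u₀ - g‖ ≤ 8 * e / θ := by
    have h1 : u₀ - g = w + (1 - (n : ℂ)) • u₀ := by
      rw [sub_smul, one_smul, ← hgw']; abel
    rw [h1]
    refine (norm_add_le _ _).trans ?_
    rw [norm_smul, hu₀n, mul_one]
    have h2 : ‖(1 : ℂ) - n‖ = n - 1 := by
      rw [← Complex.ofReal_one, ← Complex.ofReal_sub, Complex.norm_real, Real.norm_eq_abs,
        abs_sub_comm, abs_of_nonneg (by linarith)]
    rw [h2]
    have : 8 * e / θ = 4 * e / θ + 4 * e / θ := by ring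
    linarith
  have hdist8 : 8 * e / θ ≤ 1 / 8 := by rw [div_le_iff₀ hθ0]; linarith
  have hnorm (u : L2R) (hu : u ∈ conjPerp u₀) : ‖K u‖ ≤ ‖l₀‖ * (1 - θ + 8 * e) * ‖u‖ := by
    rw [mem_conjPerp] at hu
    have h1 : ‖inner ℂ g u‖ ≤ 8 * e / θ * ‖u‖ := by
      have h2 : inner ℂ g u = inner ℂ (star (g - u₀)) u := by
        rw [star_sub_L2R, inner_sub_left, hu, sub_zero, hgs]
      rw [h2]
      refine (norm_inner_le_norm _ _).trans ?_
      rw [norm_star_L2R, norm_sub_rev]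
      gcongr
    have h3 := norm_le_of_nearly_orthogonal K g hg he hθ heθ (by positivity)
      (by field_simp; rfl) hKg hKt hgap u h1
    refine h3.trans (mul_le_mul_of_nonneg_right ?_ (norm_nonneg _))
    calc ‖μ‖ * (1 - θ + 4 * e) ≤ ‖μ‖ * ((1 - 2 * e) * (1 - θ + 8 * e)) := by
          gcongr
          nlinarith
      _ = ‖μ‖ * (1 - 2 * e) * (1 - θ + 8 * e) := by ring
      _ ≤ _ := by
          have : 0 ≤ 1 - θ + 8 * e := by linarith
          gcongr
  -- Eigenvectors for distinct eigenvalues are orthogonal for $\int uv$, so all other eigenvectors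
  -- lie in $\bar u_0^\perp$, where the gap applies.
  have hsym_eig (v : L2R) {l : ℂ} (hv : K v = l • v) :
      l * inner ℂ (star u₀) v = l₀ * inner ℂ (star u₀) v := by
    have h1 := hsym v u₀
    rwa [hv, hKu₀, inner_smul_right, star_smul_L2R, inner_smul_left, Complex.conj_conj] at h1
  have hperp_eig (v : L2R) {l : ℂ} (hv : K v = l • v) (hperp : v ∈ conjPerp u₀) (hv0 : v ≠ 0) :
      ‖l‖ < ‖l₀‖ := by
    have h1 := hnorm v hperp
    have hvpos : 0 < ‖v‖ := norm_pos_iff.2 hv0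
    rw [hv, norm_smul] at h1
    have h2 := le_of_mul_le_mul_right h1 hvpos
    refine h2.trans_lt ?_
    have : 1 - θ + 8 * e < 1 := by linarith
    nlinarith
  -- $\int u_0^2$ is nonzero because $u_0$ is within $1/8$ of the real unit vector `g`, hence within
  -- $1/4$ of its own conjugate. This permits projecting off $u_0$ with the bilinear form.
  have hself : inner ℂ (star u₀) u₀ ≠ 0 := by
    intro h0
    have h1 : (1 : ℂ) = inner ℂ (u₀ - star u₀) u₀ := by
      rw [inner_sub_left, h0, sub_zero, ← ofReal_norm_sq_eq_inner, hu₀n]; simp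
    have h2 : ‖u₀ - star u₀‖ ≤ 1 / 8 + 1 / 8 := by
      have h3 : u₀ - star u₀ = (u₀ - g) - star (u₀ - g) := by
        rw [star_sub_L2R, hgs]; abel
      rw [h3]
      refine (norm_sub_le _ _).trans ?_
      rw [norm_star_L2R]
      linarith
    have h4 := norm_inner_le_norm (𝕜 := ℂ) (u₀ - star u₀) u₀
    rw [← h1, norm_one, hu₀n] at h4
    linarith
  -- Subtracting the bilinear projection leaves a vector of $\bar u_0^\perp$ which, if nonzero,
  -- would be an eigenvector there for $l_0$, against the strict inequality.
  have heigen (v : L2R) (hv : K v = l₀ • v) : ∃ c : ℂ, c • u₀ = v := by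
    refine ⟨inner ℂ (star u₀) v / inner ℂ (star u₀) u₀, ?_⟩
    by_contra hne
    refine lt_irrefl _ (hperp_eig
      (v - (inner ℂ (star u₀) v / inner ℂ (star u₀) u₀) • u₀) (l := l₀) ?_ ?_ ?_)
    · rw [map_sub, map_smul, hv, hKu₀, smul_sub, smul_comm]
    · rw [mem_conjPerp, inner_sub_right, inner_smul_right]
      field_simp
      simp
    · rw [sub_ne_zero]
      exact fun h => hne h.symm
  have hu₀0 : u₀ ≠ 0 := by
    rw [← norm_pos_iff, hu₀n]; exact one_pos
  have hu₀mem : u₀ ∈ Module.End.eigenspace (K : L2R →ₗ[ℂ] L2R) l₀ :=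
    Module.End.mem_eigenspace_iff.2 hKu₀
  refine ⟨l₀, Module.End.hasEigenvalue_of_hasEigenvector ⟨hu₀mem, hu₀0⟩, ?_, ?_, ⟨ε, hε, hl₀⟩, u₀,
    ⟨hKu₀, hu₀n, ?_, ?_⟩, ?_, hdist, ?_, hnorm⟩
  · intro l hl hne
    obtain ⟨v, hv, hv0⟩ := hl.exists_hasEigenvector
    have hKv : K v = l • v := Module.End.mem_eigenspace_iff.1 hv
    refine hperp_eig v hKv ?_ hv0
    rw [mem_conjPerp]
    have h1 := hsym_eig v hKv
    by_contra h0
    exact hne (mul_right_cancel₀ h0 h1)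
  · refine finrank_eq_one ⟨u₀, hu₀mem⟩ ?_ ?_
    · intro h
      exact hu₀0 (congrArg Subtype.val h)
    · rintro ⟨v, hv⟩
      obtain ⟨c, hc⟩ := heigen v (Module.End.mem_eigenspace_iff.1 hv)
      exact ⟨c, Subtype.ext hc⟩
  · rw [hgu₀, Complex.ofReal_im]
  · rw [hgu₀, Complex.ofReal_re]
    positivity
  · rintro v ⟨hv, hvn, him, hre⟩
    obtain ⟨c, rfl⟩ := heigen v hv
    rw [norm_smul, hu₀n, mul_one] at hvn
    rw [inner_smul_left, hgu₀, Complex.im_mul_ofReal, Complex.conj_im] at him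
    rw [inner_smul_left, hgu₀, Complex.re_mul_ofReal, Complex.conj_re] at hre
    have hnpos : 0 < n⁻¹ := by positivity
    have him' : c.im = 0 := by
      rcases mul_eq_zero.1 him with h | h
      · linarith
      · exact absurd h hnpos.ne'
    have hre' : 0 ≤ c.re := nonneg_of_mul_nonneg_left hre hnpos
    have hc : c = (c.re : ℂ) := Complex.ext rfl (by simpa using him')
    rw [hc, Complex.norm_real, Real.norm_of_nonneg hre'] at hvn
    rw [hc, hvn]
    simp
  · intro u hu
    rw [mem_conjPerp] at hu ⊢
    rw [hsym, hKu₀, star_smul_L2R, inner_smul_left, hu, mul_zero]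

/-! ### Localization by a quadratic partition of unity. -/

theorem integrable_norm_sq (u : L2R) : Integrable fun x => ‖u x‖ ^ 2 :=
  (memLp_two_iff_integrable_sq_norm (Lp.aestronglyMeasurable u)).1 (Lp.memLp u)

theorem norm_sq_eq_integral (u : L2R) : ‖u‖ ^ 2 = ∫ x, ‖u x‖ ^ 2 := by
  have h := ofReal_norm_sq_eq_inner u
  rw [inner_eq_integral] at h
  have h2 : ∫ x, (starRingEnd ℂ) (u x) * u x = ((∫ x, ‖u x‖ ^ 2 : ℝ) : ℂ) := by
    rw [← integral_complex_ofReal]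
    refine integral_congr_ae (Filter.Eventually.of_forall fun x => ?_)
    simp only
    rw [← Complex.normSq_eq_conj_mul_self, Complex.normSq_eq_norm_sq]
  rw [h2] at h
  exact_mod_cast h

/-- Multiplication of an `L₂` function by a bounded continuous function. -/
theorem exists_mul_continuous {f : ℝ → ℂ} (hf : Continuous f) (hf1 : ∀ x, ‖f x‖ ≤ 1) (u : L2R) :
    ∃ v : L2R, ∀ᵐ x : ℝ, v x = f x * u x := by
  have h : MemLp (fun x => f x * u x) 2 volume := by
    refine (Lp.memLp u).of_le (hf.aestronglyMeasurable.mul (Lp.aestronglyMeasurable u))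
      (Filter.Eventually.of_forall fun x => ?_)
    rw [norm_mul]
    exact mul_le_of_le_one_left (norm_nonneg _) (hf1 x)
  exact ⟨h.toLp _, h.coeFn_toLp⟩

theorem norm_le_mul_norm_of_ae {c : ℝ} {u v : L2R} (h : ∀ᵐ x : ℝ, ‖v x‖ ≤ c * ‖u x‖) :
    ‖v‖ ≤ c * ‖u‖ :=
  Lp.norm_le_mul_norm_of_ae_le_mul h

theorem norm_cexp_sub_cexp_le {z w : ℂ} (hz : z.re ≤ 0) (hw : w.re ≤ 0) :
    ‖Complex.exp z - Complex.exp w‖ ≤ ‖z - w‖ := by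
  have hconv : Convex ℝ {z : ℂ | z.re ≤ 0} := convex_halfSpace_re_le 0
  have := hconv.norm_image_sub_le_of_norm_deriv_le (f := Complex.exp) (C := 1)
    (fun x _ => Complex.differentiableAt_exp) (fun x hx => by
      rw [Complex.deriv_exp, Complex.norm_exp]
      exact Real.exp_le_one_iff.2 hx) hw hz
  simpa using this

theorem norm_cexp_le_one {z : ℂ} (hz : z.re ≤ 0) : ‖Complex.exp z‖ ≤ 1 := by
  rw [Complex.norm_exp]
  exact Real.exp_le_one_iff.2 hz

theorem sq_mul_exp_le {b : ℝ} (hb : 0 < b) (t : ℝ) :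
    t ^ 2 * Real.exp (-(2 * b) * t ^ 2) ≤ 1 / b * Real.exp (-b * t ^ 2) := by
  have h1 : b * t ^ 2 ≤ Real.exp (b * t ^ 2) := by
    linarith [Real.add_one_le_exp (b * t ^ 2)]
  have h2 : Real.exp (-b * t ^ 2) = Real.exp (b * t ^ 2) * Real.exp (-(2 * b) * t ^ 2) := by
    rw [← Real.exp_add]; congr 1; ring
  rw [h2, ← mul_assoc]
  refine mul_le_mul_of_nonneg_right ?_ (Real.exp_pos _).le
  rw [div_mul_eq_mul_div, one_mul, le_div_iff₀ hb]
  linarith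

/-- Localization in the style of Ismagilov, Morgan and Simon for a kernel operator: the functions
`cos θ` and `sin θ` form a quadratic partition of unity. -/
theorem norm_sq_le_of_partition {b L : ℝ} (hb : 0 < b) {k : ℝ → ℝ → ℂ}
    (hbd : ∀ x y, ‖k x y‖ ≤ Real.exp (-(2 * b) * (x - y) ^ 2)) {T : L2R →L[ℂ] L2R}
    (hT : HasKernel T k) {θ : ℝ → ℝ}
    (hθ : ∀ x y, |θ x - θ y| ≤ L * |x - y|) {u v w : L2R}
    (hv : ∀ᵐ x : ℝ, v x = (Real.cos (θ x) : ℂ) * u x)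
    (hw : ∀ᵐ x : ℝ, w x = (Real.sin (θ x) : ℂ) * u x) :
    ‖T u‖ ^ 2 ≤ ‖T v‖ ^ 2 + ‖T w‖ ^ 2 + L ^ 2 / b * (Real.pi / b) * ‖u‖ ^ 2 := by
  have hbd' (x y : ℝ) : ‖k x y‖ ≤ Real.exp (-b * (x - y) ^ 2) :=
    (hbd x y).trans (Real.exp_le_exp.2 (by nlinarith [mul_nonneg hb.le (sq_nonneg (x - y))]))
  -- the function `z ↦ ∫ exp (-b (z - x)²) |u x| dx`
  obtain ⟨u', hu'⟩ : ∃ u' : L2R, ∀ᵐ y, u' y = (‖u y‖ : ℂ) :=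
    ⟨(Lp.memLp u).norm.ofReal.toLp _, MemLp.coeFn_toLp _⟩
  have hgk : Continuous (Function.uncurry fun x y : ℝ => ((Real.exp (-b * (x - y) ^ 2) : ℝ) : ℂ)) := by
    unfold Function.uncurry
    fun_prop
  have hgbd (x y : ℝ) : ‖((Real.exp (-b * (x - y) ^ 2) : ℝ) : ℂ)‖ ≤ Real.exp (-b * (x - y) ^ 2) := by
    rw [Complex.norm_real, Real.norm_of_nonneg (Real.exp_pos _).le]
  obtain ⟨N, -, hN⟩ := exists_hasKernel hb hgk hgbd
  have hNu : ∀ᵐ z : ℝ, N u' z = ((∫ x, Real.exp (-b * (z - x) ^ 2) * ‖u x‖ : ℝ) : ℂ) := by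
    filter_upwards [hN u'] with z hz
    rw [hz, ← integral_complex_ofReal]
    refine integral_congr_ae ?_
    filter_upwards [hu'] with x hx
    rw [hx]
    push_cast
    rfl
  have hNnorm : ‖N u'‖ ^ 2 ≤ Real.pi / b * ‖u‖ ^ 2 := by
    have h1 : ‖N u'‖ ≤ 1 * Real.sqrt (Real.pi / b) * ‖u‖ := by
      refine norm_le_of_gauss_dominated hb zero_le_one _ _ ?_
      filter_upwards [hNu] with z hz
      rw [hz, Complex.norm_real, one_mul, Real.norm_of_nonneg]
      exact integral_nonneg fun x => by positivity
    calc ‖N u'‖ ^ 2 ≤ (1 * Real.sqrt (Real.pi / b) * ‖u‖) ^ 2 := by gcongr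
      _ = _ := by rw [one_mul, mul_pow, Real.sq_sqrt (by positivity)]
  have hpt : ∀ᵐ z : ℝ, ‖T u z‖ ^ 2 ≤ ‖T v z‖ ^ 2 + ‖T w z‖ ^ 2 + L ^ 2 / b * ‖N u' z‖ ^ 2 := by
    filter_upwards [hT u, hT v, hT w, hNu] with z hz1 hz2 hz3 hz4
    set I := ∫ x, Real.exp (-b * (z - x) ^ 2) * ‖u x‖ with hI
    have hI0 : 0 ≤ I := integral_nonneg fun x => by positivity
    have hIint := integrable_gauss_mul hb u z
    set c : ℂ := (Real.cos (θ z) : ℂ)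
    set s : ℂ := (Real.sin (θ z) : ℂ)
    have hv' : ∫ y, k z y * v y = ∫ y, (Real.cos (θ y) : ℂ) * (k z y * u y) := by
      refine integral_congr_ae ?_
      filter_upwards [hv] with y hy
      rw [hy]; ring
    have hw' : ∫ y, k z y * w y = ∫ y, (Real.sin (θ y) : ℂ) * (k z y * u y) := by
      refine integral_congr_ae ?_
      filter_upwards [hw] with y hy
      rw [hy]; ring
    have hvi : Integrable fun y => (Real.cos (θ y) : ℂ) * (k z y * u y) := by
      refine hz2.1.congr ?_
      filter_upwards [hv] with y hy
      rw [hy]; ring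
    have hwi : Integrable fun y => (Real.sin (θ y) : ℂ) * (k z y * u y) := by
      refine hz3.1.congr ?_
      filter_upwards [hw] with y hy
      rw [hy]; ring
    -- Rotate the pair $(Tv(z),Tw(z))$ by the angle at the output point $z$. The first component
    -- then carries $\cos(\theta(y)-\theta(z))$ under the integral, and the second is discarded by
    -- positivity.
    have hrot : ‖T v z‖ ^ 2 + ‖T w z‖ ^ 2 =
        ‖c * T v z + s * T w z‖ ^ 2 + ‖c * T w z - s * T v z‖ ^ 2 := by
      simp only [c, s, ← Complex.normSq_eq_norm_sq, Complex.normSq_apply, Complex.add_re,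
        Complex.add_im, Complex.sub_re, Complex.sub_im, Complex.re_ofReal_mul,
        Complex.im_ofReal_mul]
      linear_combination (-((T v z).re ^ 2 + (T v z).im ^ 2 + (T w z).re ^ 2 + (T w z).im ^ 2)) *
        (Real.sin_sq_add_cos_sq (θ z))
    have hc' : c * T v z + s * T w z =
        ∫ y, (Real.cos (θ y - θ z) : ℂ) * (k z y * u y) := by
      rw [hz2.2, hz3.2, hv', hw', ← integral_const_mul, ← integral_const_mul,
        ← integral_add (hvi.const_mul c) (hwi.const_mul s)]
      refine integral_congr_ae (Filter.Eventually.of_forall fun y => ?_)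
      simp only [Real.cos_sub, c, s]
      push_cast
      ring
    have hci : Integrable fun y => (Real.cos (θ y - θ z) : ℂ) * (k z y * u y) := by
      refine ((hvi.const_mul c).add (hwi.const_mul s)).congr
        (Filter.Eventually.of_forall fun y => ?_)
      simp only [Real.cos_sub, c, s, Pi.add_apply]
      push_cast
      ring
    have hku (y : ℝ) : ‖k z y * u y‖ ≤ Real.exp (-b * (z - y) ^ 2) * ‖u y‖ := by
      rw [norm_mul]
      exact mul_le_mul_of_nonneg_right (hbd' z y) (norm_nonneg _)
    have hp : ‖T u z‖ ≤ I := by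
      rw [hz1.2]
      exact norm_integral_le_of_norm_le hIint (Filter.Eventually.of_forall hku)
    have hq : ‖c * T v z + s * T w z‖ ≤ I := by
      rw [hc']
      refine norm_integral_le_of_norm_le hIint (Filter.Eventually.of_forall fun y => ?_)
      rw [norm_mul, Complex.norm_real, Real.norm_eq_abs]
      exact (mul_le_of_le_one_left (norm_nonneg _) (Real.abs_cos_le_one _)).trans (hku y)
    have hd : ‖T u z - (c * T v z + s * T w z)‖ ≤ L ^ 2 / (2 * b) * I := by
      rw [hc', hz1.2, ← integral_sub hz1.1 hci, hI, ← integral_const_mul]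
      refine norm_integral_le_of_norm_le (hIint.const_mul _) (Filter.Eventually.of_forall fun y => ?_)
      have h1 : k z y * u y - (Real.cos (θ y - θ z) : ℂ) * (k z y * u y) =
          ((1 - Real.cos (θ y - θ z) : ℝ) : ℂ) * (k z y * u y) := by push_cast; ring
      -- The deviation of the cosine from one is quadratic, so the error is of order $L^2$ rather
      -- than $L$; the factor $(z-y)^2$ is absorbed into half of the Gaussian exponent.
      have h2 : 1 - Real.cos (θ y - θ z) ≤ L ^ 2 / 2 * (z - y) ^ 2 := by
        have h3 := Real.one_sub_sq_div_two_le_cos (x := θ y - θ z)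
        have h4 : (θ y - θ z) ^ 2 ≤ L ^ 2 * (z - y) ^ 2 := by
          have h5 : |θ y - θ z| ^ 2 ≤ (L * |y - z|) ^ 2 :=
            pow_le_pow_left₀ (abs_nonneg _) (hθ y z) 2
          rw [sq_abs, mul_pow, sq_abs] at h5
          have h6 : (y - z) ^ 2 = (z - y) ^ 2 := by ring
          rwa [h6] at h5
        linarith
      rw [h1, norm_mul, Complex.norm_real, Real.norm_of_nonneg
        (by linarith [Real.cos_le_one (θ y - θ z)]), norm_mul]
      calc (1 - Real.cos (θ y - θ z)) * (‖k z y‖ * ‖u y‖)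
          ≤ (L ^ 2 / 2 * (z - y) ^ 2) * (Real.exp (-(2 * b) * (z - y) ^ 2) * ‖u y‖) := by
            gcongr
            exact hbd z y
        _ = L ^ 2 / 2 * ((z - y) ^ 2 * Real.exp (-(2 * b) * (z - y) ^ 2)) * ‖u y‖ := by ring
        _ ≤ L ^ 2 / 2 * (1 / b * Real.exp (-b * (z - y) ^ 2)) * ‖u y‖ := by
            exact mul_le_mul_of_nonneg_right
              (mul_le_mul_of_nonneg_left (sq_mul_exp_le hb _) (by positivity)) (norm_nonneg _)
        _ = _ := by field_simp
    rw [hrot, hz4, Complex.norm_real, Real.norm_of_nonneg hI0]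
    set P := T u z
    set Q := c * T v z + s * T w z
    have h1 : ‖P‖ - ‖Q‖ ≤ L ^ 2 / (2 * b) * I := (norm_sub_norm_le _ _).trans hd
    have h2 : ‖P‖ ^ 2 - ‖Q‖ ^ 2 ≤ L ^ 2 / b * I ^ 2 := by
      have h3 : ‖P‖ ^ 2 - ‖Q‖ ^ 2 = (‖P‖ - ‖Q‖) * (‖P‖ + ‖Q‖) := by ring
      rw [h3]
      calc (‖P‖ - ‖Q‖) * (‖P‖ + ‖Q‖) ≤ (L ^ 2 / (2 * b) * I) * (‖P‖ + ‖Q‖) := by gcongr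
        _ ≤ (L ^ 2 / (2 * b) * I) * (I + I) := by gcongr
        _ = _ := by field_simp; ring
    have h4 : 0 ≤ ‖c * T w z - s * T v z‖ ^ 2 := sq_nonneg _
    linarith
  have hi1 := integrable_norm_sq (T v)
  have hi2 := integrable_norm_sq (T w)
  have hi3 := (integrable_norm_sq (N u')).const_mul (L ^ 2 / b)
  have hi12 : Integrable fun z => ‖T v z‖ ^ 2 + ‖T w z‖ ^ 2 := hi1.add hi2
  have hint := integral_mono_ae (integrable_norm_sq (T u)) (hi12.add hi3) hpt
  have hsplit : ∫ z, ((fun z => ‖T v z‖ ^ 2 + ‖T w z‖ ^ 2) + fun z => L ^ 2 / b * ‖N u' z‖ ^ 2) z =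
      ‖T v‖ ^ 2 + ‖T w‖ ^ 2 + L ^ 2 / b * ‖N u'‖ ^ 2 := by
    rw [integral_add' hi12 hi3, integral_add hi1 hi2, integral_const_mul, ← norm_sq_eq_integral,
      ← norm_sq_eq_integral, ← norm_sq_eq_integral]
  rw [hsplit, ← norm_sq_eq_integral] at hint
  have h5 : L ^ 2 / b * ‖N u'‖ ^ 2 ≤ L ^ 2 / b * (Real.pi / b * ‖u‖ ^ 2) := by gcongr
  linarith

/-! ### Moments of the Gaussian, the Mehler parameter, and square roots. -/

theorem pow_mul_exp_le {α : ℝ} (hα : 0 < α) (k : ℕ) (x : ℝ) :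
    (x ^ 2) ^ k * Real.exp (-(2 * α) * x ^ 2) ≤
      k.factorial / α ^ k * Real.exp (-α * x ^ 2) := by
  have h1 := Real.pow_div_factorial_le_exp (α * x ^ 2) (by positivity) k
  have h2 : Real.exp (-α * x ^ 2) = Real.exp (α * x ^ 2) * Real.exp (-(2 * α) * x ^ 2) := by
    rw [← Real.exp_add]; congr 1; ring
  rw [h2, ← mul_assoc]
  refine mul_le_mul_of_nonneg_right ?_ (Real.exp_pos _).le
  rw [div_mul_eq_mul_div, le_div_iff₀ (by positivity)]
  rw [div_le_iff₀ (by positivity), mul_pow] at h1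
  linarith

theorem gaussFun_nonneg {α : ℝ} (hα : 0 < α) (x : ℝ) : 0 ≤ gaussFun α x := by
  unfold gaussFun
  positivity

theorem pow_mul_gaussFun_sq_le {α : ℝ} (hα : 0 < α) (k : ℕ) (x : ℝ) :
    (|x| ^ k * gaussFun α x) ^ 2 ≤
      Real.sqrt (2 * α / Real.pi) * (k.factorial / α ^ k) * Real.exp (-α * x ^ 2) := by
  have h1 : ((2 * α / Real.pi) ^ (1 / 4 : ℝ)) ^ 2 = Real.sqrt (2 * α / Real.pi) := by
    rw [Real.sqrt_eq_rpow, ← Real.rpow_natCast, ← Real.rpow_mul (by positivity)]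
    norm_num
  have h2 : Real.exp (-α * x ^ 2) ^ 2 = Real.exp (-(2 * α) * x ^ 2) := by
    rw [← Real.exp_nat_mul]; congr 1; push_cast; ring
  have h3 : (|x| ^ k) ^ 2 = (x ^ 2) ^ k := by
    rw [← pow_mul, mul_comm k 2, pow_mul, sq_abs]
  rw [gaussFun, mul_pow, mul_pow, h1, h2, h3]
  calc _ = Real.sqrt (2 * α / Real.pi) * ((x ^ 2) ^ k * Real.exp (-(2 * α) * x ^ 2)) := by ring
    _ ≤ Real.sqrt (2 * α / Real.pi) * (k.factorial / α ^ k * Real.exp (-α * x ^ 2)) := by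
        exact mul_le_mul_of_nonneg_left (pow_mul_exp_le hα k x) (Real.sqrt_nonneg _)
    _ = _ := by ring

/-- Moments of the Gaussian in `L₂`. -/
theorem norm_sq_le_of_le_pow_mul_gaussFun {α : ℝ} (hα : 0 < α) (k : ℕ) {w : L2R}
    (hw : ∀ᵐ x : ℝ, ‖w x‖ ≤ |x| ^ k * gaussFun α x) :
    ‖w‖ ^ 2 ≤ 2 * (k.factorial / α ^ k) := by
  rw [norm_sq_eq_integral]
  have h1 : ∫ x, ‖w x‖ ^ 2 ≤ ∫ x, Real.sqrt (2 * α / Real.pi) * (k.factorial / α ^ k) *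
      Real.exp (-α * x ^ 2) := by
    refine integral_mono_ae (integrable_norm_sq w)
      ((integrable_exp_neg_mul_sq hα).const_mul _) ?_
    filter_upwards [hw] with x hx
    refine le_trans ?_ (pow_mul_gaussFun_sq_le hα k x)
    exact pow_le_pow_left₀ (norm_nonneg _) hx 2
  refine h1.trans ?_
  rw [integral_const_mul, integral_gaussian]
  have h2 : Real.sqrt (2 * α / Real.pi) * Real.sqrt (Real.pi / α) = Real.sqrt 2 := by
    rw [← Real.sqrt_mul (by positivity)]
    congr 1
    field_simp
  have h3 : Real.sqrt 2 ≤ 2 := by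
    rw [Real.sqrt_le_left (by norm_num)]; norm_num
  calc _ = (Real.sqrt (2 * α / Real.pi) * Real.sqrt (Real.pi / α)) * (k.factorial / α ^ k) := by ring
    _ ≤ _ := by rw [h2]; gcongr

theorem exists_pow_mul_gaussFun {α : ℝ} (hα : 0 < α) (k : ℕ) :
    ∃ w : L2R, ∀ᵐ x : ℝ, w x = ((|x| ^ k * gaussFun α x : ℝ) : ℂ) := by
  have hc : Continuous fun x : ℝ => |x| ^ k * gaussFun α x := by
    unfold gaussFun
    fun_prop
  have h : MemLp (fun x : ℝ => |x| ^ k * gaussFun α x) 2 volume := by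
    rw [memLp_two_iff_integrable_sq hc.aestronglyMeasurable]
    refine ((integrable_exp_neg_mul_sq hα).const_mul
      (Real.sqrt (2 * α / Real.pi) * (k.factorial / α ^ k))).mono'
      (hc.pow 2).aestronglyMeasurable (Filter.Eventually.of_forall fun x => ?_)
    rw [Real.norm_of_nonneg (sq_nonneg _)]
    exact pow_mul_gaussFun_sq_le hα k x
  exact ⟨h.ofReal.toLp _, h.ofReal.coeFn_toLp⟩

/-- Of the two roots, take the one in the right half plane. A purely imaginary root would force $A$
real, and then a nonpositive square would equal $A^2+\alpha^2>0$. -/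
theorem exists_mehler_param {A : ℂ} {α : ℝ} (hA : 0 < A.re) :
    ∃ D : ℂ, 0 < D.re ∧ D ^ 2 = A ^ 2 + (α : ℂ) ^ 2 := by
  obtain ⟨E, hE⟩ : ∃ E : ℂ, E ^ 2 = A ^ 2 + (α : ℂ) ^ 2 := ⟨_, cpow_half_sq _⟩
  rcases lt_trichotomy E.re 0 with h | h | h
  · exact ⟨-E, by simpa using h, by rw [neg_sq, hE]⟩
  · exfalso
    have hre := congrArg Complex.re hE
    have him := congrArg Complex.im hE
    simp only [sq, Complex.add_re, Complex.add_im, Complex.mul_re, Complex.mul_im,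
      Complex.ofReal_re, Complex.ofReal_im, h] at hre him
    have h1 : A.re * A.im = 0 := by linarith
    have h2 : A.im = 0 := (mul_eq_zero.1 h1).resolve_left hA.ne'
    rw [h2] at hre
    nlinarith [sq_nonneg E.im, sq_nonneg α]
  · exact ⟨E, h, hE⟩

/-- Factor $z-w=(s-t)(s+t)$. Principal roots have nonnegative real part, and $\operatorname{Re}w>0$
puts $t$ in a sector where $|t|\le2\operatorname{Re}t\le2|s+t|$. -/
theorem norm_cpow_half_sub_le {z w : ℂ} (hw : 0 < w.re) :
    ‖z ^ (1 / 2 : ℂ) - w ^ (1 / 2 : ℂ)‖ * ‖w ^ (1 / 2 : ℂ)‖ ≤ 2 * ‖z - w‖ := by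
  set s := z ^ (1 / 2 : ℂ) with hs
  set t := w ^ (1 / 2 : ℂ) with ht
  have hs2 : s ^ 2 = z := cpow_half_sq z
  have ht2 : t ^ 2 = w := cpow_half_sq w
  have hsre : 0 ≤ s.re := by
    rw [hs, one_div, Complex.cpow_inv_two_re]
    exact Real.sqrt_nonneg _
  have htre : 0 ≤ t.re := by
    rw [ht, one_div, Complex.cpow_inv_two_re]
    exact Real.sqrt_nonneg _
  have ht3 : ‖t‖ ≤ 2 * t.re := by
    refine le_of_sq_le_sq ?_ (by linarith)
    rw [← Complex.normSq_eq_norm_sq, Complex.normSq_apply]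
    have := congrArg Complex.re ht2
    rw [sq, Complex.mul_re] at this
    nlinarith
  have h1 : t.re ≤ ‖s + t‖ := by
    refine le_trans ?_ (Complex.re_le_norm _)
    rw [Complex.add_re]
    linarith
  calc ‖s - t‖ * ‖t‖ ≤ ‖s - t‖ * (2 * ‖s + t‖) := by gcongr; linarith
    _ = 2 * ‖(s - t) * (s + t)‖ := by rw [norm_mul]; ring
    _ = 2 * ‖z - w‖ := by rw [← hs2, ← ht2]; ring_nf

/-! ### Comparison of the transfer kernel with the Mehler kernel. -/

/-- Quantitative description of a potential near its saddle, with all constants controlled by `Λ`. -/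
structure SaddleData (Λ a : ℝ) (ζ : ℂ) (U : ℝ → ℂ) : Prop where
  one_le : 1 ≤ Λ
  norm_eq : ‖ζ‖ = 1
  inv_le_re : Λ⁻¹ ≤ (ζ ^ 2).re
  inv_le : Λ⁻¹ ≤ a
  le : a ≤ Λ
  cont : Continuous U
  lower : ∀ x : ℝ, Λ⁻¹ * min 1 (x ^ 2) ≤ (U x).re
  -- In the application $a=\sqrt{\zeta^2U''(0)/2}$, so $a^2\overline{\zeta^2}=U''(0)/2$ since
  -- $|\zeta|=1$.
  cubic : ∀ x : ℝ, |x| < Λ⁻¹ →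
    ‖U x - (a : ℂ) ^ 2 * (starRingEnd ℂ) (ζ ^ 2) * (x : ℂ) ^ 2‖ ≤ Λ * |x| ^ 3

namespace SaddleData

variable {Λ a : ℝ} {ζ : ℂ} {U : ℝ → ℂ}

theorem pos (h : SaddleData Λ a ζ U) : 0 < Λ := lt_of_lt_of_le one_pos h.one_le

theorem a_pos (h : SaddleData Λ a ζ U) : 0 < a := (inv_pos.2 h.pos).trans_le h.inv_le

theorem re_pos (h : SaddleData Λ a ζ U) : 0 < (ζ ^ 2).re := (inv_pos.2 h.pos).trans_le h.inv_le_re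

theorem re_le_one (h : SaddleData Λ a ζ U) : (ζ ^ 2).re ≤ 1 := by
  refine (Complex.re_le_norm _).trans ?_
  rw [norm_pow, h.norm_eq, one_pow]

theorem mul_conj (h : SaddleData Λ a ζ U) : ζ ^ 2 * (starRingEnd ℂ) (ζ ^ 2) = 1 := by
  rw [Complex.mul_conj, Complex.normSq_eq_norm_sq, norm_pow, h.norm_eq]
  simp

theorem U_re_nonneg (h : SaddleData Λ a ζ U) (x : ℝ) : 0 ≤ (U x).re := by
  refine le_trans ?_ (h.lower x)
  have := h.pos
  positivity

theorem coeff_re (W : ℝ) (ζ : ℂ) : ((W : ℂ) ^ 2 * ζ ^ 2).re = W ^ 2 * (ζ ^ 2).re := by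
  rw [← Complex.ofReal_pow, Complex.re_ofReal_mul]

theorem coeff_re_pos (h : SaddleData Λ a ζ U) {W : ℝ} (hW : 0 < W) :
    0 < ((W : ℂ) ^ 2 * ζ ^ 2).re := by
  rw [coeff_re]
  have := h.re_pos
  positivity

theorem norm_coeff (h : SaddleData Λ a ζ U) (W : ℝ) : ‖(W : ℂ) ^ 2 * ζ ^ 2‖ = W ^ 2 := by
  rw [norm_mul, norm_pow, norm_pow, h.norm_eq, Complex.norm_real, Real.norm_eq_abs, sq_abs]
  ring

/-- $(D-A)(D+A)=\alpha^2$ is of order $W^2$, and so is $|D+A|\ge2\operatorname{Re}A$; hence $D-A$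
stays bounded. -/
theorem norm_D_sub_le (h : SaddleData Λ a ζ U) {W : ℝ} (hW : 0 < W) {D : ℂ} (hD : 0 < D.re)
    (hsq : D ^ 2 = ((W : ℂ) ^ 2 * ζ ^ 2) ^ 2 + ((W * a : ℝ) : ℂ) ^ 2) :
    ‖D - (W : ℂ) ^ 2 * ζ ^ 2‖ ≤ Λ ^ 3 / 2 := by
  set A := (W : ℂ) ^ 2 * ζ ^ 2 with hA
  have hΛ := h.pos
  have ha := h.a_pos
  have h1 : ‖D - A‖ * ‖D + A‖ = (W * a) ^ 2 := by
    rw [← norm_mul]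
    have : (D - A) * (D + A) = ((W * a : ℝ) : ℂ) ^ 2 := by linear_combination hsq
    rw [this, norm_pow, Complex.norm_real, Real.norm_eq_abs, sq_abs]
  have h2 : 2 * (W ^ 2 * Λ⁻¹) ≤ ‖D + A‖ := by
    refine le_trans ?_ (Complex.re_le_norm _)
    rw [Complex.add_re]
    have h3 := re_le_of_sq_eq hD hsq
    have h4 : A.re = W ^ 2 * (ζ ^ 2).re := coeff_re W ζ
    have h5 : W ^ 2 * Λ⁻¹ ≤ W ^ 2 * (ζ ^ 2).re := by
      have := h.inv_le_re
      gcongr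
    linarith
  have h6 : ‖D - A‖ * (2 * (W ^ 2 * Λ⁻¹)) ≤ Λ ^ 3 / 2 * (2 * (W ^ 2 * Λ⁻¹)) := by
    calc ‖D - A‖ * (2 * (W ^ 2 * Λ⁻¹)) ≤ ‖D - A‖ * ‖D + A‖ := by gcongr
      _ = W ^ 2 * a ^ 2 := by rw [h1]; ring
      _ ≤ W ^ 2 * Λ ^ 2 := by have := h.le; gcongr
      _ = Λ ^ 3 / 2 * (2 * (W ^ 2 * Λ⁻¹)) := by field_simp
  exact le_of_mul_le_mul_right h6 (by positivity)

/-- With $B=D-A$ and $A\overline{\zeta^2}=W^2$, the equation for $D$ reads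
$2A(B-a^2\overline{\zeta^2}/2)=-B^2$; the right side is bounded and $|A|=W^2$. So $B$ agrees with
the Taylor coefficient of $U/2$. -/
theorem norm_B_sub_le (h : SaddleData Λ a ζ U) {W : ℝ} (hW : 0 < W) {D : ℂ} (hD : 0 < D.re)
    (hsq : D ^ 2 = ((W : ℂ) ^ 2 * ζ ^ 2) ^ 2 + ((W * a : ℝ) : ℂ) ^ 2) :
    ‖D - (W : ℂ) ^ 2 * ζ ^ 2 - (a : ℂ) ^ 2 * (starRingEnd ℂ) (ζ ^ 2) / 2‖ ≤ Λ ^ 6 / W ^ 2 := by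
  have h1 := h.norm_D_sub_le hW hD hsq
  have hA := h.norm_coeff W
  have hconj := h.mul_conj
  set A := (W : ℂ) ^ 2 * ζ ^ 2 with hAdef
  have hΛ := h.pos
  have h2 : 2 * A * (D - A - (a : ℂ) ^ 2 * (starRingEnd ℂ) (ζ ^ 2) / 2) = -(D - A) ^ 2 := by
    have : A * (starRingEnd ℂ) (ζ ^ 2) = (W : ℂ) ^ 2 := by
      rw [hAdef, mul_assoc, hconj, mul_one]
    push_cast at hsq
    linear_combination hsq - (a : ℂ) ^ 2 * this
  have h3 : 2 * W ^ 2 * ‖D - A - (a : ℂ) ^ 2 * (starRingEnd ℂ) (ζ ^ 2) / 2‖ = ‖D - A‖ ^ 2 := by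
    have := congrArg norm h2
    rwa [norm_mul, norm_mul, hA, norm_neg, norm_pow, Complex.norm_ofNat] at this
  rw [le_div_iff₀ (by positivity)]
  have h4 : ‖D - A‖ ^ 2 ≤ (Λ ^ 3 / 2) ^ 2 := by gcongr
  have h5 : (Λ ^ 3 / 2) ^ 2 = Λ ^ 6 / 4 := by ring
  have h6 : 0 < Λ ^ 6 := by positivity
  nlinarith

/-- Comparison of the potential with its quadratic approximation. -/
theorem norm_exp_sub_le (h : SaddleData Λ a ζ U) {W : ℝ} (hW : 0 < W) {D : ℂ} (hD : 0 < D.re)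
    (hsq : D ^ 2 = ((W : ℂ) ^ 2 * ζ ^ 2) ^ 2 + ((W * a : ℝ) : ℂ) ^ 2) (x : ℝ) :
    ‖Complex.exp (-(U x / 2)) - Complex.exp (-((D - (W : ℂ) ^ 2 * ζ ^ 2) * (x : ℂ) ^ 2))‖ ≤
      2 * Λ ^ 6 * (|x| ^ 3 + (W ^ 2)⁻¹) := by
  have hB := h.norm_B_sub_le hW hD hsq
  have hBre := re_le_of_sq_eq hD hsq
  set A := (W : ℂ) ^ 2 * ζ ^ 2 with hAdef
  have hΛ := h.pos
  have hΛ1 := h.one_le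
  have hre1 : (-(U x / 2)).re ≤ 0 := by
    have := h.U_re_nonneg x
    simp
    linarith
  have hre2 : (-((D - A) * (x : ℂ) ^ 2)).re ≤ 0 := by
    rw [← Complex.ofReal_pow, Complex.neg_re, Complex.re_mul_ofReal, Complex.sub_re]
    have := mul_nonneg (sub_nonneg.2 hBre) (sq_nonneg x)
    linarith
  have hΛ6 : Λ ^ 3 ≤ Λ ^ 6 := pow_le_pow_right₀ hΛ1 (by norm_num)
  have hΛ61 : Λ ≤ Λ ^ 6 := le_self_pow₀ hΛ1 (by norm_num)
  have hx3 : 0 ≤ |x| ^ 3 := by positivity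
  have hWi : 0 < (W ^ 2)⁻¹ := by positivity
  -- Inside the Taylor radius compare exponents, both in the left half plane. Outside, both
  -- exponentials are at most one and $\Lambda^3|x|^3\ge1$ pays for them.
  rcases lt_or_ge |x| Λ⁻¹ with hx | hx
  · refine (norm_cexp_sub_cexp_le hre1 hre2).trans ?_
    have h1 : -(U x / 2) - -((D - A) * (x : ℂ) ^ 2) =
        (D - A - (a : ℂ) ^ 2 * (starRingEnd ℂ) (ζ ^ 2) / 2) * (x : ℂ) ^ 2 -
        (U x - (a : ℂ) ^ 2 * (starRingEnd ℂ) (ζ ^ 2) * (x : ℂ) ^ 2) / 2 := by ring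
    rw [h1]
    refine (norm_sub_le _ _).trans ?_
    rw [norm_mul, norm_div, norm_pow, Complex.norm_real, Real.norm_eq_abs, Complex.norm_ofNat]
    have h2 := h.cubic x hx
    have h3 : |x| ^ 2 ≤ 1 := by
      refine pow_le_one₀ (abs_nonneg _) (hx.le.trans ?_)
      exact inv_le_one_of_one_le₀ hΛ1
    have h4 : ‖D - A - (a : ℂ) ^ 2 * (starRingEnd ℂ) (ζ ^ 2) / 2‖ * |x| ^ 2 ≤
        Λ ^ 6 / W ^ 2 * 1 := by gcongr
    rw [mul_one, div_eq_mul_inv (Λ ^ 6)] at h4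
    have h5 : Λ * |x| ^ 3 ≤ Λ ^ 6 * |x| ^ 3 := by gcongr
    have h6 : 0 ≤ Λ ^ 6 * (W ^ 2)⁻¹ := by positivity
    have h7 : 0 ≤ Λ ^ 6 * |x| ^ 3 := by positivity
    linarith
  · refine (norm_sub_le _ _).trans ?_
    have h1 := norm_cexp_le_one hre1
    have h2 := norm_cexp_le_one hre2
    have h3 : 1 ≤ Λ ^ 3 * |x| ^ 3 := by
      rw [← mul_pow]
      refine one_le_pow₀ ?_
      calc (1 : ℝ) = Λ * Λ⁻¹ := by field_simp
        _ ≤ Λ * |x| := by gcongr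
    have h5 : Λ ^ 3 * |x| ^ 3 ≤ Λ ^ 6 * |x| ^ 3 := by gcongr
    have h6 : 0 ≤ Λ ^ 6 * (W ^ 2)⁻¹ := by positivity
    linarith

theorem transferKernel_eq (W : ℝ) (ζ : ℂ) (U : ℝ → ℂ) (x y : ℝ) :
    transferKernel W ζ U x y = Complex.exp (-(U x / 2)) *
      (mehlerKernel ((W : ℂ) ^ 2 * ζ ^ 2) 0 x y * Complex.exp (-(U y / 2))) := by
  rw [transferKernel, mehlerKernel, ← Complex.exp_add, ← Complex.exp_add]
  congr 1
  ring

theorem mehlerKernel_eq (A B : ℂ) (x y : ℝ) :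
    mehlerKernel A B x y = Complex.exp (-(B * (x : ℂ) ^ 2)) *
      (mehlerKernel A 0 x y * Complex.exp (-(B * (y : ℂ) ^ 2))) := by
  rw [mehlerKernel, mehlerKernel, ← Complex.exp_add, ← Complex.exp_add]
  congr 1
  ring

theorem continuous_transferKernel (h : SaddleData Λ a ζ U) (W : ℝ) :
    Continuous (Function.uncurry (transferKernel W ζ U)) := by
  have := h.cont
  unfold transferKernel Function.uncurry
  fun_prop

theorem norm_exp_neg_half_le_one (h : SaddleData Λ a ζ U) (x : ℝ) :
    ‖Complex.exp (-(U x / 2))‖ ≤ 1 := by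
  refine norm_cexp_le_one ?_
  have := h.U_re_nonneg x
  simp
  linarith

theorem norm_transferKernel_le (h : SaddleData Λ a ζ U) (W x y : ℝ) :
    ‖transferKernel W ζ U x y‖ ≤
      Real.exp (-(2 * (W ^ 2 * (ζ ^ 2).re / 2)) * (x - y) ^ 2) := by
  rw [transferKernel_eq, norm_mul, norm_mul]
  have h1 := h.norm_exp_neg_half_le_one x
  have h2 := h.norm_exp_neg_half_le_one y
  have h3 := norm_mehlerKernel_le (A := (W : ℂ) ^ 2 * ζ ^ 2) (B := 0) (by simp) x y
  rw [coeff_re] at h3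
  have h4 : -(2 * (W ^ 2 * (ζ ^ 2).re / 2)) = -(W ^ 2 * (ζ ^ 2).re) := by ring
  rw [h4]
  calc _ ≤ 1 * (Real.exp (-(W ^ 2 * (ζ ^ 2).re) * (x - y) ^ 2) * 1) := by gcongr
    _ = _ := by ring

theorem norm_transferKernel_le' (h : SaddleData Λ a ζ U) (W x y : ℝ) :
    ‖transferKernel W ζ U x y‖ ≤ Real.exp (-(W ^ 2 * (ζ ^ 2).re / 2) * (x - y) ^ 2) := by
  refine (h.norm_transferKernel_le W x y).trans (Real.exp_le_exp.2 ?_)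
  have := h.re_pos
  have : 0 ≤ (W ^ 2 * (ζ ^ 2).re / 2) * (x - y) ^ 2 := by positivity
  linarith

/-- Cubic and zeroth moments of the Gaussian kernel against half of its exponent. -/
theorem moment_exp_le (h : SaddleData Λ a ζ U) {W : ℝ} (hW : 1 ≤ W) (t : ℝ) :
    |t| ^ 3 * Real.exp (-(W ^ 2 * (ζ ^ 2).re) * t ^ 2) ≤
      8 * Λ ^ 2 * (W ^ 2)⁻¹ * Real.exp (-(W ^ 2 * (ζ ^ 2).re / 2) * t ^ 2) := by
  have hΛ := h.pos
  have hΛ1 := h.one_le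
  have hκ := h.re_pos
  set κ := (ζ ^ 2).re with hκdef
  -- In the scaled variable, $w^3\le1+w^4$ is controlled by the second-order expansion of half the
  -- exponential. The exact factor $W^{-3}$ is relaxed to $W^{-2}$, the order of the other error
  -- term.
  set w := W * |t| with hw
  have hw0 : 0 ≤ w := by positivity
  have hwt : w ^ 2 = W ^ 2 * t ^ 2 := by rw [hw, mul_pow, sq_abs]
  have h1 : Real.exp (-(W ^ 2 * κ / 2) * t ^ 2) =
      Real.exp (κ * w ^ 2 / 2) * Real.exp (-(W ^ 2 * κ) * t ^ 2) := by
    rw [← Real.exp_add, hwt]; congr 1; ring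
  rw [h1, ← mul_assoc]
  refine mul_le_mul_of_nonneg_right ?_ (Real.exp_pos _).le
  have h2 : 1 + (κ * w ^ 2 / 2) + (κ * w ^ 2 / 2) ^ 2 / 2 ≤ Real.exp (κ * w ^ 2 / 2) :=
    Real.quadratic_le_exp_of_nonneg (by positivity)
  have h3 : 1 ≤ Λ * κ := by
    have := mul_le_mul_of_nonneg_left h.inv_le_re hΛ.le
    rwa [mul_inv_cancel₀ hΛ.ne'] at this
  have h4 : w ^ 3 ≤ 8 * Λ ^ 2 * Real.exp (κ * w ^ 2 / 2) := by
    have h5 : w ^ 3 ≤ 1 + w ^ 4 := by nlinarith [sq_nonneg (w ^ 2 - w), sq_nonneg (w - 1), sq_nonneg (w^2 - 1), sq_nonneg w]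
    have h6 : 1 ≤ (Λ * κ) ^ 2 := one_le_pow₀ h3
    have h7 : w ^ 4 ≤ (Λ * κ) ^ 2 * w ^ 4 := le_mul_of_one_le_left (by positivity) h6
    have h8 : 1 ≤ Λ ^ 2 := one_le_pow₀ hΛ1
    have h9 : 8 * Λ ^ 2 * (1 + (κ * w ^ 2 / 2) ^ 2 / 2) ≤ 8 * Λ ^ 2 * Real.exp (κ * w ^ 2 / 2) := by
      have : 0 ≤ κ * w ^ 2 / 2 := by positivity
      gcongr
      linarith
    nlinarith
  have h10 : |t| ^ 3 = w ^ 3 * (W ^ 3)⁻¹ := by rw [hw]; field_simp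
  have h11 : (W ^ 3)⁻¹ ≤ (W ^ 2)⁻¹ := by
    have : 0 < W := by linarith
    gcongr
    norm_num
  rw [h10]
  calc w ^ 3 * (W ^ 3)⁻¹ ≤ (8 * Λ ^ 2 * Real.exp (κ * w ^ 2 / 2)) * (W ^ 2)⁻¹ := by gcongr
    _ = _ := by ring

/-- Telescope the two multipliers around the common convolution factor. The cubic error at $x$ is
moved to $y$ through $|x|^3\le4|x-y|^3+4|y|^3$, with $|x-y|^3$ absorbed by half the Gaussian; the
remaining weight acts only on the input function. -/
theorem norm_kernel_sub_le (h : SaddleData Λ a ζ U) {W : ℝ} (hW : 1 ≤ W) {D : ℂ} (hD : 0 < D.re)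
    (hsq : D ^ 2 = ((W : ℂ) ^ 2 * ζ ^ 2) ^ 2 + ((W * a : ℝ) : ℂ) ^ 2) (x y : ℝ) :
    ‖transferKernel W ζ U x y -
      mehlerKernel ((W : ℂ) ^ 2 * ζ ^ 2) (D - (W : ℂ) ^ 2 * ζ ^ 2) x y‖ ≤
      80 * Λ ^ 8 * (Real.exp (-(W ^ 2 * (ζ ^ 2).re / 2) * (x - y) ^ 2) *
        (|y| ^ 3 + (W ^ 2)⁻¹)) := by
  have hW0 : 0 < W := by linarith
  have hmx := h.norm_exp_neg_half_le_one x
  have hdx := h.norm_exp_sub_le hW0 hD hsq x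
  have hdy := h.norm_exp_sub_le hW0 hD hsq y
  have hBre := re_le_of_sq_eq hD hsq
  have hmom := h.moment_exp_le hW (x - y)
  have hcre := coeff_re W ζ
  have hΛ := h.pos
  have hΛ1 := h.one_le
  have hκ := h.re_pos
  rw [transferKernel_eq, mehlerKernel_eq _ (D - _)]
  set A := (W : ℂ) ^ 2 * ζ ^ 2 with hAdef
  have hny : ‖Complex.exp (-((D - A) * (y : ℂ) ^ 2))‖ ≤ 1 := by
    refine norm_cexp_le_one ?_
    rw [← Complex.ofReal_pow, Complex.neg_re, Complex.re_mul_ofReal, Complex.sub_re]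
    have := mul_nonneg (sub_nonneg.2 hBre) (sq_nonneg y)
    linarith
  set mx := Complex.exp (-(U x / 2))
  set my := Complex.exp (-(U y / 2))
  set nx := Complex.exp (-((D - A) * (x : ℂ) ^ 2))
  set ny := Complex.exp (-((D - A) * (y : ℂ) ^ 2))
  have hG := norm_mehlerKernel_le (A := A) (B := 0) (by simp) x y
  rw [hcre] at hG
  set G := mehlerKernel A 0 x y
  set κ := (ζ ^ 2).re
  set E := Real.exp (-(W ^ 2 * κ) * (x - y) ^ 2) with hE
  set F := Real.exp (-(W ^ 2 * κ / 2) * (x - y) ^ 2) with hF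
  have hE0 : 0 < E := Real.exp_pos _
  have hEF : E ≤ F := by
    refine Real.exp_le_exp.2 ?_
    have : 0 ≤ (W ^ 2 * κ / 2) * (x - y) ^ 2 := by positivity
    linarith
  have hWi : 0 < (W ^ 2)⁻¹ := by positivity
  have h1 : mx * (G * my) - nx * (G * ny) = G * (mx * (my - ny) + (mx - nx) * ny) := by ring
  rw [h1, norm_mul]
  have hcube : |x| ^ 3 ≤ 4 * |x - y| ^ 3 + 4 * |y| ^ 3 := by
    have h2 : |x| ≤ |x - y| + |y| := by
      calc |x| = |(x - y) + y| := by ring_nf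
        _ ≤ _ := abs_add_le _ _
    calc |x| ^ 3 ≤ (|x - y| + |y|) ^ 3 := by gcongr
      _ ≤ _ := by
        nlinarith [mul_nonneg (add_nonneg (abs_nonneg (x - y)) (abs_nonneg y))
          (sq_nonneg (|x - y| - |y|))]
  have h3 : ‖mx * (my - ny) + (mx - nx) * ny‖ ≤
      2 * Λ ^ 6 * (4 * |x - y| ^ 3 + 5 * |y| ^ 3 + 2 * (W ^ 2)⁻¹) := by
    refine (norm_add_le _ _).trans ?_
    rw [norm_mul, norm_mul]
    have h4 : ‖mx‖ * ‖my - ny‖ ≤ 1 * (2 * Λ ^ 6 * (|y| ^ 3 + (W ^ 2)⁻¹)) := by gcongr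
    have h5 : ‖mx - nx‖ * ‖ny‖ ≤ (2 * Λ ^ 6 * (|x| ^ 3 + (W ^ 2)⁻¹)) * 1 := by gcongr
    have h6 : 2 * Λ ^ 6 * |x| ^ 3 ≤ 2 * Λ ^ 6 * (4 * |x - y| ^ 3 + 4 * |y| ^ 3) := by gcongr
    linarith
  have hL2 : 1 ≤ Λ ^ 2 := one_le_pow₀ hΛ1
  have h7 : E * (4 * |x - y| ^ 3 + 5 * |y| ^ 3 + 2 * (W ^ 2)⁻¹) ≤
      40 * Λ ^ 2 * (F * (|y| ^ 3 + (W ^ 2)⁻¹)) := by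
    have h8 : E * (5 * |y| ^ 3 + 2 * (W ^ 2)⁻¹) ≤ F * (5 * |y| ^ 3 + 2 * (W ^ 2)⁻¹) := by gcongr
    have h9 : F * (5 * |y| ^ 3 + 2 * (W ^ 2)⁻¹) ≤ Λ ^ 2 * (F * (5 * |y| ^ 3 + 2 * (W ^ 2)⁻¹)) :=
      le_mul_of_one_le_left (by positivity) hL2
    have h10 : 0 ≤ Λ ^ 2 * F * |y| ^ 3 := by positivity
    have h11 : 0 ≤ Λ ^ 2 * F * (W ^ 2)⁻¹ := by positivity
    have h12 : |x - y| ^ 3 * E ≤ 8 * Λ ^ 2 * (W ^ 2)⁻¹ * F := hmom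
    nlinarith
  calc ‖G‖ * ‖mx * (my - ny) + (mx - nx) * ny‖
      ≤ E * (2 * Λ ^ 6 * (4 * |x - y| ^ 3 + 5 * |y| ^ 3 + 2 * (W ^ 2)⁻¹)) := by gcongr
    _ = 2 * Λ ^ 6 * (E * (4 * |x - y| ^ 3 + 5 * |y| ^ 3 + 2 * (W ^ 2)⁻¹)) := by ring
    _ ≤ 2 * Λ ^ 6 * (40 * Λ ^ 2 * (F * (|y| ^ 3 + (W ^ 2)⁻¹))) := by gcongr
    _ = _ := by ring

theorem sqrt_schur_le (h : SaddleData Λ a ζ U) {W : ℝ} (hW : 0 < W) :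
    Real.sqrt (Real.pi / (W ^ 2 * (ζ ^ 2).re / 2)) ≤ 3 * Λ * W⁻¹ := by
  have hΛ := h.pos
  have hκ := h.re_pos
  rw [Real.sqrt_le_left (by positivity), div_le_iff₀ (by positivity)]
  have h3 : 1 ≤ Λ * (ζ ^ 2).re := by
    have := mul_le_mul_of_nonneg_left h.inv_le_re hΛ.le
    rwa [mul_inv_cancel₀ hΛ.ne'] at this
  have h4 : (3 * Λ * W⁻¹) ^ 2 * (W ^ 2 * (ζ ^ 2).re / 2) = 9 / 2 * Λ * (Λ * (ζ ^ 2).re) := by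
    field_simp
    norm_num
  rw [h4]
  have h5 : 9 / 2 * Λ * 1 ≤ 9 / 2 * Λ * (Λ * (ζ ^ 2).re) := by gcongr
  have := h.one_le
  linarith [Real.pi_lt_four]

/-- The transfer operator is close to the Mehler operator on localized functions. -/
theorem norm_sub_le (h : SaddleData Λ a ζ U) {W : ℝ} (hW : 1 ≤ W) {D : ℂ} (hD : 0 < D.re)
    (hsq : D ^ 2 = ((W : ℂ) ^ 2 * ζ ^ 2) ^ 2 + ((W * a : ℝ) : ℂ) ^ 2) {K T : L2R →L[ℂ] L2R}
    (hK : HasKernel K (transferKernel W ζ U))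
    (hT : HasKernel T (mehlerKernel ((W : ℂ) ^ 2 * ζ ^ 2) (D - (W : ℂ) ^ 2 * ζ ^ 2)))
    {u w : L2R} (huw : ∀ᵐ y : ℝ, (|y| ^ 3 + (W ^ 2)⁻¹) * ‖u y‖ ≤ ‖w y‖) :
    ‖K u - T u‖ ≤ 240 * Λ ^ 9 * W⁻¹ * ‖w‖ := by
  have hW0 : 0 < W := by linarith
  have hΛ := h.pos
  have hκ := h.re_pos
  have hb : 0 < W ^ 2 * (ζ ^ 2).re / 2 := by positivity
  have h1 : ‖K u - T u‖ ≤ 80 * Λ ^ 8 * Real.sqrt (Real.pi / (W ^ 2 * (ζ ^ 2).re / 2)) * ‖w‖ := by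
    refine norm_le_of_gauss_dominated hb (by positivity) _ _ ?_
    filter_upwards [hK u, hT u, Lp.coeFn_sub (K u) (T u)] with x h1 h2 h3
    rw [h3, Pi.sub_apply, h1.2, h2.2, ← integral_sub h1.1 h2.1, ← integral_const_mul]
    refine norm_integral_le_of_norm_le ((integrable_gauss_mul hb w x).const_mul _) ?_
    filter_upwards [huw] with y hy
    rw [← sub_mul, norm_mul]
    calc _ ≤ 80 * Λ ^ 8 * (Real.exp (-(W ^ 2 * (ζ ^ 2).re / 2) * (x - y) ^ 2) *
        (|y| ^ 3 + (W ^ 2)⁻¹)) * ‖u y‖ := by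
          gcongr
          exact h.norm_kernel_sub_le hW hD hsq x y
      _ = 80 * Λ ^ 8 * (Real.exp (-(W ^ 2 * (ζ ^ 2).re / 2) * (x - y) ^ 2) *
        ((|y| ^ 3 + (W ^ 2)⁻¹) * ‖u y‖)) := by ring
      _ ≤ _ := by gcongr
  refine h1.trans ?_
  calc _ ≤ 80 * Λ ^ 8 * (3 * Λ * W⁻¹) * ‖w‖ := by
        gcongr
        exact h.sqrt_schur_le hW0
    _ = _ := by ring

end SaddleData

/-! ### The cutoff at scale $R$. -/

/-- The angle of the quadratic partition of unity at scale `R`. -/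
noncomputable def cutoffAngle (R x : ℝ) : ℝ := Real.pi / 2 * min 1 (max 0 (|x| / R - 1))

theorem continuous_cutoffAngle (R : ℝ) : Continuous (cutoffAngle R) := by
  unfold cutoffAngle
  fun_prop

theorem cutoffAngle_lipschitz {R : ℝ} (hR : 0 < R) (x y : ℝ) :
    |cutoffAngle R x - cutoffAngle R y| ≤ Real.pi / (2 * R) * |x - y| := by
  rw [cutoffAngle, cutoffAngle, ← mul_sub, abs_mul, abs_of_pos (by positivity)]
  have h1 : |min 1 (max 0 (|x| / R - 1)) - min 1 (max 0 (|y| / R - 1))| ≤ |x - y| / R := by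
    have h2 := abs_min_sub_min_le_max 1 (max 0 (|x| / R - 1)) 1 (max 0 (|y| / R - 1))
    have h3 := abs_max_sub_max_le_max 0 (|x| / R - 1) 0 (|y| / R - 1)
    have h4 : |(|x| / R - 1) - (|y| / R - 1)| ≤ |x - y| / R := by
      have : (|x| / R - 1) - (|y| / R - 1) = (|x| - |y|) / R := by ring
      rw [this, abs_div, abs_of_pos hR]
      exact div_le_div_of_nonneg_right (abs_abs_sub_abs_le x y) hR.le
    have h5 : (0 : ℝ) ≤ |x - y| / R := by positivity
    simp only [sub_self, abs_zero] at h2 h3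
    exact h2.trans (max_le h5 (h3.trans (max_le h5 h4)))
  calc _ ≤ Real.pi / 2 * (|x - y| / R) := by gcongr
    _ = _ := by field_simp

theorem cutoffAngle_of_le {R x : ℝ} (hR : 0 < R) (hx : |x| ≤ R) : cutoffAngle R x = 0 := by
  have : |x| / R - 1 ≤ 0 := by
    rw [sub_nonpos, div_le_one hR]; exact hx
  rw [cutoffAngle, max_eq_left this]
  simp

theorem cutoffAngle_of_ge {R x : ℝ} (hR : 0 < R) (hx : 2 * R ≤ |x|) :
    cutoffAngle R x = Real.pi / 2 := by
  have h1 : 1 ≤ |x| / R - 1 := by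
    rw [le_sub_iff_add_le, le_div_iff₀ hR]; linarith
  rw [cutoffAngle, max_eq_right (by linarith), min_eq_left h1, mul_one]

theorem cos_cutoffAngle_nonneg (R x : ℝ) : 0 ≤ Real.cos (cutoffAngle R x) := by
  have h1 : 0 ≤ min 1 (max 0 (|x| / R - 1)) := le_min zero_le_one (le_max_left _ _)
  have h2 : min 1 (max 0 (|x| / R - 1)) ≤ 1 := min_le_left _ _
  have hpi := Real.pi_pos
  refine Real.cos_nonneg_of_neg_pi_div_two_le_of_le ?_ ?_ <;> rw [cutoffAngle] <;> nlinarith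

/-- The left side vanishes for $|x|\le R$ and is at most one elsewhere. With power $k$ the squared
overlap is of order $R^{-2k}W^{-k}=W^{-4k/14}$ at $R=W^{-5/14}$, and $k=4$ is the least integer that
reaches $W^{-15/14}$. -/
theorem abs_cos_cutoffAngle_sub_one_le {R : ℝ} (hR : 0 < R) (x : ℝ) :
    |Real.cos (cutoffAngle R x) - 1| ≤ (R ^ 4)⁻¹ * |x| ^ 4 := by
  rcases le_or_gt |x| R with h | h
  · rw [cutoffAngle_of_le hR h]
    simp only [Real.cos_zero, sub_self, abs_zero]
    positivity
  · have h1 : |Real.cos (cutoffAngle R x) - 1| ≤ 1 := by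
      rw [abs_le]
      constructor <;> linarith [cos_cutoffAngle_nonneg R x, Real.cos_le_one (cutoffAngle R x)]
    refine h1.trans ?_
    rw [inv_mul_eq_div, one_le_div (by positivity)]
    gcongr

theorem norm_cos_le_one (t : ℝ) : ‖((Real.cos t : ℝ) : ℂ)‖ ≤ 1 := by
  rw [Complex.norm_real, Real.norm_eq_abs]
  exact Real.abs_cos_le_one t

theorem norm_sin_le_one (t : ℝ) : ‖((Real.sin t : ℝ) : ℂ)‖ ≤ 1 := by
  rw [Complex.norm_real, Real.norm_eq_abs]
  exact Real.abs_sin_le_one t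

theorem norm_sq_cos_add_norm_sq_sin {θ : ℝ → ℝ} {u v w : L2R}
    (hv : ∀ᵐ x : ℝ, v x = (Real.cos (θ x) : ℂ) * u x)
    (hw : ∀ᵐ x : ℝ, w x = (Real.sin (θ x) : ℂ) * u x) : ‖v‖ ^ 2 + ‖w‖ ^ 2 = ‖u‖ ^ 2 := by
  rw [norm_sq_eq_integral, norm_sq_eq_integral, norm_sq_eq_integral,
    ← integral_add (integrable_norm_sq v) (integrable_norm_sq w)]
  refine integral_congr_ae ?_
  filter_upwards [hv, hw] with x h1 h2
  rw [h1, h2, norm_mul, norm_mul, Complex.norm_real, Complex.norm_real, mul_pow, mul_pow,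
    Real.norm_eq_abs, Real.norm_eq_abs, sq_abs, sq_abs, ← add_mul, Real.cos_sq_add_sin_sq, one_mul]

/-- Cutting off a function orthogonal to the Gaussian keeps it nearly orthogonal. -/
theorem norm_inner_gauss_cutoff_le {α R : ℝ} (hα : 0 < α) (hR : 0 < R) {u v : L2R}
    (hu : inner ℂ (gaussL2 α) u = 0)
    (hv : ∀ᵐ x : ℝ, v x = (Real.cos (cutoffAngle R x) : ℂ) * u x) :
    ‖inner ℂ (gaussL2 α) v‖ ^ 2 ≤ 48 / (α ^ 4 * R ^ 8) * ‖u‖ ^ 2 := by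
  obtain ⟨w, hw⟩ := exists_pow_mul_gaussFun hα 4
  have hwn := norm_sq_le_of_le_pow_mul_gaussFun hα 4 (w := w) (by
    filter_upwards [hw] with x hx
    have : 0 ≤ |x| ^ 4 * gaussFun α x := mul_nonneg (by positivity) (gaussFun_nonneg hα x)
    rw [hx, Complex.norm_real, Real.norm_of_nonneg this])
  have hcosc : Continuous fun x => ((Real.cos (cutoffAngle R x) : ℝ) : ℂ) := by
    have := continuous_cutoffAngle R
    fun_prop
  obtain ⟨g', hg'⟩ := exists_mul_continuous hcosc (fun x => norm_cos_le_one _) (gaussL2 α)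
  have h1 : inner ℂ (gaussL2 α) v = inner ℂ (g' - gaussL2 α) u := by
    rw [inner_sub_left, hu, sub_zero, inner_eq_integral, inner_eq_integral]
    refine integral_congr_ae ?_
    filter_upwards [hv, hg'] with x h1 h2
    rw [h1, h2, map_mul, Complex.conj_ofReal]
    ring
  have h2 : ‖g' - gaussL2 α‖ ≤ (R ^ 4)⁻¹ * ‖w‖ := by
    refine norm_le_mul_norm_of_ae ?_
    filter_upwards [hg', hw, Lp.coeFn_sub g' (gaussL2 α), gaussL2_ae hα] with x h1 h2 h3 h4
    have h5 : ((Real.cos (cutoffAngle R x) : ℝ) : ℂ) * (gaussFun α x : ℂ) - (gaussFun α x : ℂ) =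
        (((Real.cos (cutoffAngle R x) - 1) * gaussFun α x : ℝ) : ℂ) := by push_cast; ring
    rw [h3, Pi.sub_apply, h1, h2, h4, h5, Complex.norm_real, Complex.norm_real, Real.norm_eq_abs,
      Real.norm_eq_abs, abs_mul, abs_mul, abs_of_nonneg (gaussFun_nonneg hα x), abs_pow, abs_abs,
      ← mul_assoc]
    exact mul_le_mul_of_nonneg_right (abs_cos_cutoffAngle_sub_one_le hR x) (gaussFun_nonneg hα x)
  have h3 : ‖inner ℂ (gaussL2 α) v‖ ≤ (R ^ 4)⁻¹ * ‖w‖ * ‖u‖ := by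
    rw [h1]
    exact (norm_inner_le_norm _ _).trans (by gcongr)
  calc ‖inner ℂ (gaussL2 α) v‖ ^ 2 ≤ ((R ^ 4)⁻¹ * ‖w‖ * ‖u‖) ^ 2 := by gcongr
    _ = (R ^ 8)⁻¹ * ‖w‖ ^ 2 * ‖u‖ ^ 2 := by field_simp
    _ ≤ (R ^ 8)⁻¹ * (2 * ((Nat.factorial 4 : ℕ) / α ^ 4)) * ‖u‖ ^ 2 := by gcongr
    _ = _ := by
        norm_num [Nat.factorial]
        field_simp
        norm_num

/-! ### Decay away from the saddle and size of the Mehler constants. -/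

namespace SaddleData

variable {Λ a : ℝ} {ζ : ℂ} {U : ℝ → ℂ}

/-- Decay of the transfer operator away from the saddle. -/
theorem norm_le_of_support (h : SaddleData Λ a ζ U) {W R : ℝ} (hW : 0 < W) (hR : 0 ≤ R)
    (hR1 : R ≤ 1) {K : L2R →L[ℂ] L2R} (hK : HasKernel K (transferKernel W ζ U)) {v : L2R}
    (hv : ∀ᵐ y : ℝ, |y| < R → v y = 0) :
    ‖K v‖ ^ 2 ≤ Real.pi / W ^ 2 * Real.exp (-(Λ⁻¹ * R ^ 2)) * ‖v‖ ^ 2 := by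
  have hΛ := h.pos
  have hA := h.coeff_re_pos hW
  have hmc : Continuous fun x => Complex.exp (-(U x / 2)) := by
    have := h.cont
    fun_prop
  obtain ⟨v', hv'⟩ := exists_mul_continuous hmc h.norm_exp_neg_half_le_one v
  obtain ⟨G, hG, -⟩ := exists_hasKernel hA (continuous_mehlerKernel ((W : ℂ) ^ 2 * ζ ^ 2) 0)
    (norm_mehlerKernel_le (by simp))
  have h1 : ‖K v‖ ≤ 1 * ‖G v'‖ := by
    refine norm_le_mul_norm_of_ae ?_
    filter_upwards [hK v, hG v'] with x h1 h2
    have h3 : ∫ y, transferKernel W ζ U x y * v y = Complex.exp (-(U x / 2)) *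
        ∫ y, mehlerKernel ((W : ℂ) ^ 2 * ζ ^ 2) 0 x y * v' y := by
      rw [← integral_const_mul]
      refine integral_congr_ae ?_
      filter_upwards [hv'] with y hy
      rw [hy, transferKernel_eq]
      ring
    rw [h1.2, h3, ← h2.2, norm_mul]
    exact mul_le_mul_of_nonneg_right (h.norm_exp_neg_half_le_one x) (norm_nonneg _)
  -- The sharp constant $\pi/W^2$ matters: it agrees with $|\mu|^2$ to leading order, and the only
  -- gain here is the exponential factor close to one.
  have h2 := norm_gauss_conv_le hA hG v'
  rw [h.norm_coeff] at h2
  have h3 : ‖v'‖ ≤ Real.exp (-(Λ⁻¹ * R ^ 2) / 2) * ‖v‖ := by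
    refine norm_le_mul_norm_of_ae ?_
    filter_upwards [hv', hv] with y h1 h2
    rcases lt_or_ge |y| R with hy | hy
    · rw [h1, h2 hy]; simp
    · rw [h1, norm_mul, Complex.norm_exp]
      gcongr
      have h4 : R ^ 2 ≤ min 1 (y ^ 2) := by
        refine le_min (pow_le_one₀ hR hR1) ?_
        rw [← sq_abs y]
        gcongr
      have h5 : Λ⁻¹ * R ^ 2 ≤ (U y).re := by
        refine le_trans ?_ (h.lower y)
        gcongr
      simp
      linarith
  have h4 : ‖K v‖ ≤ Real.sqrt (Real.pi / W ^ 2) * (Real.exp (-(Λ⁻¹ * R ^ 2) / 2) * ‖v‖) := by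
    rw [one_mul] at h1
    exact h1.trans (h2.trans (by gcongr))
  calc ‖K v‖ ^ 2 ≤ (Real.sqrt (Real.pi / W ^ 2) * (Real.exp (-(Λ⁻¹ * R ^ 2) / 2) * ‖v‖)) ^ 2 := by
        gcongr
    _ = _ := by
        rw [mul_pow, mul_pow, Real.sq_sqrt (by positivity), ← Real.exp_nat_mul]
        push_cast
        rw [mul_div_cancel₀ _ two_ne_zero]
        ring

/-- Multiplying by the unit number $\overline{\zeta^2}$ turns $D+\alpha$ into
$W^2+Wa\overline{\zeta^2}+O(1)$; the real part gives the bound. This is the source of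
$a\operatorname{Re}\zeta^2/W$ in the gap. -/
theorem norm_D_add_ge (h : SaddleData Λ a ζ U) {W : ℝ} (hW : 0 < W) {D : ℂ} (hD : 0 < D.re)
    (hsq : D ^ 2 = ((W : ℂ) ^ 2 * ζ ^ 2) ^ 2 + ((W * a : ℝ) : ℂ) ^ 2) :
    W ^ 2 + W * a * (ζ ^ 2).re - Λ ^ 3 ≤ ‖D + (W * a : ℝ)‖ := by
  have h1 := h.norm_D_sub_le hW hD hsq
  have hz : ‖(starRingEnd ℂ) (ζ ^ 2)‖ = 1 := by
    rw [RCLike.norm_conj, norm_pow, h.norm_eq, one_pow]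
  have h2 : (D + (W * a : ℝ)) * (starRingEnd ℂ) (ζ ^ 2) =
      (W ^ 2 : ℝ) + (W * a : ℝ) * (starRingEnd ℂ) (ζ ^ 2) +
        (D - (W : ℂ) ^ 2 * ζ ^ 2) * (starRingEnd ℂ) (ζ ^ 2) := by
    push_cast
    linear_combination ((W : ℂ) ^ 2) * h.mul_conj
  have h3 : ‖D + (W * a : ℝ)‖ = ‖(D + (W * a : ℝ)) * (starRingEnd ℂ) (ζ ^ 2)‖ := by
    rw [norm_mul, hz, mul_one]
  rw [h3, h2]
  refine le_trans ?_ (Complex.re_le_norm _)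
  rw [Complex.add_re, Complex.add_re, Complex.re_ofReal_mul, Complex.conj_re, Complex.ofReal_re]
  have h4 := Complex.abs_re_le_norm ((D - (W : ℂ) ^ 2 * ζ ^ 2) * (starRingEnd ℂ) (ζ ^ 2))
  rw [norm_mul, hz, mul_one] at h4
  have h5 := neg_le_of_abs_le h4
  have h6 : 0 ≤ Λ ^ 3 := by have := h.pos; positivity
  linarith

theorem norm_coeff_add_ge (h : SaddleData Λ a ζ U) {W : ℝ} (hW : 0 < W) :
    W ^ 2 ≤ ‖(W : ℂ) ^ 2 * ζ ^ 2 + (W * a : ℝ)‖ := by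
  have ha := h.a_pos
  have hκ := h.re_pos
  have hz : ‖(starRingEnd ℂ) (ζ ^ 2)‖ = 1 := by
    rw [RCLike.norm_conj, norm_pow, h.norm_eq, one_pow]
  have h2 : ((W : ℂ) ^ 2 * ζ ^ 2 + (W * a : ℝ)) * (starRingEnd ℂ) (ζ ^ 2) =
      (W ^ 2 : ℝ) + (W * a : ℝ) * (starRingEnd ℂ) (ζ ^ 2) := by
    push_cast
    linear_combination ((W : ℂ) ^ 2) * h.mul_conj
  have h3 : ‖(W : ℂ) ^ 2 * ζ ^ 2 + (W * a : ℝ)‖ =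
      ‖((W : ℂ) ^ 2 * ζ ^ 2 + (W * a : ℝ)) * (starRingEnd ℂ) (ζ ^ 2)‖ := by
    rw [norm_mul, hz, mul_one]
  rw [h3, h2]
  refine le_trans ?_ (Complex.re_le_norm _)
  rw [Complex.add_re, Complex.re_ofReal_mul, Complex.conj_re, Complex.ofReal_re]
  have : 0 ≤ W * a * (ζ ^ 2).re := by positivity
  linarith

theorem norm_coeff_add_le (h : SaddleData Λ a ζ U) {W : ℝ} (hW : 0 < W) :
    ‖(W : ℂ) ^ 2 * ζ ^ 2 + (W * a : ℝ)‖ ≤ W ^ 2 + W * Λ := by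
  have ha := h.a_pos
  refine (norm_add_le _ _).trans ?_
  rw [h.norm_coeff, Complex.norm_real, Real.norm_of_nonneg (by positivity)]
  have := h.le
  gcongr

/-- The model has top eigenvalue $\sqrt{\pi/(D+\alpha)}$, whereas $\mu$ has $A$ in place of $D$. As
$D-A$ is bounded and $|D+\alpha|\ge W^2$, the relative difference is $O(W^{-2})$. -/
theorem norm_top_sub_le (h : SaddleData Λ a ζ U) {W : ℝ} (hW : 0 < W) {D : ℂ} (hD : 0 < D.re)
    (hsq : D ^ 2 = ((W : ℂ) ^ 2 * ζ ^ 2) ^ 2 + ((W * a : ℝ) : ℂ) ^ 2)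
    (hDW : W ^ 2 ≤ ‖D + (W * a : ℝ)‖) :
    ‖mehlerTop D (W * a) - mehlerTop ((W : ℂ) ^ 2 * ζ ^ 2) (W * a)‖ ≤
      Λ ^ 3 / W ^ 2 * ‖mehlerTop ((W : ℂ) ^ 2 * ζ ^ 2) (W * a)‖ := by
  have hB := h.norm_D_sub_le hW hD hsq
  have hA := h.coeff_re_pos hW
  have hge := h.norm_coeff_add_ge hW
  have ha := h.a_pos
  have hμ := norm_sq_mehlerTop ((W : ℂ) ^ 2 * ζ ^ 2) (W * a)
  set A := (W : ℂ) ^ 2 * ζ ^ 2 with hAdef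
  have hW2 : 0 < W ^ 2 := by positivity
  have hApos : 0 < ‖A + (W * a : ℝ)‖ := hW2.trans_le hge
  have hDpos : 0 < ‖D + (W * a : ℝ)‖ := hW2.trans_le hDW
  have hA0 := norm_pos_iff.1 hApos
  have hD0 := norm_pos_iff.1 hDpos
  have hre : 0 < ((Real.pi : ℂ) / (A + (W * a : ℝ))).re := by
    rw [div_eq_mul_inv, Complex.re_ofReal_mul, Complex.inv_re]
    have h1 : 0 < (A + (W * a : ℝ)).re := by
      rw [Complex.add_re, Complex.ofReal_re]
      have : 0 < W * a := by positivity
      linarith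
    have h2 := Complex.normSq_pos.2 hA0
    have := Real.pi_pos
    positivity
  have h1 := norm_cpow_half_sub_le (z := (Real.pi : ℂ) / (D + (W * a : ℝ))) hre
  have h2 : (Real.pi : ℂ) / (D + (W * a : ℝ)) - (Real.pi : ℂ) / (A + (W * a : ℝ)) =
      -((Real.pi : ℂ) / (A + (W * a : ℝ)) * ((D - A) / (D + (W * a : ℝ)))) := by
    field_simp
    ring
  have h3 : ‖(Real.pi : ℂ) / (A + (W * a : ℝ))‖ = ‖mehlerTop A (W * a)‖ ^ 2 := by
    rw [hμ, norm_div, Complex.norm_real, Real.norm_of_nonneg Real.pi_pos.le]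
  rw [h2, norm_neg, norm_mul, h3, norm_div] at h1
  have hμpos : 0 < ‖mehlerTop A (W * a)‖ := by
    have : 0 < ‖mehlerTop A (W * a)‖ ^ 2 := by
      rw [hμ]
      have := Real.pi_pos
      positivity
    exact (norm_nonneg _).lt_of_ne (fun h0 => by rw [← h0] at this; simp at this)
  have hΛ := h.pos
  have h4 : ‖D - A‖ / ‖D + (W * a : ℝ)‖ ≤ (Λ ^ 3 / 2) / W ^ 2 := by gcongr
  change ‖mehlerTop D (W * a) - mehlerTop A (W * a)‖ * ‖mehlerTop A (W * a)‖ ≤ _ at h1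
  refine le_of_mul_le_mul_right (h1.trans ?_) hμpos
  calc 2 * (‖mehlerTop A (W * a)‖ ^ 2 * (‖D - A‖ / ‖D + (W * a : ℝ)‖))
      ≤ 2 * (‖mehlerTop A (W * a)‖ ^ 2 * ((Λ ^ 3 / 2) / W ^ 2)) := by gcongr
    _ = Λ ^ 3 / W ^ 2 * ‖mehlerTop A (W * a)‖ * ‖mehlerTop A (W * a)‖ := by ring

end SaddleData

/-! ### The gap and the errors at the scale $W=x^{-14}$. -/

namespace SaddleData

variable {Λ a : ℝ} {ζ : ℂ} {U : ℝ → ℂ}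

/-- The scale `x` with `W = x⁻¹⁴` is small compared with `Λ`. -/
structure SmallScale (Λ W x : ℝ) : Prop where
  pos : 0 < x
  small : 10 ^ 7 * Λ ^ 20 * x ≤ 1
  -- With this scale all sizes are integer powers of $x$: the cutoff radius is $x^5$, the gap is of
  -- order $x^{14}$, and the allowed error is $x^{15}$.
  eq : W⁻¹ = x ^ 14

theorem SmallScale.le_one {W x : ℝ} (hs : SmallScale Λ W x) (hΛ : 1 ≤ Λ) : x ≤ 1 := by
  have h1 : 1 ≤ 10 ^ 7 * Λ ^ 20 := by
    have : 1 ≤ Λ ^ 20 := one_le_pow₀ hΛ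
    linarith
  have := le_mul_of_one_le_left hs.pos.le h1
  linarith [hs.small]

theorem SmallScale.W_pos {W x : ℝ} (hs : SmallScale Λ W x) : 0 < W := by
  rw [← inv_pos, hs.eq]
  exact pow_pos hs.pos _

theorem SmallScale.inv_sq {W x : ℝ} (hs : SmallScale Λ W x) : (W ^ 2)⁻¹ = x ^ 28 := by
  rw [← inv_pow, hs.eq]
  ring

/-- Any moderate polynomial in `Λ` times a power of `x` is small. -/
theorem SmallScale.pow_mul_le {W x : ℝ} (hs : SmallScale Λ W x) (hΛ : 1 ≤ Λ) {m n : ℕ}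
    (hm : m ≤ 20) (hn : 1 ≤ n) : 10 ^ 7 * (Λ ^ m * x ^ n) ≤ 1 := by
  have h1 : Λ ^ m ≤ Λ ^ 20 := pow_le_pow_right₀ hΛ hm
  have h2 : x ^ n ≤ x ^ 1 := pow_le_pow_of_le_one hs.pos.le (hs.le_one hΛ) hn
  have hx := hs.pos
  have h3 : Λ ^ m * x ^ n ≤ Λ ^ 20 * x := by
    rw [pow_one] at h2
    gcongr
  linarith [hs.small]

theorem one_le_W (h : SaddleData Λ a ζ U) {W x : ℝ} (hs : SmallScale Λ W x) : 1 ≤ W := by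
  rw [← inv_le_one₀ hs.W_pos, hs.eq]
  exact pow_le_one₀ hs.pos.le (hs.le_one h.one_le)

theorem Lambda_le_W (h : SaddleData Λ a ζ U) {W x : ℝ} (hs : SmallScale Λ W x) : Λ * W⁻¹ ≤ 1 := by
  have := hs.pow_mul_le h.one_le (m := 1) (n := 14) (by norm_num) (by norm_num)
  rw [hs.eq]
  rw [pow_one] at this
  linarith [mul_pos h.pos (pow_pos hs.pos 14)]

theorem _root_.saddleMu_eq_mehlerTop {W : ℝ} (ha : saddleAlpha W ζ U = W * a) :
    saddleMu W ζ U = mehlerTop ((W : ℂ) ^ 2 * ζ ^ 2) (W * a) := by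
  rw [saddleMu, ha, mehlerTop]

/-- The second bound keeps the constant $\pi$, because the part away from the saddle is compared
with $|\mu|^2$ to within a factor $1+O(W^{-1})$; the first is the crude form used to absorb errors.
-/
theorem le_norm_top (h : SaddleData Λ a ζ U) {W x : ℝ} (hs : SmallScale Λ W x) :
    x ^ 14 ≤ ‖mehlerTop ((W : ℂ) ^ 2 * ζ ^ 2) (W * a)‖ ∧
    Real.pi * x ^ 28 ≤ ‖mehlerTop ((W : ℂ) ^ 2 * ζ ^ 2) (W * a)‖ ^ 2 * (1 + Λ * x ^ 14) := by
  have hW := hs.W_pos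
  have h1 := h.norm_coeff_add_le hW
  have h2 := h.norm_coeff_add_ge hW
  have hΛ := h.pos
  have hx := hs.pos
  have hpos : 0 < ‖(W : ℂ) ^ 2 * ζ ^ 2 + (W * a : ℝ)‖ := lt_of_lt_of_le (by positivity) h2
  have hμ := norm_sq_mehlerTop ((W : ℂ) ^ 2 * ζ ^ 2) (W * a)
  have hWx : W * x ^ 14 = 1 := by rw [← hs.eq]; field_simp
  have h3 : Real.pi * x ^ 28 ≤
      ‖mehlerTop ((W : ℂ) ^ 2 * ζ ^ 2) (W * a)‖ ^ 2 * (1 + Λ * x ^ 14) := by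
    rw [hμ, div_mul_eq_mul_div, le_div_iff₀ hpos]
    calc _ ≤ Real.pi * x ^ 28 * (W ^ 2 + W * Λ) := by gcongr
      _ = Real.pi * ((W * x ^ 14) ^ 2 + (W * x ^ 14) * (Λ * x ^ 14)) := by ring
      _ = _ := by rw [hWx]; ring
  refine ⟨?_, h3⟩
  refine le_of_sq_le_sq ?_ (norm_nonneg _)
  have h4 : Λ * x ^ 14 ≤ 1 := by rw [← hs.eq]; exact h.Lambda_le_W hs
  have h5 : ‖mehlerTop ((W : ℂ) ^ 2 * ζ ^ 2) (W * a)‖ ^ 2 * (1 + Λ * x ^ 14) ≤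
      ‖mehlerTop ((W : ℂ) ^ 2 * ζ ^ 2) (W * a)‖ ^ 2 * 2 := by gcongr; linarith
  have h6 : 0 < x ^ 28 := by positivity
  have h7 : (x ^ 14) ^ 2 = x ^ 28 := by ring
  have := mul_le_mul_of_nonneg_right Real.pi_gt_three.le h6.le
  rw [h7]
  linarith

theorem W_sq_le_norm_D_add (h : SaddleData Λ a ζ U) {W x : ℝ} (hs : SmallScale Λ W x) {D : ℂ}
    (hD : 0 < D.re) (hsq : D ^ 2 = ((W : ℂ) ^ 2 * ζ ^ 2) ^ 2 + ((W * a : ℝ) : ℂ) ^ 2) :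
    W ^ 2 ≤ ‖D + (W * a : ℝ)‖ := by
  have hW := hs.W_pos
  have hΛ := h.pos
  have hx := hs.pos
  refine le_trans ?_ (h.norm_D_add_ge hW hD hsq)
  have h1 : Λ ^ 3 ≤ W * a * (ζ ^ 2).re := by
    have hi : 0 < Λ⁻¹ := inv_pos.2 hΛ
    calc Λ ^ 3 = W * (Λ ^ 3 * W⁻¹) := by field_simp
      _ ≤ W * (Λ⁻¹ * Λ⁻¹) := by
          refine mul_le_mul_of_nonneg_left ?_ hW.le
          have h2 := hs.pow_mul_le h.one_le (m := 5) (n := 14) (by norm_num) (by norm_num)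
          rw [hs.eq, ← mul_inv, ← one_div, le_div_iff₀ (by positivity)]
          have h3 : 0 < Λ ^ 5 * x ^ 14 := by positivity
          calc Λ ^ 3 * x ^ 14 * (Λ * Λ) = Λ ^ 5 * x ^ 14 := by ring
            _ ≤ 1 := by linarith
      _ ≤ W * (a * (ζ ^ 2).re) := by
          have := h.inv_le
          have := h.inv_le_re
          have := h.a_pos
          gcongr
      _ = _ := by ring
  linarith

/-- The Gaussian is an approximate eigenfunction of the transfer operator. -/
theorem norm_apply_gauss_sub_le (h : SaddleData Λ a ζ U) {W x : ℝ} (hs : SmallScale Λ W x) {D : ℂ}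
    (hD : 0 < D.re) (hsq : D ^ 2 = ((W : ℂ) ^ 2 * ζ ^ 2) ^ 2 + ((W * a : ℝ) : ℂ) ^ 2)
    {K T : L2R →L[ℂ] L2R} (hK : HasKernel K (transferKernel W ζ U))
    (hT : HasKernel T (mehlerKernel ((W : ℂ) ^ 2 * ζ ^ 2) (D - (W : ℂ) ^ 2 * ζ ^ 2))) :
    ‖K (gaussL2 (W * a)) - mehlerTop ((W : ℂ) ^ 2 * ζ ^ 2) (W * a) • gaussL2 (W * a)‖ ≤
      1300 * Λ ^ 11 * x ^ 15 * ‖mehlerTop ((W : ℂ) ^ 2 * ζ ^ 2) (W * a)‖ := by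
  have hW := hs.W_pos
  have hΛ := h.pos
  have hΛ1 := h.one_le
  have hx := hs.pos
  have hx1 := hs.le_one hΛ1
  have ha := h.a_pos
  have hα : 0 < W * a := by positivity
  have hWi := hs.inv_sq
  -- The kernel error weights the Gaussian by $|y|^3+W^{-2}$; the cubic weight has $L_2$ norm of
  -- order $\alpha^{-3/2}$, that is $x^{21}$.
  obtain ⟨w, hw⟩ := exists_pow_mul_gaussFun hα 3
  have hwpos (y : ℝ) : 0 ≤ |y| ^ 3 * gaussFun (W * a) y :=
    mul_nonneg (by positivity) (gaussFun_nonneg hα y)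
  have hw2 := norm_sq_le_of_le_pow_mul_gaussFun hα 3 (w := w) (by
    filter_upwards [hw] with y hy
    rw [hy, Complex.norm_real, Real.norm_of_nonneg (hwpos y)])
  have hwn : ‖w‖ ≤ 4 * Λ ^ 2 * x ^ 21 := by
    refine le_of_sq_le_sq (hw2.trans ?_) (by positivity)
    have h1 : (a ^ 3)⁻¹ ≤ Λ ^ 3 := by
      rw [← inv_pow]
      gcongr
      exact (inv_le_comm₀ hΛ ha).1 h.inv_le
    have h2 : Λ ^ 3 ≤ Λ ^ 4 := pow_le_pow_right₀ hΛ1 (by norm_num)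
    calc 2 * (((Nat.factorial 3 : ℕ) : ℝ) / (W * a) ^ 3) = 12 * (W⁻¹ ^ 3 * (a ^ 3)⁻¹) := by
          norm_num [Nat.factorial]
          field_simp
          norm_num
      _ ≤ 12 * (W⁻¹ ^ 3 * Λ ^ 4) := by
          have : 0 < W⁻¹ := inv_pos.2 hW
          gcongr
          linarith
      _ ≤ 16 * (W⁻¹ ^ 3 * Λ ^ 4) := by
          have : 0 < W⁻¹ := inv_pos.2 hW
          gcongr
          norm_num
      _ = (4 * Λ ^ 2 * x ^ 21) ^ 2 := by rw [hs.eq]; ring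
  have h1 : ‖w + (x ^ 28 : ℂ) • gaussL2 (W * a)‖ ≤ 5 * Λ ^ 2 * x ^ 21 := by
    refine (norm_add_le _ _).trans ?_
    rw [norm_smul, norm_gaussL2 hα, norm_pow, Complex.norm_real, Real.norm_of_nonneg hx.le]
    have h2 : x ^ 28 ≤ x ^ 21 := pow_le_pow_of_le_one hx.le hx1 (by norm_num)
    have h3 : x ^ 21 ≤ Λ ^ 2 * x ^ 21 := le_mul_of_one_le_left (by positivity) (one_le_pow₀ hΛ1)
    linarith
  have h2 := h.norm_sub_le (h.one_le_W hs) hD hsq hK hT (u := gaussL2 (W * a))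
    (w := w + (x ^ 28 : ℂ) • gaussL2 (W * a)) (by
      filter_upwards [hw, gaussL2_ae hα, Lp.coeFn_add w ((x ^ 28 : ℂ) • gaussL2 (W * a)),
        Lp.coeFn_smul (x ^ 28 : ℂ) (gaussL2 (W * a))] with y h1 h2 h3 h4
      have h5 : ((|y| ^ 3 * gaussFun (W * a) y : ℝ) : ℂ) + (x ^ 28 : ℂ) * (gaussFun (W * a) y : ℂ) =
          (((|y| ^ 3 + x ^ 28) * gaussFun (W * a) y : ℝ) : ℂ) := by push_cast; ring
      have h6 := gaussFun_nonneg hα y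
      rw [h3, Pi.add_apply, h4, Pi.smul_apply, h1, h2, smul_eq_mul, h5, hWi, Complex.norm_real,
        Complex.norm_real, norm_mul, Real.norm_of_nonneg (by positivity : 0 ≤ |y| ^ 3 + x ^ 28)])
  have h3 : T (gaussL2 (W * a)) = mehlerTop D (W * a) • gaussL2 (W * a) := by
    have := mehler_coherent hα hD hsq hT 0
    rwa [mul_zero, coherentL2_zero] at this
  have h4 := h.norm_top_sub_le hW hD hsq (h.W_sq_le_norm_D_add hs hD hsq)
  have h5 := (h.le_norm_top hs).1
  rw [h3] at h2
  set μ := mehlerTop ((W : ℂ) ^ 2 * ζ ^ 2) (W * a)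
  set μ₀ := mehlerTop D (W * a)
  have h6 : K (gaussL2 (W * a)) - μ • gaussL2 (W * a) =
      (K (gaussL2 (W * a)) - μ₀ • gaussL2 (W * a)) + (μ₀ - μ) • gaussL2 (W * a) := by
    rw [sub_smul]; abel
  rw [h6]
  refine (norm_add_le _ _).trans ?_
  rw [norm_smul, norm_gaussL2 hα, mul_one]
  have h7 : 240 * Λ ^ 9 * W⁻¹ * ‖w + (x ^ 28 : ℂ) • gaussL2 (W * a)‖ ≤
      1200 * Λ ^ 11 * x ^ 15 * ‖μ‖ := by
    have h8 : x ^ 21 ≤ x ^ 15 := pow_le_pow_of_le_one hx.le hx1 (by norm_num)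
    rw [hs.eq]
    calc _ ≤ 240 * Λ ^ 9 * x ^ 14 * (5 * Λ ^ 2 * x ^ 21) := by gcongr
      _ ≤ 240 * Λ ^ 9 * ‖μ‖ * (5 * Λ ^ 2 * x ^ 15) := by gcongr
      _ = _ := by ring
  have h8 : Λ ^ 3 / W ^ 2 * ‖μ‖ ≤ 100 * Λ ^ 11 * x ^ 15 * ‖μ‖ := by
    rw [div_eq_mul_inv, hWi]
    have h9 : x ^ 28 ≤ x ^ 15 := pow_le_pow_of_le_one hx.le hx1 (by norm_num)
    have h10 : Λ ^ 3 ≤ Λ ^ 11 := pow_le_pow_right₀ hΛ1 (by norm_num)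
    have h11 : 0 ≤ Λ ^ 11 * x ^ 15 * ‖μ‖ := by positivity
    calc Λ ^ 3 * x ^ 28 * ‖μ‖ ≤ Λ ^ 11 * x ^ 15 * ‖μ‖ := by gcongr
      _ ≤ _ := by linarith
  linarith

theorem _root_.one_add_sq_mul_sq_le {g d q : ℝ} (hd : 0 ≤ d) (hd1 : d ≤ 1 / 100) (hg : 0 ≤ g)
    (hg1 : g ≤ 1) (hq : 0 ≤ q) (hqle : q ≤ 1 - g + 2 * d) :
    (1 + d) ^ 2 * q ^ 2 ≤ (1 - g) ^ 2 + 10 * d := by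
  have h1 : q ^ 2 ≤ (1 - g + 2 * d) ^ 2 := by gcongr
  have hdd : d * d ≤ d * (1 / 100) := mul_le_mul_of_nonneg_left hd1 hd
  have hdg : 0 ≤ d * g := mul_nonneg hd hg
  have h2 : (1 - g + 2 * d) ^ 2 ≤ (1 - g) ^ 2 + 5 * d := by nlinarith
  have h3 : (1 + d) ^ 2 ≤ 1 + 3 * d := by nlinarith
  have h4 : (1 - g) ^ 2 ≤ 1 := by nlinarith
  have h5 : d * (1 - g) ^ 2 ≤ d * 1 := mul_le_mul_of_nonneg_left h4 hd
  calc (1 + d) ^ 2 * q ^ 2 ≤ (1 + 3 * d) * ((1 - g) ^ 2 + 5 * d) := by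
        gcongr
        exact h1.trans h2
    _ = (1 - g) ^ 2 + 5 * d + 3 * (d * (1 - g) ^ 2) + 15 * (d * d) := by ring
    _ ≤ _ := by linarith

set_option maxHeartbeats 1000000 in
/-- The norm of the Mehler operator on cut-off functions orthogonal to the Gaussian. -/
theorem norm_sq_mehler_cutoff_le (h : SaddleData Λ a ζ U) {W x : ℝ} (hs : SmallScale Λ W x) {D : ℂ}
    (hD : 0 < D.re) (hsq : D ^ 2 = ((W : ℂ) ^ 2 * ζ ^ 2) ^ 2 + ((W * a : ℝ) : ℂ) ^ 2)
    {T : L2R →L[ℂ] L2R}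
    (hT : HasKernel T (mehlerKernel ((W : ℂ) ^ 2 * ζ ^ 2) (D - (W : ℂ) ^ 2 * ζ ^ 2))) {u v : L2R}
    (hu : inner ℂ (gaussL2 (W * a)) u = 0)
    (hv : ∀ᵐ y : ℝ, v y = (Real.cos (cutoffAngle (x ^ 5) y) : ℂ) * u y) :
    ‖T v‖ ^ 2 ≤ ‖mehlerTop ((W : ℂ) ^ 2 * ζ ^ 2) (W * a)‖ ^ 2 *
      ((1 - a * (ζ ^ 2).re * x ^ 14) ^ 2 * ‖v‖ ^ 2 + 200 * Λ ^ 9 * x ^ 15 * ‖u‖ ^ 2) := by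
  have hW := hs.W_pos
  have hΛ := h.pos
  have hΛ1 := h.one_le
  have hx := hs.pos
  have hx1 := hs.le_one hΛ1
  have ha := h.a_pos
  have hκ := h.re_pos
  have hα : 0 < W * a := by positivity
  have hWi := hs.inv_sq
  have hWx : W * x ^ 14 = 1 := by rw [← hs.eq]; field_simp
  have hgap := norm_sq_mehler_le hα hD hsq hT v
  have hov := norm_inner_gauss_cutoff_le hα (pow_pos hx 5) hu hv
  have hDge := h.norm_D_add_ge hW hD hsq
  have hDW := h.W_sq_le_norm_D_add hs hD hsq
  have htop := h.norm_top_sub_le hW hD hsq hDW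
  have hnA := h.norm_coeff W
  have hq1 := norm_mehler_ratio_le_one hα hD hsq
  have hvu : ‖v‖ ≤ ‖u‖ := by
    have := norm_le_mul_norm_of_ae (c := 1) (u := u) (v := v) (by
      filter_upwards [hv] with y hy
      rw [hy, norm_mul]
      exact mul_le_mul_of_nonneg_right (norm_cos_le_one _) (norm_nonneg _))
    rwa [one_mul] at this
  set A := (W : ℂ) ^ 2 * ζ ^ 2
  set κ := (ζ ^ 2).re
  set g := a * κ * x ^ 14 with hg
  set q := ‖A / (D + (W * a : ℝ))‖ with hq
  have hg0 : 0 < g := by positivity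
  have hgΛ : g ≤ Λ * x ^ 14 := by
    have h1 : a * κ ≤ Λ * 1 := mul_le_mul h.le h.re_le_one hκ.le hΛ.le
    rw [mul_one] at h1
    rw [hg]
    gcongr
  have hsm := hs.pow_mul_le hΛ1 (m := 3) (n := 28) (by norm_num) (by norm_num)
  have hsm1 := hs.pow_mul_le hΛ1 (m := 1) (n := 14) (by norm_num) (by norm_num)
  rw [pow_one] at hsm1
  -- This is $\Lambda^3/W^2$, the relative size of both the $O(1)$ term in $|D+\alpha|$ and the
  -- shift of the top eigenvalue.
  set d := Λ ^ 3 * x ^ 28 with hd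
  have hd0 : 0 < d := by positivity
  have hg2 : g ^ 2 ≤ d := by
    have h1 : Λ ^ 2 ≤ Λ ^ 3 := pow_le_pow_right₀ hΛ1 (by norm_num)
    calc g ^ 2 ≤ (Λ * x ^ 14) ^ 2 := by gcongr
      _ = Λ ^ 2 * x ^ 28 := by ring
      _ ≤ d := by rw [hd]; gcongr
  have hdg : d ≤ g := by
    have h1 := hs.pow_mul_le hΛ1 (m := 5) (n := 14) (by norm_num) (by norm_num)
    have h2 : Λ⁻¹ * Λ⁻¹ ≤ a * κ :=
      mul_le_mul h.inv_le h.inv_le_re (inv_pos.2 hΛ).le ha.le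
    calc d = (Λ ^ 5 * x ^ 14) * (Λ⁻¹ * Λ⁻¹ * x ^ 14) := by rw [hd]; field_simp
      _ ≤ 1 * (a * κ * x ^ 14) := by
          have : 0 < Λ ^ 5 * x ^ 14 := by positivity
          gcongr
          linarith
      _ = g := by rw [hg, one_mul]
  have hqle : q ≤ 1 - g + 2 * d := by
    have hpos : 0 < ‖D + (W * a : ℝ)‖ := lt_of_lt_of_le (by positivity) hDW
    rw [hq, norm_div, hnA, div_le_iff₀ hpos]
    have h1 : W ^ 2 * (1 + g - d) ≤ ‖D + (W * a : ℝ)‖ := by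
      refine le_trans (le_of_eq ?_) hDge
      rw [hg, hd]
      linear_combination (W * a * κ - Λ ^ 3 * (W * x ^ 14 + 1)) * hWx
    have h2 : 0 ≤ 1 - g + 2 * d := by
      have : 0 < Λ * x ^ 14 := by positivity
      linarith
    have h3 : 1 ≤ (1 - g + 2 * d) * (1 + g - d) := by nlinarith
    calc W ^ 2 = W ^ 2 * 1 := by ring
      _ ≤ W ^ 2 * ((1 - g + 2 * d) * (1 + g - d)) := by gcongr
      _ = (1 - g + 2 * d) * (W ^ 2 * (1 + g - d)) := by ring
      _ ≤ _ := by gcongr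
  have hg1 : g ≤ 1 := by
    have : 0 < Λ * x ^ 14 := by positivity
    linarith
  have hq0 : 0 ≤ q := norm_nonneg _
  set μ := ‖mehlerTop A (W * a)‖ with hμ
  have hμ0 : 0 ≤ μ := norm_nonneg _
  have hμle : ‖mehlerTop D (W * a)‖ ≤ μ * (1 + d) := by
    have h1 : mehlerTop D (W * a) = (mehlerTop D (W * a) - mehlerTop A (W * a)) +
        mehlerTop A (W * a) := by ring
    rw [h1]
    refine (norm_add_le _ _).trans ?_
    rw [div_eq_mul_inv, hWi] at htop
    linarith
  have hd100 : d ≤ 1 / 100 := by linarith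
  have hq2 := one_add_sq_mul_sq_le hd0.le hd100 hg0.le hg1 hq0 hqle
  have hov' : ‖inner ℂ (gaussL2 (W * a)) v‖ ^ 2 ≤ 48 * Λ ^ 4 * x ^ 16 * ‖u‖ ^ 2 := by
    refine hov.trans ?_
    gcongr
    have h1 : (a ^ 4)⁻¹ ≤ Λ ^ 4 := by
      rw [← inv_pow]
      gcongr
      exact (inv_le_comm₀ hΛ ha).1 h.inv_le
    calc 48 / ((W * a) ^ 4 * (x ^ 5) ^ 8) = 48 * (a ^ 4)⁻¹ * (W⁻¹ ^ 4 * (x ^ 40)⁻¹) := by field_simp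
      _ = 48 * (a ^ 4)⁻¹ * x ^ 16 := by
          rw [hs.eq]
          field_simp
      _ ≤ 48 * Λ ^ 4 * x ^ 16 := by gcongr
  have h1 : (1 - q ^ 2) * ‖inner ℂ (gaussL2 (W * a)) v‖ ^ 2 ≤ 48 * Λ ^ 4 * x ^ 16 * ‖u‖ ^ 2 := by
    refine le_trans (mul_le_of_le_one_left (sq_nonneg _) ?_) hov'
    linarith [sq_nonneg q]
  have hd1 : (1 + d) ^ 2 ≤ 2 := by
    calc (1 + d) ^ 2 ≤ (1 + 1 / 100) ^ 2 := by gcongr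
      _ ≤ 2 := by norm_num
  have hP : 0 ≤ 48 * Λ ^ 4 * x ^ 16 * ‖u‖ ^ 2 := by positivity
  calc ‖T v‖ ^ 2 ≤ ‖mehlerTop D (W * a)‖ ^ 2 * (q ^ 2 * ‖v‖ ^ 2 +
        (1 - q ^ 2) * ‖inner ℂ (gaussL2 (W * a)) v‖ ^ 2) := hgap
    _ ≤ ‖mehlerTop D (W * a)‖ ^ 2 * (q ^ 2 * ‖v‖ ^ 2 + 48 * Λ ^ 4 * x ^ 16 * ‖u‖ ^ 2) := by gcongr
    _ ≤ (μ * (1 + d)) ^ 2 * (q ^ 2 * ‖v‖ ^ 2 + 48 * Λ ^ 4 * x ^ 16 * ‖u‖ ^ 2) := by gcongr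
    _ = μ ^ 2 * (((1 + d) ^ 2 * q ^ 2) * ‖v‖ ^ 2 +
        (1 + d) ^ 2 * (48 * Λ ^ 4 * x ^ 16 * ‖u‖ ^ 2)) := by ring
    _ ≤ μ ^ 2 * (((1 - g) ^ 2 + 10 * d) * ‖v‖ ^ 2 + 2 * (48 * Λ ^ 4 * x ^ 16 * ‖u‖ ^ 2)) := by
        gcongr
    _ ≤ _ := by
        refine mul_le_mul_of_nonneg_left ?_ (sq_nonneg _)
        have h2 : 10 * d * ‖v‖ ^ 2 ≤ 10 * (Λ ^ 9 * x ^ 15) * ‖u‖ ^ 2 := by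
          rw [hd]
          have h3 : Λ ^ 3 ≤ Λ ^ 9 := pow_le_pow_right₀ hΛ1 (by norm_num)
          have h4 : x ^ 28 ≤ x ^ 15 := pow_le_pow_of_le_one hx.le hx1 (by norm_num)
          gcongr
        have h3 : 2 * (48 * Λ ^ 4 * x ^ 16 * ‖u‖ ^ 2) ≤ 2 * (48 * Λ ^ 9 * x ^ 15 * ‖u‖ ^ 2) := by
          have h3 : Λ ^ 4 ≤ Λ ^ 9 := pow_le_pow_right₀ hΛ1 (by norm_num)
          have h4 : x ^ 16 ≤ x ^ 15 := pow_le_pow_of_le_one hx.le hx1 (by norm_num)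
          gcongr
        have h5 : 0 ≤ Λ ^ 9 * x ^ 15 * ‖u‖ ^ 2 := by positivity
        linarith

set_option maxHeartbeats 1000000 in
/-- The transfer operator on the orthogonal complement of the Gaussian. -/
theorem norm_apply_le_of_orthogonal (h : SaddleData Λ a ζ U) {W x : ℝ} (hs : SmallScale Λ W x)
    {D : ℂ} (hD : 0 < D.re)
    (hsq : D ^ 2 = ((W : ℂ) ^ 2 * ζ ^ 2) ^ 2 + ((W * a : ℝ) : ℂ) ^ 2)
    {K T : L2R →L[ℂ] L2R} (hK : HasKernel K (transferKernel W ζ U))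
    (hT : HasKernel T (mehlerKernel ((W : ℂ) ^ 2 * ζ ^ 2) (D - (W : ℂ) ^ 2 * ζ ^ 2))) {u : L2R}
    (hu : inner ℂ (gaussL2 (W * a)) u = 0) :
    ‖K u‖ ≤ ‖mehlerTop ((W : ℂ) ^ 2 * ζ ^ 2) (W * a)‖ *
      (1 - a * (ζ ^ 2).re * x ^ 14 + 6 * 10 ^ 6 * Λ ^ 18 * x ^ 15) * ‖u‖ := by
  have hW := hs.W_pos
  have hΛ := h.pos
  have hΛ1 := h.one_le
  have hx := hs.pos
  have hx1 := hs.le_one hΛ1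
  have ha := h.a_pos
  have hκ := h.re_pos
  have hα : 0 < W * a := by positivity
  have hWi := hs.inv_sq
  have hR : 0 < x ^ 5 := pow_pos hx 5
  have hb : 0 < W ^ 2 * (ζ ^ 2).re / 2 := by positivity
  have hθc := continuous_cutoffAngle (x ^ 5)
  obtain ⟨v, hv⟩ := exists_mul_continuous
    (f := fun y => ((Real.cos (cutoffAngle (x ^ 5) y) : ℝ) : ℂ)) (by fun_prop)
    (fun y => norm_cos_le_one _) u
  obtain ⟨w, hw⟩ := exists_mul_continuous
    (f := fun y => ((Real.sin (cutoffAngle (x ^ 5) y) : ℝ) : ℂ)) (by fun_prop)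
    (fun y => norm_sin_le_one _) u
  have hsum := norm_sq_cos_add_norm_sq_sin hv hw
  have hims := norm_sq_le_of_partition hb (h.norm_transferKernel_le W) hK
    (cutoffAngle_lipschitz hR) hv hw
  have hvu : ‖v‖ ≤ ‖u‖ := le_of_sq_le_sq (by nlinarith [sq_nonneg ‖w‖]) (norm_nonneg _)
  -- the localization error
  have herr : (Real.pi / (2 * x ^ 5)) ^ 2 / (W ^ 2 * (ζ ^ 2).re / 2) *
      (Real.pi / (W ^ 2 * (ζ ^ 2).re / 2)) * ‖u‖ ^ 2 ≤ 64 * Λ ^ 2 * x ^ 46 * ‖u‖ ^ 2 := by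
    refine mul_le_mul_of_nonneg_right ?_ (sq_nonneg _)
    have h1 : (((ζ ^ 2).re) ^ 2)⁻¹ ≤ Λ ^ 2 := by
      rw [← inv_pow]
      have h2 : ((ζ ^ 2).re)⁻¹ ≤ Λ := (inv_le_comm₀ hΛ hκ).1 h.inv_le_re
      have h3 : 0 < ((ζ ^ 2).re)⁻¹ := inv_pos.2 hκ
      gcongr
    have hpi : Real.pi ^ 3 ≤ 64 := by
      have := Real.pi_lt_four.le
      have h0 := Real.pi_pos.le
      calc Real.pi ^ 3 ≤ 4 ^ 3 := by gcongr
        _ = 64 := by norm_num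
    calc _ = Real.pi ^ 3 * (((ζ ^ 2).re) ^ 2)⁻¹ * (((W ^ 2)⁻¹) ^ 2 * (x ^ 10)⁻¹) := by
          field_simp
      _ = Real.pi ^ 3 * (((ζ ^ 2).re) ^ 2)⁻¹ * x ^ 46 := by
          rw [hWi]
          field_simp
      _ ≤ 64 * Λ ^ 2 * x ^ 46 := by gcongr
  -- the part away from the saddle
  have htail := h.norm_le_of_support hW hR.le (pow_le_one₀ hx.le hx1) hK (v := w) (by
    filter_upwards [hw] with y hy hlt
    rw [hy, cutoffAngle_of_le hR hlt.le]
    simp)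
  -- the part near the saddle
  have hnear := h.norm_sub_le (h.one_le_W hs) hD hsq hK hT (u := v)
    (w := ((9 * x ^ 15 : ℝ) : ℂ) • u) (by
      filter_upwards [hv, Lp.coeFn_smul ((9 * x ^ 15 : ℝ) : ℂ) u] with y h1 h2
      rw [h2, Pi.smul_apply, norm_smul, Complex.norm_real, Real.norm_of_nonneg (by positivity),
        hWi]
      -- The cut-off function vanishes beyond $2R$; inside, the weight is at most
      -- $8x^{15}+x^{28}\le9x^{15}$.
      rcases le_or_gt (2 * x ^ 5) |y| with hy | hy
      · rw [h1, cutoffAngle_of_ge hR hy]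
        simp only [Real.cos_pi_div_two, Complex.ofReal_zero, zero_mul, norm_zero, mul_zero]
        positivity
      · have h3 : ‖v y‖ ≤ ‖u y‖ := by
          rw [h1, norm_mul]
          exact mul_le_of_le_one_left (norm_nonneg _) (norm_cos_le_one _)
        have h4 : |y| ^ 3 ≤ (2 * x ^ 5) ^ 3 := by gcongr
        have h5 : x ^ 28 ≤ x ^ 15 := pow_le_pow_of_le_one hx.le hx1 (by norm_num)
        have h6 : |y| ^ 3 + x ^ 28 ≤ 9 * x ^ 15 := by
          have : (2 * x ^ 5) ^ 3 = 8 * x ^ 15 := by ring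
          linarith
        gcongr)
  rw [norm_smul, Complex.norm_real, Real.norm_of_nonneg (by positivity), hs.eq] at hnear
  have hTv := h.norm_sq_mehler_cutoff_le hs hD hsq hT hu hv
  have hTv' : ‖T v‖ ≤ 2 * x ^ 14 * ‖u‖ := by
    have h1 := norm_mehler_le hα hD hsq hT v
    have h2 := norm_mehlerTop_le (h.coeff_re_pos hW) hα hD hsq
    rw [h.norm_coeff] at h2
    have h3 : Real.sqrt (Real.pi / W ^ 2) ≤ 2 * x ^ 14 := by
      rw [Real.sqrt_le_left (by positivity), div_eq_mul_inv, hWi]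
      have h4 : 0 < x ^ 28 := by positivity
      have h5 : (2 * x ^ 14) ^ 2 = 4 * x ^ 28 := by ring
      rw [h5]
      gcongr
      exact Real.pi_lt_four.le
    calc ‖T v‖ ≤ ‖mehlerTop D (W * a)‖ * ‖v‖ := h1
      _ ≤ _ := by
        gcongr
        exact h2.trans h3
  obtain ⟨hμ14, hμ28⟩ := h.le_norm_top hs
  rw [div_eq_mul_inv, hWi] at htail
  set μ := ‖mehlerTop ((W : ℂ) ^ 2 * ζ ^ 2) (W * a)‖ with hμ
  set κ := (ζ ^ 2).re
  set g := a * κ * x ^ 14 with hg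
  have hμ0 : 0 ≤ μ := norm_nonneg _
  have hg0 : 0 < g := by positivity
  have hgΛ : g ≤ Λ * x ^ 14 := by
    have h1 : a * κ ≤ Λ * 1 := mul_le_mul h.le h.re_le_one hκ.le hΛ.le
    rw [mul_one] at h1
    rw [hg]
    gcongr
  have hμ2 : x ^ 28 ≤ μ ^ 2 := by
    calc x ^ 28 = (x ^ 14) ^ 2 := by ring
      _ ≤ μ ^ 2 := by gcongr
  have hsm1 := hs.pow_mul_le hΛ1 (m := 1) (n := 14) (by norm_num) (by norm_num)
  rw [pow_one] at hsm1
  have hΛx : 0 < Λ * x ^ 14 := by positivity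
  have hw2 : ‖K w‖ ^ 2 ≤ μ ^ 2 * ((1 - g) ^ 2 * ‖w‖ ^ 2) := by
    -- With $t=\Lambda^{-1}x^{10}$ and $p=\Lambda x^{14}$, smallness of $x$ gives $t\ge5p$. Then
    -- $(1+t)(1-2p)\ge1+p$, so the decay at the cutoff radius beats the gap and the correction to
    -- $|\mu|^2$.
    have h1 : Real.exp (-(Λ⁻¹ * (x ^ 5) ^ 2)) * (1 + Λ * x ^ 14) ≤ (1 - g) ^ 2 := by
      have ht : 0 < Λ⁻¹ * (x ^ 5) ^ 2 := by positivity
      rw [Real.exp_neg, inv_mul_le_iff₀ (Real.exp_pos _)]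
      have h2 : 1 + Λ⁻¹ * (x ^ 5) ^ 2 ≤ Real.exp (Λ⁻¹ * (x ^ 5) ^ 2) := by
        linarith [Real.add_one_le_exp (Λ⁻¹ * (x ^ 5) ^ 2)]
      have h3 : 1 - 2 * (Λ * x ^ 14) ≤ (1 - g) ^ 2 := by nlinarith [sq_nonneg g]
      have h4 : 5 * (Λ * x ^ 14) ≤ Λ⁻¹ * (x ^ 5) ^ 2 := by
        have h5 := hs.pow_mul_le hΛ1 (m := 2) (n := 4) (by norm_num) (by norm_num)
        have h6 : 0 < Λ ^ 2 * x ^ 4 := by positivity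
        calc 5 * (Λ * x ^ 14) = (5 * (Λ ^ 2 * x ^ 4)) * (Λ⁻¹ * (x ^ 5) ^ 2) := by field_simp
          _ ≤ 1 * (Λ⁻¹ * (x ^ 5) ^ 2) := by gcongr; linarith
          _ = _ := one_mul _
      have h7 : 1 + Λ * x ^ 14 ≤ (1 + Λ⁻¹ * (x ^ 5) ^ 2) * (1 - 2 * (Λ * x ^ 14)) := by
        generalize Λ * x ^ 14 = p at *
        generalize Λ⁻¹ * (x ^ 5) ^ 2 = t at *
        have : t * (5 * p) ≤ t * 1 := mul_le_mul_of_nonneg_left (by linarith) ht.le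
        linarith
      refine h7.trans ?_
      have h8 : 0 ≤ 1 - 2 * (Λ * x ^ 14) := by linarith
      gcongr
    calc ‖K w‖ ^ 2 ≤ Real.pi * x ^ 28 * Real.exp (-(Λ⁻¹ * (x ^ 5) ^ 2)) * ‖w‖ ^ 2 := htail
      _ ≤ μ ^ 2 * (1 + Λ * x ^ 14) * Real.exp (-(Λ⁻¹ * (x ^ 5) ^ 2)) * ‖w‖ ^ 2 := by gcongr
      _ = μ ^ 2 * ((Real.exp (-(Λ⁻¹ * (x ^ 5) ^ 2)) * (1 + Λ * x ^ 14)) * ‖w‖ ^ 2) := by ring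
      _ ≤ _ := by gcongr
  have hv2 : ‖K v‖ ^ 2 ≤ ‖T v‖ ^ 2 + 5 * 10 ^ 6 * Λ ^ 18 * x ^ 43 * ‖u‖ ^ 2 := by
    set η := 2160 * Λ ^ 9 * x ^ 29 * ‖u‖ with hη
    have hη0 : 0 ≤ η := by positivity
    have h1 : ‖K v‖ ≤ ‖T v‖ + η := by
      have h2 : K v = T v + (K v - T v) := by abel
      rw [h2]
      refine (norm_add_le _ _).trans ?_
      have h3 : 240 * Λ ^ 9 * x ^ 14 * (9 * x ^ 15 * ‖u‖) = η := by rw [hη]; ring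
      linarith
    have h2 : ‖K v‖ ^ 2 ≤ (‖T v‖ + η) ^ 2 := by gcongr
    -- After squaring, the cross term must be $O(x^{28}x^{15})$: it is the product of
    -- $\|Tv\|=O(x^{14})$ and $\eta=O(x^{29})$.
    have h3 : ‖T v‖ * η ≤ 2 * x ^ 14 * ‖u‖ * η := by gcongr
    have h4 : 2 * x ^ 14 * ‖u‖ * η = 4320 * Λ ^ 9 * x ^ 43 * ‖u‖ ^ 2 := by rw [hη]; ring
    have h5 : 4320 * Λ ^ 9 * x ^ 43 * ‖u‖ ^ 2 ≤ 4320 * Λ ^ 18 * x ^ 43 * ‖u‖ ^ 2 := by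
      have : Λ ^ 9 ≤ Λ ^ 18 := pow_le_pow_right₀ hΛ1 (by norm_num)
      gcongr
    have h6 : η ^ 2 ≤ 4665600 * Λ ^ 18 * x ^ 43 * ‖u‖ ^ 2 := by
      have h7 : x ^ 58 ≤ x ^ 43 := pow_le_pow_of_le_one hx.le hx1 (by norm_num)
      calc η ^ 2 = 4665600 * Λ ^ 18 * x ^ 58 * ‖u‖ ^ 2 := by rw [hη]; ring
        _ ≤ _ := by gcongr
    have h8 : 0 ≤ Λ ^ 18 * x ^ 43 * ‖u‖ ^ 2 := by positivity
    have h9 : (‖T v‖ + η) ^ 2 = ‖T v‖ ^ 2 + 2 * (‖T v‖ * η) + η ^ 2 := by ring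
    linarith
  have hE1 : 5 * 10 ^ 6 * Λ ^ 18 * x ^ 43 * ‖u‖ ^ 2 ≤
      μ ^ 2 * (5 * 10 ^ 6 * (Λ ^ 18 * x ^ 15 * ‖u‖ ^ 2)) := by
    calc _ = x ^ 28 * (5 * 10 ^ 6 * (Λ ^ 18 * x ^ 15 * ‖u‖ ^ 2)) := by ring
      _ ≤ _ := by gcongr
  have hE2 : 64 * Λ ^ 2 * x ^ 46 * ‖u‖ ^ 2 ≤ μ ^ 2 * (64 * (Λ ^ 18 * x ^ 15 * ‖u‖ ^ 2)) := by
    have h1 : Λ ^ 2 ≤ Λ ^ 18 := pow_le_pow_right₀ hΛ1 (by norm_num)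
    have h2 : x ^ 18 ≤ x ^ 15 := pow_le_pow_of_le_one hx.le hx1 (by norm_num)
    calc _ = x ^ 28 * (64 * (Λ ^ 2 * x ^ 18 * ‖u‖ ^ 2)) := by ring
      _ ≤ _ := by gcongr
  have hE3 : 200 * Λ ^ 9 * x ^ 15 * ‖u‖ ^ 2 ≤ 200 * (Λ ^ 18 * x ^ 15 * ‖u‖ ^ 2) := by
    have h1 : Λ ^ 9 ≤ Λ ^ 18 := pow_le_pow_right₀ hΛ1 (by norm_num)
    rw [← mul_assoc, ← mul_assoc]
    gcongr
  set Q := Λ ^ 18 * x ^ 15 * ‖u‖ ^ 2 with hQ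
  have hQ0 : 0 ≤ Q := by positivity
  have htot : ‖K u‖ ^ 2 ≤ μ ^ 2 * ((1 - g) ^ 2 * ‖u‖ ^ 2 + 6 * 10 ^ 6 * Q) := by
    have h1 : μ ^ 2 * ((1 - g) ^ 2 * ‖v‖ ^ 2 + 200 * Λ ^ 9 * x ^ 15 * ‖u‖ ^ 2) ≤
        μ ^ 2 * ((1 - g) ^ 2 * ‖v‖ ^ 2 + 200 * Q) := by gcongr
    have h2 : ‖K u‖ ^ 2 ≤ μ ^ 2 * ((1 - g) ^ 2 * ‖v‖ ^ 2 + 200 * Q) + μ ^ 2 * (5 * 10 ^ 6 * Q) +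
        μ ^ 2 * ((1 - g) ^ 2 * ‖w‖ ^ 2) + μ ^ 2 * (64 * Q) := by linarith
    refine h2.trans ?_
    rw [← hsum]
    have : 0 ≤ μ ^ 2 * Q := by positivity
    linarith
  set P := 6 * 10 ^ 6 * Λ ^ 18 * x ^ 15 with hP
  have hP0 : 0 ≤ P := by positivity
  have hfin : ‖K u‖ ^ 2 ≤ (μ * (1 - g + P) * ‖u‖) ^ 2 := by
    refine htot.trans ?_
    have h1 : (1 - g) ^ 2 * ‖u‖ ^ 2 + 6 * 10 ^ 6 * Q = ((1 - g) ^ 2 + P) * ‖u‖ ^ 2 := by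
      rw [hQ, hP]; ring
    -- Taking the square root costs nothing since $2(1-g)\ge1$.
    have h2 : (1 - g) ^ 2 + P ≤ (1 - g + P) ^ 2 := by nlinarith
    rw [h1]
    calc μ ^ 2 * (((1 - g) ^ 2 + P) * ‖u‖ ^ 2) ≤ μ ^ 2 * ((1 - g + P) ^ 2 * ‖u‖ ^ 2) := by gcongr
      _ = _ := by ring
  refine le_of_sq_le_sq hfin ?_
  have : 0 ≤ 1 - g + P := by linarith
  positivity

end SaddleData

/-! ### Uniform constants and the conclusion. -/

/-- Writing $p=\zeta^2U''(0)$, one has $U''(0)=p\,\overline{\zeta^2}$, so (U3) says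
$p\operatorname{Re}\zeta^2/2\ge1/C_1$ while (U4) gives $p\le M$. Thus $\operatorname{Re}\zeta^2$ is
bounded below uniformly, although it is only assumed positive, and `a` lies in a compact subset of
$(0,\infty)$. -/
theorem exists_saddleData {C₁ C₂ c : ℝ} (hC₁ : 0 < C₁) (hC₂ : 0 < C₂) (hc : 0 < c) :
    ∃ Λ : ℝ, 1 ≤ Λ ∧ ∀ (γ : ℝ) (ζ : ℂ) (U : ℝ → ℂ), ‖ζ‖ = 1 → 0 < (ζ ^ 2).re →
      AdmissiblePotential γ C₁ C₂ c ζ U →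
      SaddleData Λ (Real.sqrt ((ζ ^ 2 * iteratedDeriv 2 U 0).re / 2)) ζ U ∧
      Real.sqrt (‖iteratedDeriv 2 U 0‖ / 2) =
        Real.sqrt ((ζ ^ 2 * iteratedDeriv 2 U 0).re / 2) := by
  obtain ⟨M, r, hr0, hr1, hM, hall⟩ := AdmissiblePotential.quadratic_approx (C₁ := C₁) hC₂ hc
  set Λ := M + C₁ + C₁ * M + r⁻¹ with hΛdef
  have hM0 : 0 < M := by linarith
  have hCM : 0 < C₁ * M := mul_pos hC₁ hM0
  have hri : 0 < r⁻¹ := inv_pos.2 hr0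
  have hΛ1 : 1 ≤ Λ := by linarith
  have hΛ0 : 0 < Λ := by linarith
  have hΛCM : C₁ * M ≤ Λ := by linarith
  have hΛC : C₁ ≤ Λ := by linarith
  have hΛM : M ≤ Λ := by linarith
  have hΛr : r⁻¹ ≤ Λ := by linarith
  refine ⟨Λ, hΛ1, fun γ ζ U hζ hκ hU => ?_⟩
  obtain ⟨h1, h2, h3⟩ := hall γ ζ U hζ hU
  have hpos := hU.second_deriv_pos
  set p := (ζ ^ 2 * iteratedDeriv 2 U 0).re with hp
  have hreal : ζ ^ 2 * iteratedDeriv 2 U 0 = (p : ℂ) :=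
    Complex.ext (by simp [hp]) (by simp [hU.second_deriv_real])
  have hz : (starRingEnd ℂ) (ζ ^ 2) * ζ ^ 2 = 1 := by
    rw [mul_comm, Complex.mul_conj, Complex.normSq_eq_norm_sq, norm_pow, hζ]
    simp
  have hU2 : iteratedDeriv 2 U 0 = (p : ℂ) * (starRingEnd ℂ) (ζ ^ 2) := by
    rw [← hreal]
    linear_combination (-iteratedDeriv 2 U 0) * hz
  have hnorm : ‖iteratedDeriv 2 U 0‖ = p := by
    rw [hU2, norm_mul, RCLike.norm_conj, norm_pow, hζ, Complex.norm_real,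
      Real.norm_of_nonneg hpos.le]
    simp
  refine ⟨?_, by rw [hnorm]⟩
  have ha2 : Real.sqrt (p / 2) ^ 2 = p / 2 := Real.sq_sqrt (by positivity)
  have ha0 : 0 ≤ Real.sqrt (p / 2) := Real.sqrt_nonneg _
  set a := Real.sqrt (p / 2)
  have hκ1 : (ζ ^ 2).re ≤ 1 := by
    refine (Complex.re_le_norm _).trans ?_
    rw [norm_pow, hζ, one_pow]
  have hpre : (iteratedDeriv 2 U 0).re = p * (ζ ^ 2).re := by
    rw [hU2, Complex.re_ofReal_mul, Complex.conj_re]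
  rw [hpre] at h2
  rw [hnorm] at h1
  have hCpos : 0 < 1 / C₁ := by positivity
  have hCΛ : Λ⁻¹ ≤ 1 / C₁ := by
    rw [one_div]
    gcongr
  have haC : 1 / C₁ ≤ a ^ 2 := by
    have : p * (ζ ^ 2).re ≤ p * 1 := by gcongr
    linarith
  refine ⟨hΛ1, hζ, ?_, ?_, ?_, hU.smooth.continuous, fun x => ?_, fun x hx => ?_⟩
  · have h4 : (C₁ * M)⁻¹ ≤ (ζ ^ 2).re := by
      rw [inv_le_iff_one_le_mul₀ hCM]
      have h5 : p * (ζ ^ 2).re ≤ M * (ζ ^ 2).re := by gcongr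
      have h6 : 1 / C₁ ≤ M * (ζ ^ 2).re := by
        have : 0 < M * (ζ ^ 2).re := by positivity
        linarith
      rw [div_le_iff₀ hC₁] at h6
      linarith
    refine le_trans ?_ h4
    gcongr
  · refine le_of_sq_le_sq (le_trans ?_ haC) ha0
    refine le_trans ?_ hCΛ
    have h4 : Λ⁻¹ ≤ 1 := inv_le_one_of_one_le₀ hΛ1
    have h5 : 0 < Λ⁻¹ := inv_pos.2 hΛ0
    nlinarith
  · refine le_of_sq_le_sq ?_ hΛ0.le
    nlinarith
  · refine le_trans ?_ (hU.lower_bound x)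
    rw [sq_abs]
    gcongr
  · have h4 : |x| < r := hx.trans_le ((inv_le_comm₀ hr0 hΛ0).1 hΛr)
    have h5 : (a : ℂ) ^ 2 * (starRingEnd ℂ) (ζ ^ 2) * (x : ℂ) ^ 2 =
        iteratedDeriv 2 U 0 / 2 * (x : ℂ) ^ 2 := by
      rw [hU2, ← Complex.ofReal_pow, ha2]
      push_cast
      ring
    rw [h5]
    refine (h3 x h4).trans ?_
    gcongr

theorem norm_pow_apply_le_of_mapsTo {K : L2R →L[ℂ] L2R} {S : Submodule ℂ L2R} {b : ℝ}
    (hS : ∀ u ∈ S, K u ∈ S) (hb : 0 ≤ b) (hK : ∀ u ∈ S, ‖K u‖ ≤ b * ‖u‖) (n : ℕ) :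
    ∀ u ∈ S, ‖(K ^ n) u‖ ≤ b ^ n * ‖u‖ := by
  induction n with
  | zero => intro u _; simp
  | succ n ih =>
    intro u hu
    rw [pow_succ, mul_apply_eq_comp]
    refine (ih _ (hS u hu)).trans ?_
    rw [pow_succ, mul_assoc]
    gcongr
    exact hK u hu

namespace SaddleData

theorem SmallScale.of_le {Λ W : ℝ} (hΛ : 1 ≤ Λ) (hW : (10 ^ 7 * Λ ^ 20) ^ 14 ≤ W) :
    SmallScale Λ W (W ^ (-(1 / 14) : ℝ)) := by
  have hB : 0 < 10 ^ 7 * Λ ^ 20 := by positivity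
  have hW0 : 0 < W := lt_of_lt_of_le (by positivity) hW
  refine ⟨Real.rpow_pos_of_pos hW0 _, ?_, ?_⟩
  · rw [Real.rpow_neg hW0.le, ← div_eq_mul_inv, div_le_one (Real.rpow_pos_of_pos hW0 _)]
    rw [one_div, Real.le_rpow_inv_iff_of_pos hB.le hW0.le (by norm_num)]
    exact_mod_cast hW
  · rw [← Real.rpow_natCast, ← Real.rpow_mul hW0.le, ← Real.rpow_neg_one]
    norm_num

variable {Λ a : ℝ} {ζ : ℂ} {U : ℝ → ℂ}

/-- The size of the gap and of the errors at a small scale. -/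
theorem gap_bounds (h : SaddleData Λ a ζ U) {W x : ℝ} (hs : SmallScale Λ W x) {e θ : ℝ}
    (he : e = 1300 * Λ ^ 11 * x ^ 15)
    (hθ : θ = a * (ζ ^ 2).re * x ^ 14 - 6 * 10 ^ 6 * Λ ^ 18 * x ^ 15) :
    0 ≤ e ∧ θ ≤ 1 / 2 ∧ 64 * e ≤ θ ∧ 0 < θ ∧ 2 * e ≤ 10 ^ 7 * Λ ^ 18 * x ^ 15 ∧
      8 * e / θ ≤ 10 ^ 7 * Λ ^ 18 * x ∧
      1 - θ + 8 * e ≤ 1 - a * (ζ ^ 2).re * x ^ 14 + 10 ^ 7 * Λ ^ 18 * x ^ 15 := by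
  have hΛ1 := h.one_le
  have hΛ := h.pos
  have hx := hs.pos
  have ha := h.a_pos
  have hκ := h.re_pos
  have hx14 : 0 < x ^ 14 := by positivity
  have hQ : 0 < Λ ^ 18 * x ^ 15 := by positivity
  have hi : 0 < Λ⁻¹ := inv_pos.2 hΛ
  have he0 : 0 ≤ e := by rw [he]; positivity
  have heQ : e ≤ 1300 * (Λ ^ 18 * x ^ 15) := by
    have h1 : Λ ^ 11 ≤ Λ ^ 18 := pow_le_pow_right₀ hΛ1 (by norm_num)
    rw [he, mul_assoc]
    gcongr
  -- The exponent $20=18+2$ in `SmallScale` comes from here: the error carries $\Lambda^{18}$, and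
  -- the gap is only known to be at least $\Lambda^{-2}x^{14}$.
  have hlow : 10 ^ 7 * (Λ ^ 18 * x ^ 15) ≤ a * (ζ ^ 2).re * x ^ 14 := by
    calc 10 ^ 7 * (Λ ^ 18 * x ^ 15) = 10 ^ 7 * Λ ^ 20 * x * (Λ⁻¹ * Λ⁻¹ * x ^ 14) := by
          field_simp
      _ ≤ 1 * (Λ⁻¹ * Λ⁻¹ * x ^ 14) := by
          have := hs.small
          gcongr
      _ ≤ a * (ζ ^ 2).re * x ^ 14 := by
          have := h.inv_le
          have := h.inv_le_re
          rw [one_mul]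
          gcongr
  have hlow2 : Λ⁻¹ * Λ⁻¹ * x ^ 14 ≤ a * (ζ ^ 2).re * x ^ 14 := by
    have := h.inv_le
    have := h.inv_le_re
    gcongr
  have hup : a * (ζ ^ 2).re * x ^ 14 ≤ Λ * x ^ 14 := by
    have h1 : a * (ζ ^ 2).re ≤ Λ * 1 := mul_le_mul h.le h.re_le_one hκ.le hΛ.le
    rw [mul_one] at h1
    gcongr
  have hsm := hs.pow_mul_le hΛ1 (m := 1) (n := 14) (by norm_num) (by norm_num)
  rw [pow_one] at hsm
  have hθ0 : 0 < θ := by rw [hθ]; linarith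
  have hθ4 : 4 / 10 * (Λ⁻¹ * Λ⁻¹ * x ^ 14) ≤ θ := by rw [hθ]; linarith
  refine ⟨he0, ?_, ?_, hθ0, by linarith, ?_, ?_⟩
  · have : 0 < Λ * x ^ 14 := by positivity
    rw [hθ]; linarith
  · rw [hθ]; linarith
  · rw [div_le_iff₀ hθ0]
    calc 8 * e ≤ 10 ^ 6 * (Λ ^ 13 * x ^ 15) := by
          have h1 : 0 < Λ ^ 13 * x ^ 15 := by positivity
          have h2 : Λ ^ 11 * x ^ 15 ≤ Λ ^ 13 * x ^ 15 := by
            have h3 : Λ ^ 11 ≤ Λ ^ 13 := pow_le_pow_right₀ hΛ1 (by norm_num)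
            gcongr
          rw [he]; linarith
      _ ≤ 10 ^ 6 * (Λ ^ 16 * x ^ 15) := by
          have h3 : Λ ^ 13 ≤ Λ ^ 16 := pow_le_pow_right₀ hΛ1 (by norm_num)
          gcongr
      _ ≤ 4 * (10 ^ 6 * (Λ ^ 16 * x ^ 15)) :=
          le_mul_of_one_le_left (by positivity) (by norm_num)
      _ = 10 ^ 7 * Λ ^ 18 * x * (4 / 10 * (Λ⁻¹ * Λ⁻¹ * x ^ 14)) := by
          field_simp
      _ ≤ _ := by gcongr
  · rw [hθ]; linarith

end SaddleData

open SaddleData in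
theorem corollary1 (γ : ℝ) (hγ : 1 < γ) :
    ∃ δ : ℝ, 0 < δ ∧
      ∀ C₁ C₂ c : ℝ, 0 < C₁ → 0 < C₂ → 0 < c →
        ∃ C W₀ : ℝ, 0 < C ∧ 0 < W₀ ∧
          ∀ (ζ : ℂ) (U : ℝ → ℂ) (W : ℝ), ‖ζ‖ = 1 → 0 < (ζ ^ 2).re →
            AdmissiblePotential γ C₁ C₂ c ζ U → W₀ ≤ W →
            ∃ K : L2R →L[ℂ] L2R, HasKernel K (transferKernel W ζ U) ∧
              ∃ l₀ : ℂ,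
                Module.End.HasEigenvalue (K : L2R →ₗ[ℂ] L2R) l₀ ∧
                (∀ l : ℂ, Module.End.HasEigenvalue (K : L2R →ₗ[ℂ] L2R) l → l ≠ l₀ →
                  ‖l‖ < ‖l₀‖) ∧
                Module.finrank ℂ (Module.End.eigenspace (K : L2R →ₗ[ℂ] L2R) l₀) = 1 ∧
                (∃ ε : ℂ, ‖ε‖ ≤ C * W ^ (-1 - δ) ∧ l₀ = saddleMu W ζ U * (1 + ε)) ∧
                ∃ u₀ : L2R,
                  IsNormalizedEigenfunction K (gaussL2 (saddleAlpha W ζ U)) l₀ u₀ ∧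
                  (∀ v : L2R,
                    IsNormalizedEigenfunction K (gaussL2 (saddleAlpha W ζ U)) l₀ v → v = u₀) ∧
                  ‖u₀ - gaussL2 (saddleAlpha W ζ U)‖ ≤ C * W ^ (-δ) ∧
                  (∀ u ∈ conjPerp u₀, K u ∈ conjPerp u₀) ∧
                  ∀ (n : ℕ), ∀ u ∈ conjPerp u₀,
                    ‖(K ^ n) u‖ ≤ ‖l₀‖ ^ n *
                      (1 - Real.sqrt (‖iteratedDeriv 2 U 0‖ / 2) * (ζ ^ 2).re / W
                        + C * W ^ (-1 - δ)) ^ n * ‖u‖ := by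
  -- With $x=W^{-1/14}$ the bounds $x^{15}$ and $x$ become $W^{-1-\delta}$ and $W^{-\delta}$.
  refine ⟨1 / 14, by norm_num, fun C₁ C₂ c hC₁ hC₂ hc => ?_⟩
  obtain ⟨Λ, hΛ1, hall⟩ := exists_saddleData hC₁ hC₂ hc
  have hΛ : 0 < Λ := by linarith
  refine ⟨10 ^ 7 * Λ ^ 18, (10 ^ 7 * Λ ^ 20) ^ 14, by positivity, by positivity,
    fun ζ U W hζ hκ hU hW => ?_⟩
  obtain ⟨h, hsqrt⟩ := hall γ ζ U hζ hκ hU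
  have hs := SmallScale.of_le hΛ1 hW
  have hα_eq : saddleAlpha W ζ U = W * Real.sqrt ((ζ ^ 2 * iteratedDeriv 2 U 0).re / 2) := rfl
  rw [hsqrt, saddleMu_eq_mehlerTop hα_eq, hα_eq]
  generalize Real.sqrt ((ζ ^ 2 * iteratedDeriv 2 U 0).re / 2) = a at h
  have hW0 := hs.W_pos
  have hx0 := hs.pos
  have hx15 : W ^ (-1 - 1 / 14 : ℝ) = (W ^ (-(1 / 14) : ℝ)) ^ 15 := by
    rw [← Real.rpow_natCast, ← Real.rpow_mul hW0.le]
    norm_num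
  rw [hx15, div_eq_mul_inv _ W, hs.eq]
  set x := W ^ (-(1 / 14) : ℝ)
  have hα : 0 < W * a := mul_pos hW0 h.a_pos
  have hA := h.coeff_re_pos hW0
  have hb : 0 < W ^ 2 * (ζ ^ 2).re / 2 := by positivity
  obtain ⟨D, hD, hsq⟩ := exists_mehler_param (α := W * a) hA
  have hcont := h.continuous_transferKernel W
  have hbd := h.norm_transferKernel_le' W
  obtain ⟨K, hK, -⟩ := exists_hasKernel hb hcont hbd
  obtain ⟨T, hT, -⟩ := exists_hasKernel hA
    (continuous_mehlerKernel ((W : ℂ) ^ 2 * ζ ^ 2) (D - (W : ℂ) ^ 2 * ζ ^ 2))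
    (norm_mehlerKernel_le (by
      rw [Complex.sub_re, sub_nonneg]
      exact re_le_of_sq_eq hD hsq))
  have hsym : ∀ x y, transferKernel W ζ U x y = transferKernel W ζ U y x := fun x y => by
    unfold transferKernel
    congr 1
    ring
  obtain ⟨he0, hθ2, heθ, hθ0, h2e, h8e, hgap⟩ := h.gap_bounds hs rfl rfl
  have hμ0 : mehlerTop ((W : ℂ) ^ 2 * ζ ^ 2) (W * a) ≠ 0 :=
    norm_pos_iff.1 (lt_of_lt_of_le (by positivity) (h.le_norm_top hs).1)
  obtain ⟨l₀, hl₀, hdom, hdim, ⟨ε, hε, hlε⟩, u₀, hu₀, huniq, hclose, hinv, hbound⟩ :=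
    spectral_gap_consequences (norm_gaussL2 hα) (star_gaussL2 hα)
      (hK.inner_star_symm hb hcont hbd hsym) hμ0 he0 hθ2 heθ hθ0
      (h.norm_apply_gauss_sub_le hs hD hsq hK hT) (fun u hu => by
        refine (h.norm_apply_le_of_orthogonal hs hD hsq hK hT hu).trans (le_of_eq ?_)
        ring)
  refine ⟨K, hK, l₀, hl₀, hdom, hdim, ⟨ε, hε.trans h2e, hlε⟩, u₀, hu₀, huniq,
    hclose.trans h8e, hinv, fun n u hu => ?_⟩
  rw [← mul_pow]
  refine norm_pow_apply_le_of_mapsTo hinv (mul_nonneg (norm_nonneg _) ?_) (fun v hv => ?_) n u hu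
  · linarith
  · refine (hbound v hv).trans ?_
    gcongr
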